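/- Theorem 1. An instance of the parametric weight knapsack problem consists of $n\ge 1$ items with profits $p_i\in\mathbb{N}_{>0}$ and weights $w_i(\lambda)=a_i+\lambda b_i$, $a_i,b_i\in\mathbb{Z}$, depending on a parameter $\lambda\in\mathbb{R}$, and of a capacity $W\in\mathbb{N}$. For $\lambda\in\mathbb{R}$ let $p^*(\lambda)$ be the maximum of $\sum_i p_i x_i$ over all $x\in\{0,1\}^n$ with $\sum_i w_i(\lambda)x_i\le W$, and let $M=\max\{W,\; n\cdot\max_i\max\{|a_i|,|b_i|\}\}$. There is a fully polynomial-time approximation scheme for this problem, that is, an algorithm which, given an instance and a rational $\varepsilon\in(0,1)$, computes a partition of the real line into finitely many intervals, given by rational breakpoints $\lambda_1<\dots<\lambda_k$ ($k\ge 0$) and, for each breakpoint, the information to which of its two adjacent intervals it belongs, together with one vector $x\in\{0,1\}^n$ for each interval such that, for every $\lambda$ in the interval, $\sum_i w_i(\lambda)x_i\le W$ and $\sum_i p_i x_i\ge(1-\varepsilon)\,p^*(\lambda)$; its running time is polynomial in the encoding length of the instance and in $1/\varepsilon$. More precisely, its running time is $$\mathcal{O}\!\left(\frac{n^5}{\varepsilon^2}\cdot\min\left\{\log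 M,\ \frac{n\log(n/\varepsilon)}{\log\bigl(n\log(n/\varepsilon)\bigr)}\right\}\right),$$ where the minimum is to be read as $1$ whenever it is smaller than $1$. The model of computation is the random access machine with unit-cost integer arithmetic ($+$, $-$, $\cdot$, integer division, comparison, indirect addressing), and all integers that occur during the computation are bounded by a polynomial in $n$, $W$, the $p_i$, $|a_i|$, $|b_i|$ and the denominator of $\varepsilon$. -/

import Mathlib

/-! ## The parametric weight knapsack problem -/

/-- An instance: `n ≥ 1` items with profits `p i ∈ ℕ_{>0}` and weights `a i + lam * b i`
(`a i, b i ∈ ℤ`), and a capacity `W ∈ ℕ`. -/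
structure ParamKnapsack where
  n : ℕ
  n_pos : 0 < n
  W : ℕ
  p : Fin n → ℕ
  p_pos : ∀ i, 0 < p i
  a : Fin n → ℤ
  b : Fin n → ℤ

namespace ParamKnapsack

/-- The set `s` of packed items fits into the knapsack at the parameter value `lam`. -/
def Feasible (I : ParamKnapsack) (lam : ℝ) (s : Finset (Fin I.n)) : Prop :=
  ∑ i ∈ s, ((I.a i : ℝ) + lam * (I.b i : ℝ)) ≤ (I.W : ℝ)

/-- The profit of a set of items. -/
def profit (I : ParamKnapsack) (s : Finset (Fin I.n)) : ℕ := ∑ i ∈ s, I.p i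

open Classical in
/-- The optimal profit at `lam`: a maximum over the feasible sets, among which is `∅`
because `W ≥ 0`. -/
noncomputable def optProfit (I : ParamKnapsack) (lam : ℝ) : ℕ :=
  (Finset.univ.filter fun s : Finset (Fin I.n) => I.Feasible lam s).sup I.profit

/-- `M = max {W, n * max_i {|a i|, |b i|}}`. -/
def bigM (I : ParamKnapsack) : ℕ :=
  max I.W (I.n * Finset.univ.sup fun i => max (I.a i).natAbs (I.b i).natAbs)

/-- The binary encoding length of an instance, up to constant factors. -/
def encodingLength (I : ParamKnapsack) : ℕ :=
  I.n + Nat.size I.W +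
    ∑ i, (Nat.size (I.p i) + Nat.size (I.a i).natAbs + Nat.size (I.b i).natAbs)

/-- The magnitude of the numbers in the input (an instance and a precision). -/
def magnitude (I : ParamKnapsack) (ε : ℚ) : ℕ :=
  I.n + I.W + ∑ i, (I.p i + (I.a i).natAbs + (I.b i).natAbs) + ε.den

/-! ## Parametric solutions -/

/-- Breakpoints `lam_0 < ... < lam_{k-1}`, which cut the real line into `k + 1` intervals,
and one item set for each interval. `left i` says whether the breakpoint `lam_i` belongs to the
interval on its left (`true`) or to the one on its right (`false`). -/
structure ParamSolution (n : ℕ) where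
  k : ℕ
  breakpoint : Fin k → ℚ
  strictMono : StrictMono breakpoint
  left : Fin k → Bool
  sol : Fin (k + 1) → Finset (Fin n)

/-- The `j`-th of the `k + 1` intervals: it lies to the right of the breakpoints with index `< j`
and to the left of those with index `≥ j`. -/
def ParamSolution.interval {n : ℕ} (S : ParamSolution n) (j : Fin (S.k + 1)) : Set ℝ :=
  {lam | ∀ i : Fin S.k,
    (i.val < j.val →
      (S.breakpoint i : ℝ) < lam ∨ ((S.breakpoint i : ℝ) = lam ∧ S.left i = false)) ∧
    (j.val ≤ i.val →
      lam < (S.breakpoint i : ℝ) ∨ (lam = (S.breakpoint i : ℝ) ∧ S.left i = true))}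

/-- Each item set is feasible and `(1 - ε)`-approximate at every parameter value of its
interval. -/
def IsApprox (I : ParamKnapsack) (ε : ℚ) (S : ParamSolution I.n) : Prop :=
  ∀ j, ∀ lam ∈ S.interval j,
    I.Feasible lam (S.sol j) ∧
      (1 - (ε : ℝ)) * (I.optProfit lam : ℝ) ≤ (I.profit (S.sol j) : ℝ)

end ParamKnapsack

/-! ## Random access machines -/

/-- Instructions of an integer RAM. The numbers `d s t` name registers, `l` is a position in the
program. -/
inductive RAMInstr where
  | const (d : ℕ) (c : ℤ)
  | add (d s t : ℕ)
  | sub (d s t : ℕ)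
  | mul (d s t : ℕ)
  | div (d s t : ℕ)
  | load (d s : ℕ)
  | store (d s : ℕ)
  | jumpPos (s l : ℕ)

/-- A configuration: program counter, registers, main memory. -/
structure RAMConfig where
  pc : ℕ
  reg : ℕ → ℤ
  mem : ℤ → ℤ

/-- Write `v` into register `d` and go to the next instruction. -/
def RAMConfig.write (c : RAMConfig) (d : ℕ) (v : ℤ) : RAMConfig :=
  { c with pc := c.pc + 1, reg := Function.update c.reg d v }

/-- The effect of an instruction. `div` is integer division (with value `0` on division
by `0`), `load` and `store` access the memory cell whose address is in a register, `jumpPos`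
jumps if a register is positive. -/
def RAMInstr.exec (c : RAMConfig) : RAMInstr → RAMConfig
  | const d v => c.write d v
  | add d s t => c.write d (c.reg s + c.reg t)
  | sub d s t => c.write d (c.reg s - c.reg t)
  | mul d s t => c.write d (c.reg s * c.reg t)
  | div d s t => c.write d (c.reg s / c.reg t)
  | load d s => c.write d (c.mem (c.reg s))
  | store d s => { c with pc := c.pc + 1, mem := Function.update c.mem (c.reg d) (c.reg s) }
  | jumpPos s l => { c with pc := if 0 < c.reg s then l else c.pc + 1 }

/-- A program is a finite list of instructions. -/
abbrev RAMProgram := List RAMInstr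

/-- The machine has halted when its program counter points outside the program. -/
def RAMProgram.Halted (P : RAMProgram) (c : RAMConfig) : Prop := P.length ≤ c.pc

/-- One step, of unit cost; a halted machine stays as it is. -/
def RAMProgram.step (P : RAMProgram) (c : RAMConfig) : RAMConfig :=
  match P[c.pc]? with
  | none => c
  | some ins => ins.exec c

/-- The configuration after `t` steps. -/
def RAMProgram.run (P : RAMProgram) (c : RAMConfig) (t : ℕ) : RAMConfig := P.step^[t] c

/-- All registers and memory cells hold integers of absolute value at most `B`. -/
def RAMConfig.BoundedBy (c : RAMConfig) (B : ℕ) : Prop :=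
  (∀ r, (c.reg r).natAbs ≤ B) ∧ ∀ z, (c.mem z).natAbs ≤ B

/-! ## Input, output and approximation schemes -/

namespace ParamKnapsack

/-- The input as a list of integers: `n`, `W`, numerator and denominator of `ε`, then all `p i`,
all `a i`, all `b i`. -/
def inputList (I : ParamKnapsack) (ε : ℚ) : List ℤ :=
  [(I.n : ℤ), (I.W : ℤ), ε.num, (ε.den : ℤ)] ++
    (List.ofFn fun i => (I.p i : ℤ)) ++ List.ofFn I.a ++ List.ofFn I.b

/-- At the start the memory holds the input from address `0` on; everything else is `0`. -/
def initConfig (I : ParamKnapsack) (ε : ℚ) : RAMConfig where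
  pc := 0
  reg := fun _ => 0
  mem := fun z => if 0 ≤ z then (I.inputList ε).getD z.toNat 0 else 0

/-- The configuration `c` presents `S` as its output: register `0` holds `k`, register `1` the
address of a table with a row (numerator, positive denominator, bit `left`) for each breakpoint,
register `2` the address of a table with a row of `n` bits for each interval. -/
def Outputs {n : ℕ} (c : RAMConfig) (S : ParamSolution n) : Prop :=
  c.reg 0 = (S.k : ℤ) ∧
  (∀ i : Fin S.k,
    0 < c.mem (c.reg 1 + 3 * (i.val : ℤ) + 1) ∧
    S.breakpoint i =
      (c.mem (c.reg 1 + 3 * (i.val : ℤ)) : ℚ) / (c.mem (c.reg 1 + 3 * (i.val : ℤ) + 1) : ℚ) ∧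
    c.mem (c.reg 1 + 3 * (i.val : ℤ) + 2) = if S.left i = true then 1 else 0) ∧
  ∀ (j : Fin (S.k + 1)) (i : Fin n),
    c.mem (c.reg 2 + (j.val : ℤ) * (n : ℤ) + (i.val : ℤ)) = if i ∈ S.sol j then 1 else 0

/-- On input `(I, ε)` the program `P` halts after at most `t` steps. -/
def HaltsWithin (P : RAMProgram) (I : ParamKnapsack) (ε : ℚ) (t : ℕ) : Prop :=
  P.Halted (P.run (I.initConfig ε) t)

/-- `P` is a fully polynomial-time approximation scheme: for every instance and every rational
`ε ∈ (0, 1)` it halts with a `(1 - ε)`-approximate parametric solution, after a number of steps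
that is polynomial in the encoding length of the instance and in `1 / ε`, while all
integers that it handles are polynomially bounded in the magnitude of the input numbers
(so they fit into a constant number of machine words). -/
def IsFPTAS (P : RAMProgram) : Prop :=
  ∃ d : ℕ, ∀ (I : ParamKnapsack) (ε : ℚ), 0 < ε → ε < 1 →
    ∃ t : ℕ, HaltsWithin P I ε t ∧
      (t : ℝ) ≤ ((I.encodingLength : ℝ) + 1 / (ε : ℝ)) ^ d ∧
      (∀ s ≤ t, (P.run (I.initConfig ε) s).BoundedBy (I.magnitude ε ^ d)) ∧
      ∃ S : ParamSolution I.n, Outputs (P.run (I.initConfig ε) t) S ∧ I.IsApprox ε S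

/-- `n⁵ / ε² * min {log M, n log (n / ε) / log (n log (n / ε))}`, where the minimum is replaced
by `1` if it is smaller. (For `n ≥ 2` and `M ≥ 2` both terms are at least `log 2`.) -/
noncomputable def timeBound (I : ParamKnapsack) (ε : ℚ) : ℝ :=
  (I.n : ℝ) ^ 5 / (ε : ℝ) ^ 2 *
    max 1 (min (Real.log (I.bigM : ℝ))
      ((I.n : ℝ) * Real.log ((I.n : ℝ) / (ε : ℝ)) /
        Real.log ((I.n : ℝ) * Real.log ((I.n : ℝ) / (ε : ℝ)))))

end ParamKnapsack

/-! Fix a target profit and consider the item sets that reach it up to rounding. Their least weight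
is a minimum of finitely many affine functions of `lam`, hence concave, so the parameters at which
some of them fits form the complement of an open interval. One set per half-line is enough to cover
this complement: a set of nonpositive slope on the right, a set of nonnegative slope on the left.
The reflection `lam ↦ -lam` turns the second case into the first. The end of the right half-line is
found by Newton's method, started far to the right. Each iteration solves, by dynamic programming
over rounded profits, a knapsack problem at a fixed rational parameter (`newtonStep_spec`).

The targets are `2 ^ i * p k * (1 + l / E)` for all items `k`, all `2 ^ i ≤ n` and all `l < E`,
where `E = ⌊2 / ε⌋ + 1`. If `k` is the most profitable item of a set, then the profit of the set
lies between `p k` and `n * p k`, and some target is smaller by a factor of at least `E / (E + 1)`.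
Rounding the profits costs another factor `(E - 1) / E`. The product `(E - 1) / (E + 1)` is at least
`1 - ε` (`exists_covers`, `levels_mul`). The half-lines of all targets, each with its set, are the
records. Their ends cut the real line, and on each piece the most profitable record that is valid
there is returned. A breakpoint goes to the more profitable of its two neighbours (`Segment.mk'`,
`Out.approx`).

The number of Newton iterations is bounded twice. Along a run, (ratio of consecutive slacks) +
(ratio of consecutive slopes) is at most 1, so the product of slack and slope falls by a factor of 4
in each iteration. As all data are integers, this gives `O(log M)` iterations (`four_pow_le`).
Independently of the size of the numbers, a sequence of `m` positive subset sums of `k` reals in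
which each is at most half its predecessor satisfies `2 ^ m ≤ (m + 1) ^ k`, by the pigeonhole
principle (`two_pow_le_of_halving`). Applied to the slopes, and between two halvings of the slope to
the excess weights at a later iterate, this gives `O(n ^ 2 * log² n)` iterations (`length_le`). A
dynamic program costs `O(n ^ 2 * E)`, so the total is `O(n ^ 3 * log n * E ^ 2)` times the number of
iterations. Both bounds fit below the claimed running time, the second one because the second term
of the minimum is at least `n / 2` (`half_le_ratio`).

To obtain a statement about the machine, the algorithm is written in a small structured language
with a verified compiler (`Cmd.code_spec`) and is analysed with a program logic that counts machine
steps. Stored integers are bounded explicitly, and all intermediate values are polynomial in that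
bound (`Cmd.exists_mag_le`). -/

namespace RAMLang

/-! ### A structured language with arrays and its compilation to the machine. -/

/-- Expressions over registers `V`, four two-dimensional arrays and the raw memory. -/
inductive Ex (V : Type) where
  | lit (c : ℤ)
  | var (v : V)
  | add (x y : Ex V)
  | sub (x y : Ex V)
  | mul (x y : Ex V)
  | div (x y : Ex V)
  | get (r : Fin 4) (i j : Ex V)
  | raw (i : Ex V)

/-- Structured programs. `ite e c d` and `loopWhile e c` test whether `e` is positive. -/
inductive Cmd (V : Type) where
  | skip
  | set (v : V) (e : Ex V)
  | put (r : Fin 4) (i j e : Ex V)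
  | rput (i e : Ex V)
  | seq (c d : Cmd V)
  | ite (e : Ex V) (c d : Cmd V)
  | loopWhile (e : Ex V) (c : Cmd V)

/-- States of structured programs. -/
structure St (V : Type) where
  reg : V → ℤ
  arr : Fin 4 → ℤ → ℤ → ℤ
  raw : ℤ → ℤ

variable {V : Type}

namespace St

/-- Assign to a register. -/
def set [DecidableEq V] (σ : St V) (v : V) (x : ℤ) : St V :=
  { σ with reg := fun w => if w = v then x else σ.reg w }

/-- Assign to an array cell. -/
def put (σ : St V) (r : Fin 4) (i j x : ℤ) : St V :=
  { σ with arr := fun r' i' j' => if r' = r ∧ i' = i ∧ j' = j then x else σ.arr r' i' j' }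

/-- Assign to a raw memory cell. -/
def rput (σ : St V) (i x : ℤ) : St V :=
  { σ with raw := fun i' => if i' = i then x else σ.raw i' }

/-- All values of the state lie in `[-u, u]`. -/
def Bounded (u : ℕ) (σ : St V) : Prop :=
  (∀ v, (σ.reg v).natAbs ≤ u) ∧ (∀ r i j, (σ.arr r i j).natAbs ≤ u) ∧ ∀ i, (σ.raw i).natAbs ≤ u

end St

namespace Ex

/-- The value of an expression. -/
def eval (σ : St V) : Ex V → ℤ
  | lit c => c
  | var v => σ.reg v
  | add x y => x.eval σ + y.eval σ
  | sub x y => x.eval σ - y.eval σ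
  | mul x y => x.eval σ * y.eval σ
  | div x y => x.eval σ / y.eval σ
  | get r i j => σ.arr r (i.eval σ) (j.eval σ)
  | raw i => σ.raw (i.eval σ)

/-- All indices in the expression are nonnegative. -/
def Safe (σ : St V) : Ex V → Prop
  | lit _ => True
  | var _ => True
  | add x y => x.Safe σ ∧ y.Safe σ
  | sub x y => x.Safe σ ∧ y.Safe σ
  | mul x y => x.Safe σ ∧ y.Safe σ
  | div x y => x.Safe σ ∧ y.Safe σ
  | get _ i j => (i.Safe σ ∧ j.Safe σ) ∧ 0 ≤ i.eval σ ∧ 0 ≤ j.eval σ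
  | raw i => i.Safe σ ∧ 0 ≤ i.eval σ

/-- The number of machine instructions of the compiled expression. -/
def size : Ex V → ℕ
  | lit _ => 1
  | var _ => 2
  | add x y => x.size + y.size + 1
  | sub x y => x.size + y.size + 1
  | mul x y => x.size + y.size + 1
  | div x y => x.size + y.size + 1
  | get _ i j => i.size + j.size + 8
  | raw i => i.size + 1

/-- A bound for all intermediate values, if the state is bounded by `u`. -/
def mag (u : ℕ) : Ex V → ℕ
  | lit c => c.natAbs
  | var _ => u
  | add x y => x.mag u + y.mag u
  | sub x y => x.mag u + y.mag u
  | mul x y => (x.mag u + 1) * (y.mag u + 1)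
  | div x y => x.mag u + y.mag u
  | get _ i j => u + 16 * ((i.mag u + j.mag u + 1) * (i.mag u + j.mag u + 1))
  | raw i => u + i.mag u

end Ex

/-- Code turning indices in the scratch registers `d` and `d + 1` into the address of an array
cell in scratch register `d`. -/
def addrCode (r : Fin 4) (d : ℕ) : List RAMInstr :=
  [.add (2 * d + 3) (2 * d + 1) (2 * d + 3), .mul (2 * d + 3) (2 * d + 3) (2 * d + 3),
    .add (2 * d + 1) (2 * d + 1) (2 * d + 3), .const (2 * d + 3) (-4),
    .mul (2 * d + 1) (2 * d + 1) (2 * d + 3), .const (2 * d + 3) (-((r : ℕ) : ℤ) - 1),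
    .add (2 * d + 1) (2 * d + 1) (2 * d + 3)]

/-- The address of an array cell. -/
def addr (r : Fin 4) (i j : ℤ) : ℤ := (i + (i + j) * (i + j)) * (-4) + (-((r : ℕ) : ℤ) - 1)

namespace Ex

/-- Compile an expression; its value is left in the scratch register `d`. -/
def code (enc : V → ℕ) : Ex V → ℕ → List RAMInstr
  | lit c, d => [.const (2 * d + 1) c]
  | var v, d => [.const (2 * d + 1) 0, .add (2 * d + 1) (2 * enc v) (2 * d + 1)]
  | add x y, d => x.code enc d ++ (y.code enc (d + 1) ++ [.add (2 * d + 1) (2 * d + 1) (2 * d + 3)])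
  | sub x y, d => x.code enc d ++ (y.code enc (d + 1) ++ [.sub (2 * d + 1) (2 * d + 1) (2 * d + 3)])
  | mul x y, d => x.code enc d ++ (y.code enc (d + 1) ++ [.mul (2 * d + 1) (2 * d + 1) (2 * d + 3)])
  | div x y, d => x.code enc d ++ (y.code enc (d + 1) ++ [.div (2 * d + 1) (2 * d + 1) (2 * d + 3)])
  | get r i j, d =>
      i.code enc d ++ (j.code enc (d + 1) ++ (addrCode r d ++ [.load (2 * d + 1) (2 * d + 1)]))
  | raw i, d => i.code enc d ++ [.load (2 * d + 1) (2 * d + 1)]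

theorem length_code (enc : V → ℕ) (e : Ex V) (d : ℕ) : (e.code enc d).length = e.size := by
  induction e generalizing d <;> simp_all [code, size, addrCode] <;> omega

theorem natAbs_eval_le {u : ℕ} {σ : St V} (hσ : σ.Bounded u) (e : Ex V) :
    (e.eval σ).natAbs ≤ e.mag u := by
  induction e with
  | lit c => simp [eval, mag]
  | var v => exact hσ.1 v
  | add x y hx hy => simp only [eval, mag]; omega
  | sub x y hx hy => simp only [eval, mag]; omega
  | mul x y hx hy =>
    simp only [eval, mag, Int.natAbs_mul]
    exact Nat.mul_le_mul (by omega) (by omega)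
  | div x y hx hy =>
    simp only [eval, mag]
    have := Int.natAbs_ediv_le_natAbs (x.eval σ) (y.eval σ)
    omega
  | get r i j => exact (hσ.2.1 _ _ _).trans (by simp [mag])
  | raw i => exact (hσ.2.2 _).trans (by simp [mag])

end Ex

namespace Cmd

/-- The number of machine instructions of the compiled program. -/
def size : Cmd V → ℕ
  | skip => 0
  | set _ e => e.size + 2
  | put _ i j e => e.size + i.size + j.size + 8
  | rput i e => e.size + i.size + 1
  | seq c d => c.size + d.size
  | ite e c d => e.size + 1 + d.size + 2 + c.size
  | loopWhile e c => e.size + 1 + 2 + c.size + 2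

/-- Compile a program that is placed at position `pos`. -/
def code (enc : V → ℕ) : Cmd V → ℕ → List RAMInstr
  | skip, _ => []
  | set v e, _ => e.code enc 0 ++ [.const 3 0, .add (2 * enc v) 1 3]
  | put r i j e, _ =>
      e.code enc 0 ++ (i.code enc 1 ++ (j.code enc 2 ++ (addrCode r 1 ++ [.store 3 1])))
  | rput i e, _ => e.code enc 0 ++ (i.code enc 1 ++ [.store 3 1])
  | seq c d, pos => c.code enc pos ++ d.code enc (pos + c.size)
  | ite e c d, pos =>
      e.code enc 0 ++ ([.jumpPos 1 (pos + (e.size + 1 + d.size + 2))] ++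
        (d.code enc (pos + (e.size + 1)) ++
          ([.const 1 1, .jumpPos 1 (pos + (e.size + 1 + d.size + 2 + c.size))] ++
            c.code enc (pos + (e.size + 1 + d.size + 2)))))
  | loopWhile e c, pos =>
      e.code enc 0 ++ ([.jumpPos 1 (pos + (e.size + 3)), .const 1 1,
        .jumpPos 1 (pos + (e.size + 3 + c.size + 2))] ++
        (c.code enc (pos + (e.size + 3)) ++ [.const 1 1, .jumpPos 1 pos]))

theorem length_code (enc : V → ℕ) (c : Cmd V) (pos : ℕ) :
    (c.code enc pos).length = c.size := by
  induction c generalizing pos <;> simp_all [code, size, Ex.length_code, addrCode] <;> omega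

/-- A bound for all intermediate values, if all stored values are bounded by `u`. -/
def mag (u : ℕ) : Cmd V → ℕ
  | skip => 0
  | set _ e => e.mag u
  | put _ i j e => e.mag u + 16 * ((i.mag u + j.mag u + 1) * (i.mag u + j.mag u + 1))
  | rput i e => e.mag u + i.mag u
  | seq c d => c.mag u + d.mag u
  | ite e c d => e.mag u + c.mag u + d.mag u + 1
  | loopWhile e c => e.mag u + c.mag u + 1

end Cmd

/-- `Runs u c σ t σ'`: from the state `σ` the program `c` halts after `t` machine steps in the
state `σ'`, and all assigned values lie in `[-u, u]`. -/
inductive Runs [DecidableEq V] (u : ℕ) : Cmd V → St V → ℕ → St V → Prop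
  | skip (σ) : Runs u .skip σ 0 σ
  | set (v e σ) (h : e.Safe σ) (hu : (e.eval σ).natAbs ≤ u) :
      Runs u (.set v e) σ (e.size + 2) (σ.set v (e.eval σ))
  | put (r i j e σ) (he : e.Safe σ) (hi : i.Safe σ) (hj : j.Safe σ) (hi0 : 0 ≤ i.eval σ)
      (hj0 : 0 ≤ j.eval σ) (hu : (e.eval σ).natAbs ≤ u) :
      Runs u (.put r i j e) σ (e.size + i.size + j.size + 8)
        (σ.put r (i.eval σ) (j.eval σ) (e.eval σ))
  | rput (i e σ) (he : e.Safe σ) (hi : i.Safe σ) (hi0 : 0 ≤ i.eval σ)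
      (hu : (e.eval σ).natAbs ≤ u) :
      Runs u (.rput i e) σ (e.size + i.size + 1) (σ.rput (i.eval σ) (e.eval σ))
  | seq (c d σ t σ₁ t₁ σ₂) (h : Runs u c σ t σ₁) (h₁ : Runs u d σ₁ t₁ σ₂) :
      Runs u (.seq c d) σ (t + t₁) σ₂
  | iteTrue (e c d σ t σ₁) (hs : e.Safe σ) (he : 0 < e.eval σ) (h : Runs u c σ t σ₁) :
      Runs u (.ite e c d) σ (e.size + 1 + t) σ₁
  | iteFalse (e c d σ t σ₁) (hs : e.Safe σ) (he : e.eval σ ≤ 0) (h : Runs u d σ t σ₁) :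
      Runs u (.ite e c d) σ (e.size + 1 + t + 2) σ₁
  | whileTrue (e c σ t σ₁ t₁ σ₂) (hs : e.Safe σ) (he : 0 < e.eval σ) (h : Runs u c σ t σ₁)
      (h₁ : Runs u (.loopWhile e c) σ₁ t₁ σ₂) :
      Runs u (.loopWhile e c) σ (e.size + 1 + t + 2 + t₁) σ₂
  | whileFalse (e c σ) (hs : e.Safe σ) (he : e.eval σ ≤ 0) :
      Runs u (.loopWhile e c) σ (e.size + 3) σ

/-! ### Correctness of the compiler -/

/-- `P` goes from `k` to `k'` in `t` steps through configurations bounded by `B`. -/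
def Reach (P : RAMProgram) (B : ℕ) (k k' : RAMConfig) (t : ℕ) : Prop :=
  P.run k t = k' ∧ ∀ s ≤ t, (P.run k s).BoundedBy B

theorem Reach.trans {P : RAMProgram} {B : ℕ} {k k₁ k₂ : RAMConfig} {t t₁ : ℕ}
    (h : Reach P B k k₁ t) (h₁ : Reach P B k₁ k₂ t₁) : Reach P B k k₂ (t + t₁) := by
  have key : ∀ s, P.run k (t + s) = P.run k₁ s := fun s => by
    rw [← h.1]; simp only [RAMProgram.run]; rw [add_comm, Function.iterate_add_apply]
  refine ⟨(key t₁).trans h₁.1, fun s hs => ?_⟩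
  rcases le_total s t with h' | h'
  · exact h.2 s h'
  · obtain ⟨r, rfl⟩ := Nat.exists_eq_add_of_le h'
    rw [key]; exact h₁.2 r (by omega)

theorem Reach.bounded {P : RAMProgram} {B : ℕ} {k k' : RAMConfig} {t : ℕ}
    (h : Reach P B k k' t) : k'.BoundedBy B := h.1 ▸ h.2 t le_rfl

theorem Reach.refl {P : RAMProgram} {B : ℕ} {k : RAMConfig} (h : k.BoundedBy B) :
    Reach P B k k 0 := ⟨rfl, fun s hs => by obtain rfl : s = 0 := by omega
                                            exact h⟩

theorem Reach.one {P : RAMProgram} {B : ℕ} {k : RAMConfig} {i : RAMInstr} (h : k.BoundedBy B)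
    (hi : P[k.pc]? = some i) (h' : (i.exec k).BoundedBy B) : Reach P B k (i.exec k) 1 := by
  have : P.run k 1 = i.exec k := by simp [RAMProgram.run, RAMProgram.step, hi]
  refine ⟨this, fun s hs => ?_⟩
  interval_cases s
  · exact h
  · rw [this]; exact h'

/-- The code `L` stands at position `pos` of `P`. -/
def CodeAt (P : RAMProgram) (pos : ℕ) (L : List RAMInstr) : Prop :=
  ∀ k, k < L.length → P[pos + k]? = L[k]?

theorem codeAt_append {P : RAMProgram} {pos : ℕ} {L M : List RAMInstr} :
    CodeAt P pos (L ++ M) ↔ CodeAt P pos L ∧ CodeAt P (pos + L.length) M := by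
  constructor
  · refine fun h => ⟨fun k hk => ?_, fun k hk => ?_⟩
    · rw [h k (by simp; omega), List.getElem?_append_left hk]
    · rw [add_assoc, h _ (by simp; omega), List.getElem?_append_right (by omega)]; simp
  · rintro ⟨h, h'⟩ k hk
    rcases lt_or_ge k L.length with hl | hl
    · rw [h k hl, List.getElem?_append_left hl]
    · obtain ⟨r, rfl⟩ := Nat.exists_eq_add_of_le hl
      rw [← add_assoc, h' r (by simp at hk; omega), List.getElem?_append_right (by omega)]; simp

theorem codeAt_cons {P : RAMProgram} {pos : ℕ} {i : RAMInstr} {M : List RAMInstr} :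
    CodeAt P pos (i :: M) ↔ P[pos]? = some i ∧ CodeAt P (pos + 1) M := by
  rw [← List.singleton_append, codeAt_append]
  refine and_congr ⟨fun h => by simpa using h 0 (by simp), fun h k hk => ?_⟩ Iff.rfl
  obtain rfl : k = 0 := by simp at hk; omega
  simpa using h

/-- The machine configuration `k` represents the state `σ`. -/
structure Sim (enc : V → ℕ) (σ : St V) (k : RAMConfig) : Prop where
  reg : ∀ v, k.reg (2 * enc v) = σ.reg v
  raw : ∀ z, 0 ≤ z → k.mem z = σ.raw z
  arr : ∀ r i j, 0 ≤ i → 0 ≤ j → k.mem (addr r i j) = σ.arr r i j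

/-- Arrays occupy negative addresses and the raw memory nonnegative ones, so they never interfere.
-/
theorem addr_neg {r : Fin 4} {i j : ℤ} (hi : 0 ≤ i) (hj : 0 ≤ j) : addr r i j < 0 := by
  have : 0 ≤ (i + j) * (i + j) := mul_self_nonneg _
  unfold addr; omega

/-- The residue modulo 4 determines `r`. With `s = i + j`, the number `i + s ^ 2` lies between `s ^
2` and `s ^ 2 + s`, and these ranges are disjoint for different `s`, so it determines `s` and then
`i`. -/
theorem addr_inj {r r' : Fin 4} {i j i' j' : ℤ} (hi : 0 ≤ i) (hj : 0 ≤ j) (hi' : 0 ≤ i')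
    (hj' : 0 ≤ j') (h : addr r i j = addr r' i' j') : r = r' ∧ i = i' ∧ j = j' := by
  unfold addr at h
  have h1 : (r : ℕ) = r' := by omega
  have h2 : i + (i + j) * (i + j) = i' + (i' + j') * (i' + j') := by omega
  have h3 : i + j = i' + j' := by
    rcases lt_trichotomy (i + j) (i' + j') with h | h | h
    · nlinarith
    · exact h
    · nlinarith
  rw [h3] at h2
  exact ⟨Fin.ext h1, by omega, by omega⟩

theorem _root_.RAMConfig.BoundedBy.write {k : RAMConfig} {B : ℕ} (h : k.BoundedBy B) (d : ℕ) {x : ℤ}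
    (hx : x.natAbs ≤ B) : (k.write d x).BoundedBy B := by
  refine ⟨fun r => ?_, h.2⟩
  by_cases hr : r = d
  · subst hr; simpa [RAMConfig.write] using hx
  · simpa [RAMConfig.write, hr] using h.1 r

/-- `k'` arises from `k` by `n` steps of straight code which only writes scratch registers
with index at least `d`. -/
structure Scratch (P : RAMProgram) (B d n : ℕ) (k k' : RAMConfig) : Prop where
  reach : Reach P B k k' n
  pc : k'.pc = k.pc + n
  mem : k'.mem = k.mem
  reg : ∀ r, (∀ d' ≥ d, r ≠ 2 * d' + 1) → k'.reg r = k.reg r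

theorem Scratch.trans {P : RAMProgram} {B d n n' : ℕ} {k k₁ k₂ : RAMConfig}
    (h : Scratch P B d n k k₁) (h' : Scratch P B d n' k₁ k₂) : Scratch P B d (n + n') k k₂ :=
  ⟨h.reach.trans h'.reach, by rw [h'.pc, h.pc, add_assoc], h'.mem.trans h.mem,
    fun r hr => (h'.reg r hr).trans (h.reg r hr)⟩

theorem Scratch.mono {P : RAMProgram} {B d d' n : ℕ} {k k₁ : RAMConfig}
    (h : Scratch P B d' n k k₁) (hd : d ≤ d') : Scratch P B d n k k₁ :=
  ⟨h.reach, h.pc, h.mem, fun r hr => h.reg r fun x hx => hr x (hd.trans hx)⟩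

theorem Scratch.write {P : RAMProgram} {B d d' : ℕ} {k : RAMConfig} {i : RAMInstr} {x : ℤ}
    (hk : k.BoundedBy B) (hi : P[k.pc]? = some i) (he : i.exec k = k.write (2 * d' + 1) x)
    (hd : d ≤ d') (hx : x.natAbs ≤ B) : Scratch P B d 1 k (k.write (2 * d' + 1) x) :=
  ⟨he ▸ Reach.one hk hi (he ▸ hk.write _ hx), rfl, rfl, fun r hr => by
    simp [RAMConfig.write, hr d' hd]⟩

/-- Variables live in registers of even number and scratch values in registers of odd number. -/
theorem Sim.scratch {enc : V → ℕ} {σ : St V} {P : RAMProgram} {B d n : ℕ} {k k' : RAMConfig}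
    (h : Sim enc σ k) (h' : Scratch P B d n k k') : Sim enc σ k' :=
  ⟨fun v => by rw [h'.reg _ (fun _ _ => by omega), h.reg], fun z hz => by rw [h'.mem, h.raw z hz],
    fun r i j hi hj => by rw [h'.mem, h.arr r i j hi hj]⟩

/-- The factor 16 leaves room for `4 * (i + (i + j) ^ 2) + 4` and for all intermediate values of the
computation of the address. -/
theorem addrCode_spec {P : RAMProgram} {B d : ℕ} {k : RAMConfig} {r : Fin 4} {i j : ℤ} {x y : ℕ}
    (hk : k.BoundedBy B) (hc : CodeAt P k.pc (addrCode r d)) (hi : k.reg (2 * d + 1) = i)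
    (hj : k.reg (2 * d + 3) = j) (hx : i.natAbs ≤ x) (hy : j.natAbs ≤ y) (hi0 : 0 ≤ i)
    (hj0 : 0 ≤ j) (hB : 16 * ((x + y + 1) * (x + y + 1)) ≤ B) :
    ∃ k', Scratch P B d 7 k k' ∧ k'.reg (2 * d + 1) = addr r i j := by
  have hr := r.isLt
  have hs : (i + j) * (i + j) ≤ ((x : ℤ) + y) * (x + y) := by
    apply mul_self_le_mul_self <;> omega
  have hs0 : 0 ≤ (i + j) * (i + j) := mul_self_nonneg _
  have hB' : 16 * (((x : ℤ) + y) * (x + y) + 2 * (x + y) + 1) ≤ B := by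
    have : (16 * (((x : ℤ) + y + 1) * (x + y + 1))) ≤ B := by exact_mod_cast hB
    linarith
  set q := (i + j) * (i + j) with hq
  set m := ((x : ℤ) + y) * (x + y)
  have b1 : (i + j).natAbs ≤ B := by omega
  have b2 : q.natAbs ≤ B := by omega
  have b3 : (i + q).natAbs ≤ B := by omega
  have b5 : ((i + q) * (-4)).natAbs ≤ B := by omega
  have b6 : (-((r : ℕ) : ℤ) - 1).natAbs ≤ B := by omega
  have b7 : ((i + q) * (-4) + (-((r : ℕ) : ℤ) - 1)).natAbs ≤ B := by omega
  simp only [addrCode, codeAt_cons] at hc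
  obtain ⟨c1, c2, c3, c4, c5, c6, c7, -⟩ := hc
  have s1 := Scratch.write (d := d) (d' := d + 1) (x := i + j) hk c1
    (congrArg (RAMConfig.write _ _) (by simp [hi, hj])) (by omega) b1
  have s2 := Scratch.write (d := d) (d' := d + 1) (x := q) s1.reach.bounded c2
    (congrArg (RAMConfig.write _ _) (by simp [RAMConfig.write, mul_add, hq])) (by omega) b2
  have s3 := Scratch.write (d := d) (d' := d) (x := i + q) s2.reach.bounded c3
    (congrArg (RAMConfig.write _ _) (by simp [RAMConfig.write, mul_add, hi])) (by omega) b3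
  have s4 := Scratch.write (d := d) (d' := d + 1) (x := -4) s3.reach.bounded c4 rfl
    (by omega) (by omega)
  have s5 := Scratch.write (d := d) (d' := d) (x := (i + q) * (-4)) s4.reach.bounded c5
    (congrArg (RAMConfig.write _ _) (by simp [RAMConfig.write, mul_add])) (by omega) b5
  have s6 := Scratch.write (d := d) (d' := d + 1) (x := -((r : ℕ) : ℤ) - 1) s5.reach.bounded c6
    rfl (by omega) b6
  have s7 := Scratch.write (d := d) (d' := d) (x := (i + q) * (-4) + (-((r : ℕ) : ℤ) - 1))
    s6.reach.bounded c7
    (congrArg (RAMConfig.write _ _) (by simp [RAMConfig.write, mul_add])) (by omega) b7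
  exact ⟨_, (((((s1.trans s2).trans s3).trans s4).trans s5).trans s6).trans s7,
    by simp [RAMConfig.write, addr, hq]⟩

end RAMLang

namespace RAMLang
variable {V : Type}

/-- The common part of the four arithmetic operations: the right operand is evaluated in scratch
registers from `d + 1` on, so the left value in scratch register `d` survives. -/
theorem Ex.code_binary_spec {enc : V → ℕ} {P : RAMProgram} {B d : ℕ} {σ : St V}
    {k k₁ k₂ : RAMConfig} {x y : Ex V} {o : RAMInstr} {z : ℤ}
    (hx : Scratch P B d x.size k k₁) (hxv : k₁.reg (2 * d + 1) = x.eval σ)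
    (hy : Scratch P B (d + 1) y.size k₁ k₂) (hyv : k₂.reg (2 * d + 3) = y.eval σ)
    (hc : CodeAt P (k.pc + (x.code enc d).length + (y.code enc (d + 1)).length) [o])
    (ho : k₂.reg (2 * d + 1) = x.eval σ → k₂.reg (2 * d + 3) = y.eval σ →
      o.exec k₂ = k₂.write (2 * d + 1) z) (hz : z.natAbs ≤ B) :
    ∃ k', Scratch P B d (x.size + y.size + 1) k k' ∧ k'.reg (2 * d + 1) = z := by
  have h2 : k₂.reg (2 * d + 1) = x.eval σ := by
    rw [hy.reg _ (fun _ _ => by omega), hxv]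
  rw [length_code, length_code, codeAt_cons, ← hx.pc, ← hy.pc] at hc
  exact ⟨_, (hx.trans (hy.mono (by omega))).trans
    (Scratch.write hy.reach.bounded hc.1 (ho h2 hyv) le_rfl hz), by simp [RAMConfig.write]⟩

theorem Ex.code_spec {enc : V → ℕ} {P : RAMProgram} {u B : ℕ} {σ : St V} (hσ : σ.Bounded u)
    (e : Ex V) (d : ℕ) (k : RAMConfig) (hk : k.BoundedBy B) (hs : Sim enc σ k)
    (he : e.Safe σ) (hB : e.mag u ≤ B) (hc : CodeAt P k.pc (e.code enc d)) :
    ∃ k', Scratch P B d e.size k k' ∧ k'.reg (2 * d + 1) = e.eval σ := by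
  induction e generalizing d k with
  | lit c =>
    rw [code, codeAt_cons] at hc
    exact ⟨_, Scratch.write hk hc.1 rfl le_rfl hB, by simp [RAMConfig.write, eval]⟩
  | var v =>
    simp only [code, codeAt_cons] at hc
    have s1 := Scratch.write (d := d) hk hc.1 rfl le_rfl (by simp)
    have s2 := Scratch.write (d := d) (d' := d) (x := σ.reg v) s1.reach.bounded hc.2.1
      (congrArg (RAMConfig.write _ _) (by
        rw [s1.reg (2 * enc v) (fun _ _ => by omega), hs.reg]; simp [RAMConfig.write])) le_rfl
      ((hσ.1 v).trans hB)
    exact ⟨_, s1.trans s2, by simp [RAMConfig.write, eval]⟩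
  | add x y hx hy =>
    have hB' := hB
    simp only [mag] at hB'
    simp only [code, codeAt_append] at hc
    obtain ⟨k₁, s1, v1⟩ := hx d k hk hs he.1 (by omega) hc.1
    obtain ⟨k₂, s2, v2⟩ := hy (d + 1) k₁ s1.reach.bounded (hs.scratch s1) he.2 (by omega)
      (by rw [s1.pc, ← length_code enc x d]; exact hc.2.1)
    exact code_binary_spec s1 v1 s2 v2 hc.2.2 (fun h h' => by simp [RAMInstr.exec, h, h', eval])
      ((natAbs_eval_le hσ (add x y)).trans hB)
  | sub x y hx hy =>
    have hB' := hB
    simp only [mag] at hB'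
    simp only [code, codeAt_append] at hc
    obtain ⟨k₁, s1, v1⟩ := hx d k hk hs he.1 (by omega) hc.1
    obtain ⟨k₂, s2, v2⟩ := hy (d + 1) k₁ s1.reach.bounded (hs.scratch s1) he.2 (by omega)
      (by rw [s1.pc, ← length_code enc x d]; exact hc.2.1)
    exact code_binary_spec s1 v1 s2 v2 hc.2.2 (fun h h' => by simp [RAMInstr.exec, h, h', eval])
      ((natAbs_eval_le hσ (sub x y)).trans hB)
  | mul x y hx hy =>
    have hB' := hB
    simp only [mag] at hB'
    -- The summands `+ 1` in the bound of a product keep it above the bounds of both factors, even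
    -- if the other bound is 0.
    have hx' : x.mag u ≤ B := by nlinarith [Nat.zero_le (x.mag u * y.mag u)]
    have hy' : y.mag u ≤ B := by nlinarith [Nat.zero_le (x.mag u * y.mag u)]
    simp only [code, codeAt_append] at hc
    obtain ⟨k₁, s1, v1⟩ := hx d k hk hs he.1 hx' hc.1
    obtain ⟨k₂, s2, v2⟩ := hy (d + 1) k₁ s1.reach.bounded (hs.scratch s1) he.2 hy'
      (by rw [s1.pc, ← length_code enc x d]; exact hc.2.1)
    exact code_binary_spec s1 v1 s2 v2 hc.2.2 (fun h h' => by simp [RAMInstr.exec, h, h', eval])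
      ((natAbs_eval_le hσ (mul x y)).trans hB)
  | div x y hx hy =>
    have hB' := hB
    simp only [mag] at hB'
    simp only [code, codeAt_append] at hc
    obtain ⟨k₁, s1, v1⟩ := hx d k hk hs he.1 (by omega) hc.1
    obtain ⟨k₂, s2, v2⟩ := hy (d + 1) k₁ s1.reach.bounded (hs.scratch s1) he.2 (by omega)
      (by rw [s1.pc, ← length_code enc x d]; exact hc.2.1)
    exact code_binary_spec s1 v1 s2 v2 hc.2.2 (fun h h' => by simp [RAMInstr.exec, h, h', eval])
      ((natAbs_eval_le hσ (div x y)).trans hB)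
  | get r i j hi hj =>
    simp only [mag] at hB
    have hsq : i.mag u + j.mag u ≤ (i.mag u + j.mag u + 1) * (i.mag u + j.mag u + 1) := by
      nlinarith
    simp only [code, codeAt_append, length_code, codeAt_cons] at hc
    obtain ⟨k₁, s1, v1⟩ := hi d k hk hs he.1.1 (by omega) hc.1
    obtain ⟨k₂, s2, v2⟩ := hj (d + 1) k₁ s1.reach.bounded (hs.scratch s1) he.1.2 (by omega)
      (by rw [s1.pc]; exact hc.2.1)
    have s12 := s1.trans (s2.mono (Nat.le_succ d))
    obtain ⟨k₃, s3, v3⟩ := addrCode_spec (r := r) (d := d) s12.reach.bounded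
      (by rw [s12.pc, ← add_assoc]; exact hc.2.2.1)
      (by rw [s2.reg _ (fun _ _ => by omega), v1]) v2 (natAbs_eval_le hσ i)
      (natAbs_eval_le hσ j) he.2.1 he.2.2 (by omega)
    have s123 := s12.trans s3
    have hm := (hs.scratch s123).arr r _ _ he.2.1 he.2.2
    have s4 := Scratch.write (d := d) (d' := d) (x := (get r i j).eval σ) s123.reach.bounded
      (by rw [s123.pc]; simpa [addrCode, add_assoc] using hc.2.2.2.1)
      (by simp [RAMInstr.exec, v3, hm, eval]) le_rfl ((hσ.2.1 _ _ _).trans (by omega))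
    exact ⟨_, (s123.trans s4), by simp [RAMConfig.write]⟩
  | raw i hi =>
    simp only [mag] at hB
    simp only [code, codeAt_append, length_code, codeAt_cons] at hc
    obtain ⟨k₁, s1, v1⟩ := hi d k hk hs he.1 (by omega) hc.1
    have hm := (hs.scratch s1).raw _ he.2
    have s4 := Scratch.write (d := d) (d' := d) (x := (raw i).eval σ) s1.reach.bounded
      (by rw [s1.pc]; exact hc.2.1)
      (by simp [RAMInstr.exec, v1, hm, eval]) le_rfl ((hσ.2.2 _).trans (by omega))
    exact ⟨_, (s1.trans s4), by simp [RAMConfig.write]⟩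

/-- The machine only has conditional jumps; an unconditional one tests a scratch register that has
just been set to 1. -/
theorem reach_jump {P : RAMProgram} {B : ℕ} {k : RAMConfig} {l : ℕ}
    (hk : k.BoundedBy B) (hB : 1 ≤ B)
    (hc : CodeAt P k.pc [.const 1 1, .jumpPos 1 l]) {enc : V → ℕ} {σ : St V} (hs : Sim enc σ k) :
    ∃ k', Reach P B k k' 2 ∧ Sim enc σ k' ∧ k'.pc = l := by
  simp only [codeAt_cons] at hc
  have s1 := Scratch.write (d := 0) (d' := 0) (x := 1) hk hc.1 rfl le_rfl (by simpa using hB)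
  have s2 := Reach.one s1.reach.bounded hc.2.1
    (by exact ⟨s1.reach.bounded.1, s1.reach.bounded.2⟩)
  refine ⟨_, s1.reach.trans s2, ?_, by simp [RAMInstr.exec, RAMConfig.write]⟩
  have := hs.scratch s1
  exact ⟨this.reg, this.raw, this.arr⟩

theorem reach_test {P : RAMProgram} {B u : ℕ} {k : RAMConfig} {l : ℕ} {enc : V → ℕ} {σ : St V}
    (hσ : σ.Bounded u) (hk : k.BoundedBy B) (hs : Sim enc σ k) {e : Ex V} (he : e.Safe σ)
    (hB : e.mag u ≤ B) (hc : CodeAt P k.pc (e.code enc 0))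
    (hc' : P[k.pc + e.size]? = some (.jumpPos 1 l)) :
    ∃ k', Reach P B k k' (e.size + 1) ∧ Sim enc σ k' ∧
      k'.pc = if 0 < e.eval σ then l else k.pc + (e.size + 1) := by
  obtain ⟨k₁, s1, v1⟩ := e.code_spec hσ 0 k hk hs he hB hc
  rw [← s1.pc] at hc'
  have s2 := Reach.one s1.reach.bounded hc' (by exact s1.reach.bounded)
  have := hs.scratch s1
  refine ⟨_, s1.reach.trans s2, ⟨this.reg, this.raw, this.arr⟩, ?_⟩
  simp only [mul_zero, zero_add] at v1
  simp [RAMInstr.exec, v1, s1.pc, add_assoc]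

theorem St.Bounded.set [DecidableEq V] {u : ℕ} {σ : St V} (h : σ.Bounded u) (v : V) {x : ℤ}
    (hx : x.natAbs ≤ u) : (σ.set v x).Bounded u :=
  ⟨fun w => by by_cases h' : w = v <;> simp [St.set, h', hx, h.1 w], h.2.1, h.2.2⟩

theorem St.Bounded.put {u : ℕ} {σ : St V} (h : σ.Bounded u) (r : Fin 4) (i j : ℤ) {x : ℤ}
    (hx : x.natAbs ≤ u) : (σ.put r i j x).Bounded u :=
  ⟨h.1, fun r' i' j' => by simp only [St.put]; split_ifs; exacts [hx, h.2.1 _ _ _], h.2.2⟩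

theorem St.Bounded.rput {u : ℕ} {σ : St V} (h : σ.Bounded u) (i : ℤ) {x : ℤ}
    (hx : x.natAbs ≤ u) : (σ.rput i x).Bounded u :=
  ⟨h.1, h.2.1, fun i' => by simp only [St.rput]; split_ifs; exacts [hx, h.2.2 _]⟩

theorem reach_store {P : RAMProgram} {B : ℕ} {k : RAMConfig} (hk : k.BoundedBy B)
    (hc : P[k.pc]? = some (.store 3 1)) :
    Reach P B k { k with pc := k.pc + 1, mem := Function.update k.mem (k.reg 3) (k.reg 1) } 1 := by
  refine Reach.one hk hc ⟨hk.1, fun z => ?_⟩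
  simp only [RAMInstr.exec]
  by_cases h : z = k.reg 3
  · subst h; simpa using hk.1 1
  · simpa [h] using hk.2 z

/-- The compiler is correct. -/
theorem Cmd.code_spec [DecidableEq V] {enc : V → ℕ} (henc : Function.Injective enc)
    {P : RAMProgram} {u B : ℕ} {c : Cmd V} {σ σ' : St V} {t : ℕ} (h : Runs u c σ t σ')
    (hB : c.mag u ≤ B) (hσ : σ.Bounded u) (k : RAMConfig) (hk : k.BoundedBy B)
    (hs : Sim enc σ k) (hc : CodeAt P k.pc (c.code enc k.pc)) :
    ∃ k', Reach P B k k' t ∧ Sim enc σ' k' ∧ k'.pc = k.pc + c.size ∧ σ'.Bounded u := by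
  induction h generalizing k with
  | skip σ => exact ⟨k, Reach.refl hk, hs, rfl, hσ⟩
  | set v e σ he hu =>
    simp only [code, codeAt_append, Ex.length_code, codeAt_cons] at hc
    obtain ⟨k₁, s1, v1⟩ := e.code_spec hσ 0 k hk hs he hB hc.1
    rw [← s1.pc] at hc
    have s2 := Scratch.write (d := 1) (d' := 1) (x := 0) s1.reach.bounded hc.2.1 rfl
      le_rfl (by simp)
    have hs2 := (hs.scratch s1).scratch s2
    have s12 := (s1.trans (s2.mono (Nat.zero_le 1)))
    have hE : (RAMInstr.add (2 * enc v) 1 3).exec (k₁.write (2 * 1 + 1) 0)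
        = (k₁.write (2 * 1 + 1) 0).write (2 * enc v) (e.eval σ) := by
      simp at v1
      simp [RAMInstr.exec, RAMConfig.write, v1]
    have s3 := Reach.one s12.reach.bounded hc.2.2.1 (by
      rw [hE]; exact s12.reach.bounded.write _ ((Ex.natAbs_eval_le hσ e).trans hB))
    refine ⟨_, s12.reach.trans s3, ?_, ?_, hσ.set v hu⟩
    · rw [hE]
      refine ⟨fun w => ?_, hs2.raw, hs2.arr⟩
      by_cases h' : w = v
      · subst h'; simp [RAMConfig.write, St.set]
      · have : enc w ≠ enc v := fun h => h' (henc h)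
        have := hs2.reg w
        simp_all [RAMConfig.write, St.set]
    · rw [hE]; simp [RAMConfig.write, s1.pc, size, add_assoc]
  | put r i j e σ he hi hj hi0 hj0 hu =>
    simp only [mag] at hB
    have hsq : i.mag u + j.mag u ≤ (i.mag u + j.mag u + 1) * (i.mag u + j.mag u + 1) := by
      nlinarith
    simp only [code, codeAt_append, Ex.length_code, codeAt_cons] at hc
    obtain ⟨k₁, s1, v1⟩ := e.code_spec hσ 0 k hk hs he (by omega) hc.1
    have hs1 := hs.scratch s1
    obtain ⟨k₂, s2, v2⟩ := i.code_spec hσ 1 k₁ s1.reach.bounded hs1 hi (by omega)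
      (by rw [s1.pc]; exact hc.2.1)
    have hs2 := hs1.scratch s2
    obtain ⟨k₃, s3, v3⟩ := j.code_spec hσ 2 k₂ s2.reach.bounded hs2 hj (by omega)
      (by rw [s2.pc, s1.pc]; exact hc.2.2.1)
    have hs3 := hs2.scratch s3
    obtain ⟨k₄, s4, v4⟩ := addrCode_spec (r := r) (d := 1) s3.reach.bounded
      (by rw [s3.pc, s2.pc, s1.pc]; exact hc.2.2.2.1)
      (by rw [s3.reg _ (fun _ _ => by omega), v2]) v3 (Ex.natAbs_eval_le hσ i)
      (Ex.natAbs_eval_le hσ j) hi0 hj0 (by omega)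
    have hs4 := hs3.scratch s4
    have s5 := reach_store s4.reach.bounded
      (by rw [s4.pc, s3.pc, s2.pc, s1.pc]; exact hc.2.2.2.2.1)
    have v1' : k₄.reg 1 = e.eval σ := by
      rw [s4.reg _ (fun _ _ => by omega), s3.reg _ (fun _ _ => by omega),
        s2.reg _ (fun _ _ => by omega)]
      exact v1
    have v4' : k₄.reg 3 = addr r (i.eval σ) (j.eval σ) := v4
    refine ⟨_, (((s1.reach.trans s2.reach).trans s3.reach).trans s4.reach).trans s5, ?_, ?_,
      hσ.put r _ _ hu⟩
    · rw [v1', v4']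
      refine ⟨hs4.reg, fun z hz => ?_, fun r' i' j' hi' hj' => ?_⟩
      · have : z ≠ addr r (i.eval σ) (j.eval σ) := by
          have := addr_neg (r := r) hi0 hj0
          omega
        simpa [this, St.put] using hs4.raw z hz
      · by_cases h' : r' = r ∧ i' = i.eval σ ∧ j' = j.eval σ
        · obtain ⟨rfl, rfl, rfl⟩ := h'
          simp [St.put]
        · have : addr r' i' j' ≠ addr r (i.eval σ) (j.eval σ) :=
            fun h => h' (addr_inj hi' hj' hi0 hj0 h)
          simpa [this, St.put, h'] using hs4.arr r' i' j' hi' hj'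
    · simp only [s4.pc, s3.pc, s2.pc, s1.pc, size]; omega
  | rput i e σ he hi hi0 hu =>
    simp only [mag] at hB
    simp only [code, codeAt_append, Ex.length_code, codeAt_cons] at hc
    obtain ⟨k₁, s1, v1⟩ := e.code_spec hσ 0 k hk hs he (by omega) hc.1
    have hs1 := hs.scratch s1
    obtain ⟨k₂, s2, v2⟩ := i.code_spec hσ 1 k₁ s1.reach.bounded hs1 hi (by omega)
      (by rw [s1.pc]; exact hc.2.1)
    have hs2 := hs1.scratch s2
    have s5 := reach_store s2.reach.bounded (by rw [s2.pc, s1.pc]; exact hc.2.2.1)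
    have v1' : k₂.reg 1 = e.eval σ := by
      rw [s2.reg _ (fun _ _ => by omega)]
      exact v1
    have v2' : k₂.reg 3 = i.eval σ := v2
    refine ⟨_, (s1.reach.trans s2.reach).trans s5, ?_, ?_, hσ.rput _ hu⟩
    · rw [v1', v2']
      refine ⟨hs2.reg, fun z hz => ?_, fun r' i' j' hi' hj' => ?_⟩
      · by_cases h' : z = i.eval σ
        · simp [h', St.rput]
        · simpa [h', St.rput] using hs2.raw z hz
      · have : addr r' i' j' ≠ i.eval σ := by
          have := addr_neg (r := r') hi' hj'
          omega
        simpa [this, St.rput] using hs2.arr r' i' j' hi' hj'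
    · simp only [s2.pc, s1.pc, size]; omega
  | seq c d σ t σ₁ t₁ σ₂ _ _ ih ih₁ =>
    simp only [mag] at hB
    simp only [code, codeAt_append, length_code] at hc
    obtain ⟨k₁, r1, hs1, p1, b1⟩ := ih (by omega) hσ k hk hs hc.1
    obtain ⟨k₂, r2, hs2, p2, b2⟩ := ih₁ (by omega) b1 k₁ r1.bounded hs1 (by rw [p1]; exact hc.2)
    exact ⟨k₂, r1.trans r2, hs2, by rw [p2, p1, size]; omega, b2⟩
  | iteTrue e c d σ t σ₁ hse he _ ih =>
    simp only [mag] at hB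
    simp only [code, codeAt_append, length_code, Ex.length_code, List.length_singleton] at hc
    obtain ⟨k₁, r1, hs1, p1⟩ := reach_test hσ hk hs hse (by omega) hc.1
      ((codeAt_cons.1 hc.2.1).1)
    rw [if_pos he] at p1
    obtain ⟨k₂, r2, hs2, p2, b2⟩ := ih (by omega) hσ k₁ r1.bounded hs1 (by
      rw [p1]; convert hc.2.2.2.2 using 1; simp only [List.length_cons, List.length_nil]; omega)
    exact ⟨k₂, r1.trans r2, hs2, by rw [p2, p1, size]; omega, b2⟩
  | iteFalse e c d σ t σ₁ hse he _ ih =>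
    simp only [mag] at hB
    simp only [code, codeAt_append, length_code, Ex.length_code, List.length_singleton] at hc
    obtain ⟨k₁, r1, hs1, p1⟩ := reach_test hσ hk hs hse (by omega) hc.1
      ((codeAt_cons.1 hc.2.1).1)
    rw [if_neg (by omega)] at p1
    obtain ⟨k₂, r2, hs2, p2, b2⟩ := ih (by omega) hσ k₁ r1.bounded hs1 (by
      rw [p1]; exact hc.2.2.1)
    obtain ⟨k₃, r3, hs3, p3⟩ := reach_jump r2.bounded (by omega)
      (by rw [p2, p1]; convert hc.2.2.2.1 using 1; omega) hs2
    exact ⟨k₃, (r1.trans r2).trans r3, hs3, by rw [p3, size], b2⟩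
  | whileTrue e c σ t σ₁ t₁ σ₂ hse he _ _ ih ih₁ =>
    have hB' := hB
    have hc' := hc
    simp only [mag] at hB
    simp only [code, codeAt_append, length_code, Ex.length_code] at hc
    obtain ⟨k₁, r1, hs1, p1⟩ := reach_test hσ hk hs hse (by omega) hc.1
      ((codeAt_cons.1 hc.2.1).1)
    rw [if_pos he] at p1
    obtain ⟨k₂, r2, hs2, p2, b2⟩ := ih (by omega) hσ k₁ r1.bounded hs1 (by
      rw [p1]; convert hc.2.2.1 using 1; simp only [List.length_cons, List.length_nil]; omega)
    obtain ⟨k₃, r3, hs3, p3⟩ := reach_jump r2.bounded (by omega)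
      (by rw [p2, p1]; convert hc.2.2.2 using 1; simp only [List.length_cons, List.length_nil]; omega) hs2
    obtain ⟨k₄, r4, hs4, p4, b4⟩ := ih₁ hB' b2 k₃ r3.bounded hs3 (by rw [p3]; exact hc')
    exact ⟨k₄, ((r1.trans r2).trans r3).trans r4, hs4, by rw [p4, p3], b4⟩
  | whileFalse e c σ hse he =>
    simp only [mag] at hB
    simp only [code, codeAt_append, length_code, Ex.length_code] at hc
    have hc2 := codeAt_cons.1 hc.2.1
    obtain ⟨k₁, r1, hs1, p1⟩ := reach_test hσ hk hs hse (by omega) hc.1 hc2.1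
    rw [if_neg (by omega)] at p1
    obtain ⟨k₃, r3, hs3, p3⟩ := reach_jump r1.bounded (by omega)
      (by rw [p1]; exact hc2.2) hs1
    exact ⟨k₃, r1.trans r3, hs3, by rw [p3, size], hσ⟩

/-- The bound is a polynomial in `u` whose degree depends on the expression only. Because of `2 ≤
u`, constants are absorbed by the exponent, for instance `c ≤ 2 ^ c ≤ u ^ c`. -/
theorem Ex.exists_mag_le (e : Ex V) : ∃ D, ∀ u, 2 ≤ u → e.mag u ≤ u ^ D := by
  have hadd : ∀ {f g : ℕ → ℕ}, (∃ D, ∀ u, 2 ≤ u → f u ≤ u ^ D) → (∃ D, ∀ u, 2 ≤ u → g u ≤ u ^ D) →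
      ∃ D, ∀ u, 2 ≤ u → f u + g u ≤ u ^ D := by
    rintro f g ⟨D, hD⟩ ⟨D', hD'⟩
    refine ⟨D + D' + 1, fun u hu => ?_⟩
    have h1 : u ^ D ≤ u ^ (D + D') := Nat.pow_le_pow_right (by omega) (by omega)
    have h2 : u ^ D' ≤ u ^ (D + D') := Nat.pow_le_pow_right (by omega) (by omega)
    have h3 := hD u hu
    have h4 := hD' u hu
    rw [pow_succ]
    nlinarith
  have hmul : ∀ {f g : ℕ → ℕ}, (∃ D, ∀ u, 2 ≤ u → f u ≤ u ^ D) → (∃ D, ∀ u, 2 ≤ u → g u ≤ u ^ D) →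
      ∃ D, ∀ u, 2 ≤ u → f u * g u ≤ u ^ D := by
    rintro f g ⟨D, hD⟩ ⟨D', hD'⟩
    exact ⟨D + D', fun u hu => by rw [pow_add]; exact Nat.mul_le_mul (hD u hu) (hD' u hu)⟩
  have hlit : ∀ c : ℕ, ∃ D, ∀ u, 2 ≤ u → c ≤ u ^ D := fun c =>
    ⟨c, fun u hu => (Nat.lt_two_pow_self).le.trans (Nat.pow_le_pow_left hu c)⟩
  have hid : ∃ D, ∀ u : ℕ, 2 ≤ u → u ≤ u ^ D := ⟨1, fun u _ => by simp⟩
  induction e with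
  | lit c => exact hlit _
  | var v => exact hid
  | add x y hx hy => exact hadd hx hy
  | sub x y hx hy => exact hadd hx hy
  | mul x y hx hy => exact hmul (hadd hx (hlit 1)) (hadd hy (hlit 1))
  | div x y hx hy => exact hadd hx hy
  | get r i j hi hj =>
    exact hadd hid (hmul (hlit 16) (hmul (hadd (hadd hi hj) (hlit 1)) (hadd (hadd hi hj) (hlit 1))))
  | raw i hi => exact hadd hid hi

theorem Cmd.exists_mag_le (c : Cmd V) : ∃ D, ∀ u, 2 ≤ u → c.mag u ≤ u ^ D := by
  have hadd : ∀ {f g : ℕ → ℕ}, (∃ D, ∀ u, 2 ≤ u → f u ≤ u ^ D) → (∃ D, ∀ u, 2 ≤ u → g u ≤ u ^ D) →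
      ∃ D, ∀ u, 2 ≤ u → f u + g u ≤ u ^ D := by
    rintro f g ⟨D, hD⟩ ⟨D', hD'⟩
    refine ⟨D + D' + 1, fun u hu => ?_⟩
    have h1 : u ^ D ≤ u ^ (D + D') := Nat.pow_le_pow_right (by omega) (by omega)
    have h2 : u ^ D' ≤ u ^ (D + D') := Nat.pow_le_pow_right (by omega) (by omega)
    have h3 := hD u hu
    have h4 := hD' u hu
    rw [pow_succ]
    nlinarith
  have h1 : ∃ D, ∀ u : ℕ, 2 ≤ u → 1 ≤ u ^ D := ⟨0, fun u _ => by simp⟩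
  induction c with
  | skip => exact ⟨0, fun u _ => by simp [mag]⟩
  | set v e => exact e.exists_mag_le
  | put r i j e =>
    refine hadd e.exists_mag_le ?_
    -- The address term of a write access is a summand of the bound for the corresponding read
    -- access.
    obtain ⟨D, hD⟩ := (Ex.get r i j).exists_mag_le
    exact ⟨D, fun u hu => le_trans (by simp [Ex.mag]) (hD u hu)⟩
  | rput i e => exact hadd e.exists_mag_le i.exists_mag_le
  | seq c d hc hd => exact hadd hc hd
  | ite e c d hc hd => exact hadd (hadd (hadd e.exists_mag_le hc) hd) h1
  | loopWhile e c hc => exact hadd (hadd e.exists_mag_le hc) h1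

end RAMLang

/-! ### Program logic: frame conditions and total correctness with running times. -/

namespace RAMLang
variable {V : Type} [DecidableEq V]

namespace Cmd

/-- Does the program assign to the register `v`? -/
def writesReg (v : V) : Cmd V → Bool
  | skip => false
  | set w _ => decide (v = w)
  | put _ _ _ _ => false
  | rput _ _ => false
  | seq c d => c.writesReg v || d.writesReg v
  | ite _ c d => c.writesReg v || d.writesReg v
  | loopWhile _ c => c.writesReg v

/-- Does the program assign to the array `r`? -/
def writesArr (r : Fin 4) : Cmd V → Bool
  | skip => false
  | set _ _ => false
  | put r' _ _ _ => decide (r = r')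
  | rput _ _ => false
  | seq c d => c.writesArr r || d.writesArr r
  | ite _ c d => c.writesArr r || d.writesArr r
  | loopWhile _ c => c.writesArr r

/-- Does the program assign to the raw memory? -/
def writesRaw : Cmd V → Bool
  | skip => false
  | set _ _ => false
  | put _ _ _ _ => false
  | rput _ _ => true
  | seq c d => c.writesRaw || d.writesRaw
  | ite _ c d => c.writesRaw || d.writesRaw
  | loopWhile _ c => c.writesRaw

/-- `for v in 0, ..., w - 1 do c`. -/
def loop (v w : V) (c : Cmd V) : Cmd V :=
  .seq (.set v (.lit 0)) (.loopWhile (.sub (.var w) (.var v))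
    (.seq c (.set v (.add (.var v) (.lit 1)))))

end Cmd

/-- The states `σ` and `σ'` agree on everything that `c` does not assign to. -/
structure Frame (c : Cmd V) (σ σ' : St V) : Prop where
  reg : ∀ v, c.writesReg v = false → σ'.reg v = σ.reg v
  arr : ∀ r, c.writesArr r = false → σ'.arr r = σ.arr r
  raw : c.writesRaw = false → σ'.raw = σ.raw

theorem Frame.refl (c : Cmd V) (σ : St V) : Frame c σ σ :=
  ⟨fun _ _ => rfl, fun _ _ => rfl, fun _ => rfl⟩

theorem Frame.trans {c : Cmd V} {σ σ₁ σ₂ : St V} (h : Frame c σ σ₁) (h' : Frame c σ₁ σ₂) :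
    Frame c σ σ₂ :=
  ⟨fun v hv => (h'.reg v hv).trans (h.reg v hv), fun v hv => (h'.arr v hv).trans (h.arr v hv),
    fun hv => (h'.raw hv).trans (h.raw hv)⟩

theorem Frame.mono {c d : Cmd V} {σ σ' : St V} (h : Frame c σ σ')
    (hr : ∀ v, d.writesReg v = false → c.writesReg v = false)
    (ha : ∀ v, d.writesArr v = false → c.writesArr v = false)
    (hm : d.writesRaw = false → c.writesRaw = false) : Frame d σ σ' :=
  ⟨fun v hv => h.reg v (hr v hv), fun v hv => h.arr v (ha v hv), fun hv => h.raw (hm hv)⟩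

/-- A frame only depends on the target of an assignment, so the right-hand side of the command may
be a dummy. -/
theorem Frame.set (σ : St V) (v : V) (x : ℤ) : Frame (.set v (.lit 0)) σ (σ.set v x) :=
  ⟨fun w hw => by simp_all [St.set, Cmd.writesReg], fun _ _ => rfl, fun _ => rfl⟩

theorem Frame.put (σ : St V) (r : Fin 4) (i j x : ℤ) :
    Frame (.put r (.lit 0) (.lit 0) (.lit 0)) σ (σ.put r i j x) :=
  ⟨fun _ _ => rfl, fun w hw => by
    simp only [Cmd.writesArr, decide_eq_false_iff_not] at hw
    funext i' j'; simp [St.put, hw], fun _ => rfl⟩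

theorem Runs.frame {u : ℕ} {c : Cmd V} {σ σ' : St V} {t : ℕ} (h : Runs u c σ t σ') :
    Frame c σ σ' := by
  induction h with
  | skip σ => exact Frame.refl _ _
  | set v e σ h hu =>
    exact ⟨fun w hw => by simp_all [St.set, Cmd.writesReg], fun _ _ => rfl, fun _ => rfl⟩
  | put r i j e σ =>
    refine ⟨fun _ _ => rfl, fun w hw => ?_, fun _ => rfl⟩
    simp only [Cmd.writesArr, decide_eq_false_iff_not] at hw
    funext i' j'; simp [St.put, hw]
  | rput i e σ => exact ⟨fun _ _ => rfl, fun _ _ => rfl, fun h => by simp [Cmd.writesRaw] at h⟩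
  | seq c d σ t σ₁ t₁ σ₂ _ _ ih ih₁ =>
    refine Frame.trans (ih.mono ?_ ?_ ?_) (ih₁.mono ?_ ?_ ?_) <;>
      simp_all [Cmd.writesReg, Cmd.writesArr, Cmd.writesRaw]
  | iteTrue e c d σ t σ₁ _ _ _ ih =>
    refine ih.mono ?_ ?_ ?_ <;> simp_all [Cmd.writesReg, Cmd.writesArr, Cmd.writesRaw]
  | iteFalse e c d σ t σ₁ _ _ _ ih =>
    refine ih.mono ?_ ?_ ?_ <;> simp_all [Cmd.writesReg, Cmd.writesArr, Cmd.writesRaw]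
  | whileTrue e c σ t σ₁ t₁ σ₂ _ _ _ _ ih ih₁ => exact Frame.trans (ih.mono (by simp [Cmd.writesReg])
      (by simp [Cmd.writesArr]) (by simp [Cmd.writesRaw])) ih₁
  | whileFalse e c σ => exact Frame.refl _ _

/-- Total correctness with running time at most `T`: from the state `σ` the program `c` reaches
a state satisfying `Q`. -/
def Tr (u : ℕ) (c : Cmd V) (T : ℕ) (σ : St V) (Q : St V → Prop) : Prop :=
  ∃ t ≤ T, ∃ σ', Runs u c σ t σ' ∧ Q σ'

namespace Tr

variable {u T T' : ℕ} {c d : Cmd V} {σ : St V} {Q R : St V → Prop}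

/-- The frame of the run is passed to the postcondition, so specifications need not mention what a
program leaves untouched. -/
theorem mono (h : Tr u c T σ Q) (hT : T ≤ T') (hQ : ∀ σ', Frame c σ σ' → Q σ' → R σ') :
    Tr u c T' σ R := by
  obtain ⟨t, ht, σ', hr, hq⟩ := h
  exact ⟨t, ht.trans hT, σ', hr, hQ σ' hr.frame hq⟩

theorem le (h : Tr u c T σ Q) (hT : T ≤ T') : Tr u c T' σ Q := h.mono hT fun _ _ h => h

theorem set {v : V} {e : Ex V} (h : e.Safe σ) (hl : -(u : ℤ) ≤ e.eval σ) (hu : e.eval σ ≤ u)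
    (hQ : Q (σ.set v (e.eval σ))) : Tr u (.set v e) (e.size + 2) σ Q :=
  ⟨_, le_rfl, _, .set v e σ h (by omega), hQ⟩

theorem seq (h : Tr u c T σ fun σ₁ => Tr u d T' σ₁ Q) : Tr u (.seq c d) (T + T') σ Q := by
  obtain ⟨t, ht, σ₁, hr, t', ht', σ₂, hr', hq⟩ := h
  exact ⟨_, Nat.add_le_add ht ht', σ₂, .seq _ _ _ _ _ _ _ hr hr', hq⟩

/-- Rule for `while` loops: the invariant is indexed by a bound for the number of the
remaining iterations. -/
theorem loopWhile {e : Ex V} (I : ℕ → St V → Prop) (m : ℕ) (hI : I m σ)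
    (hs : ∀ m σ, I m σ → e.Safe σ)
    (step : ∀ m σ, I m σ → 0 < e.eval σ → Tr u c T σ fun σ' => ∃ m' < m, I m' σ')
    (exit : ∀ m σ, I m σ → e.eval σ ≤ 0 → Q σ) :
    Tr u (.loopWhile e c) (m * (T + (e.size + 3)) + (e.size + 3)) σ Q := by
  induction m using Nat.strong_induction_on generalizing σ with
  | _ m ih =>
    rcases lt_or_ge 0 (e.eval σ) with he | he
    · obtain ⟨t, ht, σ₁, hr, m', hm', hI'⟩ := step m σ hI he
      obtain ⟨t', ht', σ₂, hr', hq⟩ := ih m' hm' hI'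
      refine ⟨_, ?_, σ₂, .whileTrue _ _ _ _ _ _ _ (hs m σ hI) he hr hr', hq⟩
      have : (m' + 1) * (T + (e.size + 3)) ≤ m * (T + (e.size + 3)) :=
        Nat.mul_le_mul_right _ hm'
      rw [add_mul, one_mul] at this
      omega
    · exact ⟨_, by omega, σ, .whileFalse _ _ _ (hs m σ hI) he, exit m σ hI he⟩

/-- Rule for `for` loops. -/
theorem loop {v w : V} {N : ℕ} (I : ℕ → St V → Prop) (hvw : v ≠ w)
    (hv : c.writesReg v = false) (hw : c.writesReg w = false) (hN : σ.reg w = N) (hu : N ≤ u)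
    (h0 : I 0 (σ.set v 0))
    (body : ∀ k < N, ∀ σ₁, I k σ₁ → σ₁.reg v = k → Frame (.loop v w c) σ σ₁ →
      Tr u c T σ₁ fun σ₂ => I (k + 1) (σ₂.set v ((k + 1 : ℕ) : ℤ)))
    (hQ : ∀ σ₁, I N σ₁ → Frame (.loop v w c) σ σ₁ → Q σ₁) :
    Tr u (.loop v w c) (N * (T + 14) + 11) σ Q := by
  have hw' : (Cmd.loop v w c).writesReg w = false := by
    simp [Cmd.loop, Cmd.writesReg, hw, Ne.symm hvw]
  -- Setting the counter to 0 costs 3 steps. Each round adds 6 for the increment and 8 for the test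
  -- with its jumps, and the final failing test costs 8.
  have key : Tr u (.seq (.set v (.lit 0)) (.loopWhile (.sub (.var w) (.var v))
      (.seq c (.set v (.add (.var v) (.lit 1)))))) (3 + (N * (T + 6 + 8) + 8)) σ Q := by
    refine seq (set trivial (by simp [Ex.eval]) (by simp [Ex.eval]) ?_)
    have hf0 : Frame (Cmd.loop v w c) σ (σ.set v 0) :=
      ⟨fun x hx => by simp_all [Cmd.loop, Cmd.writesReg, St.set], fun _ _ => rfl, fun _ => rfl⟩
    refine loopWhile (e := .sub (.var w) (.var v)) (fun m σ₁ => ∃ k : ℕ, m + k = N ∧ I k σ₁ ∧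
      σ₁.reg v = k ∧ Frame (.loop v w c) σ σ₁) N
      ⟨0, rfl, h0, by simp [St.set, Ex.eval], hf0⟩ (fun _ _ _ => ⟨trivial, trivial⟩) ?_ ?_
    · rintro m σ₁ ⟨k, hk, hI, hkv, hF⟩ he
      have hwN : σ₁.reg w = N := by rw [hF.reg w hw', hN]
      simp only [Ex.eval, hwN, hkv] at he
      have hkN : k < N := by omega
      refine seq ((body k hkN σ₁ hI hkv hF).mono le_rfl fun σ₂ hF₂ h₂ => ?_)
      have hv₂ : σ₂.reg v = k := by rw [hF₂.reg v hv, hkv]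
      have hval : (Ex.add (.var v) (.lit 1)).eval σ₂ = ((k + 1 : ℕ) : ℤ) := by
        simp [Ex.eval, hv₂]
      have hF₃ : Frame (.loop v w c) σ₁ σ₂ :=
        hF₂.mono (fun x => by simp +contextual [Cmd.loop, Cmd.writesReg])
          (fun x => by simp +contextual [Cmd.loop, Cmd.writesArr])
          (by simp +contextual [Cmd.loop, Cmd.writesRaw])
      refine set ⟨trivial, trivial⟩ (by rw [hval]; omega) (by rw [hval]; omega)
        ⟨m - 1, by omega, k + 1, by omega, ?_, ?_, ?_⟩
      · rw [hval]; exact h₂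
      · rw [hval]; simp [St.set]
      · refine (hF.trans hF₃).trans ⟨fun x hx => ?_, fun _ _ => rfl, fun _ => rfl⟩
        have : x ≠ v := by rintro rfl; simp [Cmd.loop, Cmd.writesReg] at hx
        simp [St.set, this]
    · rintro m σ₁ ⟨k, hk, hI, hkv, hF⟩ he
      have hwN : σ₁.reg w = N := by rw [hF.reg w hw', hN]
      simp only [Ex.eval, hwN, hkv] at he
      obtain rfl : k = N := by omega
      exact hQ σ₁ hI hF
  refine key.le ?_
  have : T + 6 + 8 = T + 14 := by ring
  rw [this]; omega

end Tr

/-- From the state `σ` the program `c` halts, and the running time and the final state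
satisfy `Q`. -/
def Wp (u : ℕ) (c : Cmd V) (σ : St V) (Q : ℕ → St V → Prop) : Prop :=
  ∃ t σ', Runs u c σ t σ' ∧ Q t σ'

theorem Tr.of_wp {u T : ℕ} {c : Cmd V} {σ : St V} {Q : St V → Prop}
    (h : Wp u c σ fun t σ' => t ≤ T ∧ Q σ') : Tr u c T σ Q := by
  obtain ⟨t, σ', hr, ht, hq⟩ := h
  exact ⟨t, ht, σ', hr, hq⟩

namespace Wp

variable {u T : ℕ} {c d : Cmd V} {σ : St V} {Q : ℕ → St V → Prop} {R : St V → Prop}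

theorem of_tr (h : Tr u c T σ R) (hQ : ∀ t ≤ T, ∀ σ', Frame c σ σ' → R σ' → Q t σ') :
    Wp u c σ Q := by
  obtain ⟨t, ht, σ', hr, hq⟩ := h
  exact ⟨t, σ', hr, hQ t ht σ' hr.frame hq⟩

theorem skip (h : Q 0 σ) : Wp u .skip σ Q := ⟨0, σ, .skip σ, h⟩

theorem set {v : V} {e : Ex V} (h : e.Safe σ) (hu : -(u : ℤ) ≤ e.eval σ ∧ e.eval σ ≤ u)
    (hQ : Q (e.size + 2) (σ.set v (e.eval σ))) : Wp u (.set v e) σ Q :=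
  ⟨_, _, .set v e σ h (by omega), hQ⟩

theorem put {r : Fin 4} {i j e : Ex V} (he : e.Safe σ) (hi : i.Safe σ ∧ 0 ≤ i.eval σ)
    (hj : j.Safe σ ∧ 0 ≤ j.eval σ) (hu : -(u : ℤ) ≤ e.eval σ ∧ e.eval σ ≤ u)
    (hQ : Q (e.size + i.size + j.size + 8) (σ.put r (i.eval σ) (j.eval σ) (e.eval σ))) :
    Wp u (.put r i j e) σ Q :=
  ⟨_, _, .put r i j e σ he hi.1 hj.1 hi.2 hj.2 (by omega), hQ⟩

theorem rput {i e : Ex V} (he : e.Safe σ) (hi : i.Safe σ ∧ 0 ≤ i.eval σ)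
    (hu : -(u : ℤ) ≤ e.eval σ ∧ e.eval σ ≤ u)
    (hQ : Q (e.size + i.size + 1) (σ.rput (i.eval σ) (e.eval σ))) : Wp u (.rput i e) σ Q :=
  ⟨_, _, .rput i e σ he hi.1 hi.2 (by omega), hQ⟩

theorem seq (h : Wp u c σ fun t σ₁ => Wp u d σ₁ fun t' σ₂ => Q (t + t') σ₂) :
    Wp u (.seq c d) σ Q := by
  obtain ⟨t, σ₁, hr, t', σ₂, hr', hq⟩ := h
  exact ⟨_, σ₂, .seq _ _ _ _ _ _ _ hr hr', hq⟩

theorem ite {e : Ex V} (hs : e.Safe σ)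
    (h : 0 < e.eval σ → Wp u c σ fun t σ' => Q (e.size + 1 + t) σ')
    (h' : e.eval σ ≤ 0 → Wp u d σ fun t σ' => Q (e.size + 1 + t + 2) σ') :
    Wp u (.ite e c d) σ Q := by
  rcases lt_or_ge 0 (e.eval σ) with he | he
  · obtain ⟨t, σ₁, hr, hq⟩ := h he
    exact ⟨_, σ₁, .iteTrue _ _ _ _ _ _ hs he hr, hq⟩
  · obtain ⟨t, σ₁, hr, hq⟩ := h' he
    exact ⟨_, σ₁, .iteFalse _ _ _ _ _ _ hs he hr, hq⟩

end Wp

/-- From a specification of a program to a run of the compiled machine program. -/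
theorem Tr.compile {enc : V → ℕ} (henc : Function.Injective enc) {c : Cmd V} {u B T : ℕ}
    {σ : St V} {Q : St V → Prop} (h : Tr u c T σ Q) (hσ : σ.Bounded u) (hB : c.mag u ≤ B)
    {k : RAMConfig} (hk : k.BoundedBy B) (hs : Sim enc σ k) (hpc : k.pc = 0) :
    ∃ t ≤ T + 1, ∃ k' σ', Reach (c.code enc 0 ++ [RAMInstr.const 1 0]) B k k' t ∧
      k'.pc = (c.code enc 0 ++ [RAMInstr.const 1 0]).length ∧ Sim enc σ' k' ∧ k'.reg 1 = 0 ∧ Q σ' := by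
  obtain ⟨t, ht, σ', hr, hq⟩ := h
  have hc : CodeAt (c.code enc 0 ++ [RAMInstr.const 1 0]) 0 (c.code enc 0 ++ [RAMInstr.const 1 0]) :=
    fun k _ => by simp
  rw [codeAt_append, Cmd.length_code, codeAt_cons] at hc
  obtain ⟨k', r1, hs1, p1, -⟩ := Cmd.code_spec henc hr hB hσ k hk hs (by rw [hpc]; exact hc.1)
  rw [hpc] at p1
  -- The last instruction clears register 1: the output convention reads it as the address of the
  -- table of breakpoints, which begins at address 0.
  have s2 := Scratch.write (d := 0) (d' := 0) (x := 0) r1.bounded (by rw [p1]; exact hc.2.1)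
    rfl le_rfl (by simp)
  exact ⟨t + 1, by omega, _, σ', r1.trans s2.reach, by
    simp [RAMConfig.write, p1, Cmd.length_code], hs1.scratch s2, by simp [RAMConfig.write], hq⟩

end RAMLang

namespace KnapsackDP

/-! ### Dynamic programming -/

section DP

variable (w : ℕ → ℤ) (q : ℕ → ℕ) (inf : ℤ)

/-- `dp i j` is the least weight of a subset of the first `i` items with total value at
least `j`, where a missing value is penalized by `inf`. -/
def dp : ℕ → ℕ → ℤ
  | 0, j => if j = 0 then 0 else inf
  | i + 1, j => min (dp i j) (dp i (j - q i) + w i)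

/-- A set attaining `dp i j`. -/
def dpSet : ℕ → ℕ → Finset ℕ
  | 0, _ => ∅
  | i + 1, j => if dp w q inf (i + 1) j < dp w q inf i j then insert i (dpSet i (j - q i))
      else dpSet i j

/-- The value that `dpSet i j` misses. -/
def dpRest : ℕ → ℕ → ℕ
  | 0, j => j
  | i + 1, j => if dp w q inf (i + 1) j < dp w q inf i j then dpRest i (j - q i)
      else dpRest i j

theorem dpSet_subset (i j : ℕ) : dpSet w q inf i j ⊆ Finset.range i := by
  induction i generalizing j with
  | zero => simp [dpSet]
  | succ i ih =>
    simp only [dpSet]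
    split_ifs
    · rw [Finset.range_add_one]; exact Finset.insert_subset_insert _ (ih _)
    · exact (ih _).trans (Finset.range_subset_range.2 (by omega))

theorem notMem_dpSet (i j : ℕ) : i ∉ dpSet w q inf i j := fun h => by
  simpa using dpSet_subset w q inf i j h

/-- Induction on `i`, removing item `i` from the set if it is there. The truncated subtraction `j -
q i` permits the target to be exceeded. -/
theorem dp_le (i j : ℕ) (s : Finset ℕ) (hs : s ⊆ Finset.range i) (hj : j ≤ ∑ k ∈ s, q k) :
    dp w q inf i j ≤ ∑ k ∈ s, w k := by
  induction i generalizing j s with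
  | zero =>
    obtain rfl : s = ∅ := by simpa using hs
    obtain rfl : j = 0 := by simpa using hj
    simp [dp]
  | succ i ih =>
    by_cases hi : i ∈ s
    · have h1 := ih (j - q i) (s.erase i) (fun k hk => by
        have := hs (Finset.mem_of_mem_erase hk)
        have := Finset.ne_of_mem_erase hk
        simp at *; omega) (by rw [← Finset.add_sum_erase _ _ hi] at hj; omega)
      rw [← Finset.add_sum_erase _ _ hi, dp]
      exact (min_le_right _ _).trans (by linarith)
    · exact (min_le_left _ _).trans (ih j s (fun k hk => by
        have := hs hk
        have : k ≠ i := fun h => hi (h ▸ hk)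
        simp at *; omega) hj)

/-- `dpSet` and `dpRest` repeat the choices of the recursion. The value that is still missing in row
0 is charged with `inf`. -/
theorem dp_eq (i j : ℕ) : dp w q inf i j =
    (if dpRest w q inf i j = 0 then 0 else inf) + ∑ k ∈ dpSet w q inf i j, w k := by
  induction i generalizing j with
  | zero => by_cases h : j = 0 <;> simp [dp, dpRest, dpSet, h]
  | succ i ih =>
    simp only [dpRest, dpSet]
    split_ifs with h h'
    · rw [Finset.sum_insert (notMem_dpSet w q inf i _)]
      have := ih (j - q i)
      rw [if_pos h'] at this
      simp only [dp] at h ⊢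
      rw [min_eq_right (by omega)]; omega
    · rw [Finset.sum_insert (notMem_dpSet w q inf i _)]
      have := ih (j - q i)
      rw [if_neg h'] at this
      simp only [dp] at h ⊢
      rw [min_eq_right (by omega)]; omega
    · have := ih j
      simp only [dp] at h ⊢
      rw [min_eq_left (by omega)]; simp_all
    · have := ih j
      simp only [dp] at h ⊢
      rw [min_eq_left (by omega)]; simp_all

theorem le_sum_dpSet (i j : ℕ) :
    j ≤ ∑ k ∈ dpSet w q inf i j, q k + dpRest w q inf i j := by
  induction i generalizing j with
  | zero => simp [dpRest]
  | succ i ih =>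
    simp only [dpRest, dpSet]
    split_ifs
    · rw [Finset.sum_insert (notMem_dpSet w q inf i _)]
      have := ih (j - q i)
      omega
    · exact ih j

/-- Needed for the bound on the stored integers. -/
theorem abs_dp_le (i j : ℕ) (hinf : 0 ≤ inf) :
    |dp w q inf i j| ≤ inf + ∑ k ∈ Finset.range i, |w k| := by
  induction i generalizing j with
  | zero => simp only [dp]; split_ifs <;> simp [abs_of_nonneg, hinf]
  | succ i ih =>
    rw [Finset.sum_range_succ, dp]
    have h1 := abs_le.1 (ih j)
    have h2 := abs_le.1 (ih (j - q i))
    have h3 := abs_le.1 (le_refl |w i|)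
    rcases min_choice (dp w q inf i j) (dp w q inf i (j - q i) + w i) with h | h <;> rw [h, abs_le]
    · constructor <;> linarith [abs_nonneg (w i)]
    · constructor <;> linarith

/-- If `inf` is large, `dpSet` is a set of value at least `j` of least weight, provided that it
misses nothing; otherwise there is no set of value at least `j`. -/
theorem dpSet_spec {n j : ℕ} (hinf : 2 * ∑ k ∈ Finset.range n, |w k| < inf) {s : Finset ℕ}
    (hs : s ⊆ Finset.range n) (hj : j ≤ ∑ k ∈ s, q k) :
    dpRest w q inf n j = 0 ∧ ∑ k ∈ dpSet w q inf n j, w k ≤ ∑ k ∈ s, w k := by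
  have h1 := dp_le w q inf n j s hs hj
  rw [dp_eq] at h1
  have key : ∀ t ⊆ Finset.range n, |∑ k ∈ t, w k| ≤ ∑ k ∈ Finset.range n, |w k| := fun t ht =>
    (Finset.abs_sum_le_sum_abs _ _).trans
      (Finset.sum_le_sum_of_subset_of_nonneg ht fun _ _ _ => abs_nonneg _)
  have h2 := abs_le.1 (key s hs)
  have h3 := abs_le.1 (key _ (dpSet_subset w q inf n j))
  have h4 : dpRest w q inf n j = 0 := by
    by_contra h
    rw [if_neg h] at h1
    linarith
  rw [if_pos h4] at h1
  exact ⟨h4, by linarith⟩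

end DP

/-! ### Sequences of halving subset sums -/

/-- Downward induction: the tail behind `i` is `S (i + 1)` plus a smaller tail, hence less than `2 *
S (i + 1) ≤ S i` (or empty). -/
theorem tail_lt_of_halving {S : ℕ → ℝ} {m : ℕ} (hpos : ∀ i < m, 0 < S i)
    (hhalf : ∀ i, i + 1 < m → 2 * S (i + 1) ≤ S i) (d i : ℕ) (hd : i + d + 1 = m) :
    ∑ k ∈ Finset.Ico (i + 1) m, S k < S i := by
  induction d generalizing i with
  | zero => subst hd; simpa using hpos i (by omega)
  | succ d ih =>
    rw [Finset.sum_eq_sum_Ico_succ_bot (by omega)]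
    have h1 := ih (i + 1) (by omega)
    have h2 := hhalf i (by omega)
    linarith

/-- At the first index where the two sets differ, the set containing it has an advantage that the
whole remaining tail cannot make up for. -/
theorem eq_of_sum_eq_of_halving {S : ℕ → ℝ} {m : ℕ} (hpos : ∀ i < m, 0 < S i)
    (hhalf : ∀ i, i + 1 < m → 2 * S (i + 1) ≤ S i) {T T' : Finset ℕ}
    (hT : T ⊆ Finset.range m) (hT' : T' ⊆ Finset.range m)
    (h : ∑ i ∈ T, S i = ∑ i ∈ T', S i) : T = T' := by
  have key : ∀ {T T' : Finset ℕ}, T ⊆ Finset.range m → T' ⊆ Finset.range m →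
      ∑ i ∈ T, S i = ∑ i ∈ T', S i → ∀ i ∈ T, i ∉ T' → (∀ j < i, j ∈ T ↔ j ∈ T') → False := by
    intro T T' hT hT' h i hi hi' hlt
    have h1 : ∑ i ∈ T \ T', S i = ∑ i ∈ T' \ T, S i := by
      have e1 := Finset.sum_inter_add_sum_sdiff T T' S
      have e2 := Finset.sum_inter_add_sum_sdiff T' T S
      rw [Finset.inter_comm] at e2
      linarith
    have him : i < m := by simpa using hT hi
    have h2 : ∑ i ∈ T' \ T, S i ≤ ∑ k ∈ Finset.Ico (i + 1) m, S k := by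
      refine Finset.sum_le_sum_of_subset_of_nonneg (fun j hj => ?_) fun j hj _ => ?_
      · rw [Finset.mem_sdiff] at hj
        have h3 : j < m := by simpa using hT' hj.1
        have h4 : j ≠ i := fun h => hi' (h ▸ hj.1)
        have h5 : ¬ j < i := fun h => hj.2 ((hlt j h).2 hj.1)
        simp; omega
      · exact (hpos j (by simp at hj; omega)).le
    have h3 : S i ≤ ∑ i ∈ T \ T', S i :=
      Finset.single_le_sum (f := S) (fun j hj => (hpos j (by
        simpa using hT (Finset.mem_sdiff.1 hj).1)).le) (Finset.mem_sdiff.2 ⟨hi, hi'⟩)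
    have := tail_lt_of_halving hpos hhalf (m - i - 1) i (by omega)
    linarith
  by_contra hne
  have hex : ∃ i, ¬ (i ∈ T ↔ i ∈ T') := by
    by_contra hcon
    push Not at hcon
    exact hne (Finset.ext hcon)
  classical
  have hmin : ∀ j < Nat.find hex, j ∈ T ↔ j ∈ T' := fun j hj => not_not.1 (Nat.find_min hex hj)
  have hspec := Nat.find_spec hex
  by_cases hi : Nat.find hex ∈ T
  · exact key hT hT' h _ hi (fun h' => hspec ⟨fun _ => h', fun _ => hi⟩) hmin
  · have hi' : Nat.find hex ∈ T' := by tauto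
    exact key hT' hT h.symm _ hi' hi fun j hj => (hmin j hj).symm

/-- A sequence of `m` positive subset sums of `k` real numbers in which each member is at most
half of its predecessor satisfies `2 ^ m ≤ (m + 1) ^ k`. -/
theorem two_pow_le_of_halving (G : Finset ℕ) (c : ℕ → ℝ) (s : ℕ → Finset ℕ) (m : ℕ)
    (hs : ∀ i < m, s i ⊆ G) (hpos : ∀ i < m, 0 < ∑ j ∈ s i, c j)
    (hhalf : ∀ i, i + 1 < m → 2 * ∑ j ∈ s (i + 1), c j ≤ ∑ j ∈ s i, c j) :
    2 ^ m ≤ (m + 1) ^ G.card := by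
  by_contra! hlt
  -- `f T j` counts the members of the sequence with index in `T` that use the number `c j`. The
  -- count is at most `m`, so the reduction modulo `m + 1` is harmless.
  let f : Finset ℕ → (G → Fin (m + 1)) := fun T j =>
    Fin.ofNat (m + 1) ((T.filter fun i => (j : ℕ) ∈ s i).card)
  have hcard : (Finset.univ : Finset (G → Fin (m + 1))).card <
      (Finset.range m).powerset.card := by
    simpa using hlt
  -- Two different index sets have the same counts, hence the same total, which is impossible for a
  -- sequence that halves.
  obtain ⟨T, hT, T', hT', hne, heq⟩ :=
    Finset.exists_ne_map_eq_of_card_lt_of_maps_to hcard (f := f) (fun _ _ => Finset.mem_univ _)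
  rw [Finset.mem_powerset] at hT hT'
  have hval : ∀ T ⊆ Finset.range m, ∀ j : G,
      ((f T j : ℕ)) = (T.filter fun i => (j : ℕ) ∈ s i).card := fun T hT j => by
    have : (T.filter fun i => (j : ℕ) ∈ s i).card ≤ m :=
      (Finset.card_filter_le _ _).trans ((Finset.card_le_card hT).trans (by simp))
    simp only [f, Fin.ofNat]
    exact Nat.mod_eq_of_lt (by omega)
  have hsum : ∀ T ⊆ Finset.range m, ∑ i ∈ T, ∑ j ∈ s i, c j =
      ∑ j ∈ G.attach, ((f T j : ℕ) : ℝ) * c j := fun T hT => by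
    have h1 : ∀ i ∈ T, ∑ j ∈ s i, c j = ∑ j ∈ G, if j ∈ s i then c j else 0 := fun i hi => by
      rw [← Finset.sum_filter, Finset.filter_mem_eq_inter,
        Finset.inter_eq_right.2 (hs i (by simpa using hT hi))]
    rw [Finset.sum_congr rfl h1, Finset.sum_comm, ← Finset.sum_attach]
    refine Finset.sum_congr rfl fun j _ => ?_
    rw [hval T hT j, ← Finset.sum_filter]
    simp
  exact hne (eq_of_sum_eq_of_halving hpos hhalf hT hT'
    (by rw [hsum T hT, hsum T' hT', heq]))

/-! ### Newton's method -/

/-- A run of Newton's method of length `N` for the smallest `lam` at which a set `s` with `F s`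
satisfies `∑ a + lam * ∑ b ≤ W`. -/
structure NewtonChain (F : Finset ℕ → Prop) (a b : ℕ → ℤ) (W : ℤ) (N : ℕ) (lam : ℕ → ℝ)
    (s : ℕ → Finset ℕ) : Prop where
  mem : ∀ i < N, F (s i)
  neg : ∀ i < N, ∑ k ∈ s i, b k < 0
  gap : ∀ i < N, ((∑ k ∈ s i, a k : ℤ) : ℝ) + lam i * ((∑ k ∈ s i, b k : ℤ) : ℝ) < W
  next : ∀ i < N, lam (i + 1) * ((∑ k ∈ s i, b k : ℤ) : ℝ) = W - ((∑ k ∈ s i, a k : ℤ) : ℝ)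
  opt : ∀ i < N, ∀ t, F t →
    ((∑ k ∈ s i, a k : ℤ) : ℝ) + lam i * ((∑ k ∈ s i, b k : ℤ) : ℝ) ≤
      ((∑ k ∈ t, a k : ℤ) : ℝ) + lam i * ((∑ k ∈ t, b k : ℤ) : ℝ)

namespace NewtonChain

variable {F : Finset ℕ → Prop} {a b : ℕ → ℤ} {W : ℤ} {N : ℕ} {lam : ℕ → ℝ} {s : ℕ → Finset ℕ}

/-- The slope of the current line, with opposite sign. -/
noncomputable def slope (b : ℕ → ℤ) (s : ℕ → Finset ℕ) (i : ℕ) : ℝ :=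
  -((∑ k ∈ s i, b k : ℤ) : ℝ)

/-- The slack of the current line. -/
noncomputable def slack (a b : ℕ → ℤ) (W : ℤ) (lam : ℕ → ℝ) (s : ℕ → Finset ℕ) (i : ℕ) : ℝ :=
  W - ((∑ k ∈ s i, a k : ℤ) : ℝ) + lam i * slope b s i

variable (h : NewtonChain F a b W N lam s)
include h

theorem slope_ge_one {i : ℕ} (hi : i < N) : 1 ≤ slope b s i := by
  have := h.neg i hi
  have : (1 : ℤ) ≤ -(∑ k ∈ s i, b k) := by omega
  unfold slope; exact_mod_cast this

theorem slope_pos {i : ℕ} (hi : i < N) : 0 < slope b s i :=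
  lt_of_lt_of_le one_pos (h.slope_ge_one hi)

theorem slack_pos {i : ℕ} (hi : i < N) : 0 < slack a b W lam s i := by
  have := h.gap i hi
  unfold slack slope; linarith

theorem slack_eq {i : ℕ} (hi : i < N) :
    (lam i - lam (i + 1)) * slope b s i = slack a b W lam s i := by
  have := h.next i hi
  unfold slack slope; linarith

theorem lam_lt {i : ℕ} (hi : i < N) : lam (i + 1) < lam i := by
  have h1 := h.slack_eq hi
  have h2 := h.slack_pos hi
  have h3 := h.slope_pos hi
  by_contra! hcon
  nlinarith

/-- The set `s i` is optimal at `lam i`; comparing it with `s (i + 1)` there bounds `slack (i + 1) +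
(lam i - lam (i + 1)) * slope (i + 1)` by `slack i`. After division by `slack i * slope i`, the
claim is that the ratios of consecutive slacks and consecutive slopes add up to at most 1. -/
theorem key {i : ℕ} (hi : i + 1 < N) :
    slack a b W lam s (i + 1) * slope b s i + slack a b W lam s i * slope b s (i + 1) ≤
      slack a b W lam s i * slope b s i := by
  have h1 := h.opt i (by omega) (s (i + 1)) (h.mem _ hi)
  have h2 := h.slack_eq (i := i) (by omega)
  have h3 := h.slope_pos (i := i) (by omega)
  have h4 : slack a b W lam s (i + 1) + (lam i - lam (i + 1)) * slope b s (i + 1) ≤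
      slack a b W lam s i := by
    unfold slack slope; linarith
  have h5 := mul_le_mul_of_nonneg_right h4 h3.le
  have h6 : (lam i - lam (i + 1)) * slope b s (i + 1) * slope b s i =
      slack a b W lam s i * slope b s (i + 1) := by rw [← h2]; ring
  rw [add_mul, h6] at h5
  exact h5

theorem slope_lt {i : ℕ} (hi : i + 1 < N) : slope b s (i + 1) < slope b s i := by
  have h1 := h.key hi
  have h2 := mul_pos (h.slack_pos hi) (h.slope_pos (i := i) (by omega))
  have h3 := h.slack_pos (i := i) (by omega)
  by_contra! hcon
  nlinarith

theorem slope_anti {i j : ℕ} (hij : i ≤ j) (hj : j < N) : slope b s j ≤ slope b s i := by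
  induction j, hij using Nat.le_induction with
  | base => exact le_rfl
  | succ j _ ih => exact (h.slope_lt hj).le.trans (ih (by omega))

/-- Two nonnegative ratios with sum at most 1 have product at most `1 / 4`. -/
theorem four_mul_le {i : ℕ} (hi : i + 1 < N) :
    4 * (slack a b W lam s (i + 1) * slope b s (i + 1)) ≤ slack a b W lam s i * slope b s i := by
  have h1 := h.key hi
  have p1 := h.slack_pos hi
  have p2 := h.slope_pos hi
  have p3 := h.slack_pos (i := i) (by omega)
  have p4 := h.slope_pos (i := i) (by omega)
  set x := slack a b W lam s (i + 1)
  set y := slope b s (i + 1)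
  set z := slack a b W lam s i
  set t := slope b s i
  have hzt := mul_pos p3 p4
  have h2 : 4 * ((x * t) * (z * y)) ≤ (z * t) * (z * t) := by
    have h3 : (x * t + z * y) * (x * t + z * y) ≤ (z * t) * (z * t) :=
      mul_self_le_mul_self (by positivity) h1
    nlinarith [sq_nonneg (x * t - z * y)]
  have h4 : (z * t) * (4 * (x * y)) ≤ (z * t) * (z * t) := by linarith
  exact le_of_mul_le_mul_left h4 hzt

theorem four_pow_mul_le {i : ℕ} (hi : i < N) :
    4 ^ i * (slack a b W lam s i * slope b s i) ≤ slack a b W lam s 0 * slope b s 0 := by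
  induction i with
  | zero => simp
  | succ i ih =>
    have h1 := ih (by omega)
    have h2 := h.four_mul_le hi
    have : (0 : ℝ) < 4 ^ i := by positivity
    rw [pow_succ]
    nlinarith

/-- The parameter `lam (i + 1)` is a fraction with denominator `slope i`, so this product is a
positive integer. -/
theorem one_le_slack_mul {i : ℕ} (hi : i + 1 < N) :
    1 ≤ slack a b W lam s (i + 1) * slope b s i := by
  have h1 := h.next i (by omega)
  have h2 : slack a b W lam s (i + 1) * slope b s i =
      ((-(W - ∑ k ∈ s (i + 1), a k) * (∑ k ∈ s i, b k) +
        (W - ∑ k ∈ s i, a k) * (∑ k ∈ s (i + 1), b k) : ℤ) : ℝ) := by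
    push_cast
    push_cast at h1
    rw [← h1]
    unfold slack slope
    push_cast
    ring
  have h3 : 0 < slack a b W lam s (i + 1) * slope b s i :=
    mul_pos (h.slack_pos hi) (h.slope_pos (by omega))
  rw [h2] at h3 ⊢
  exact_mod_cast h3

/-- At the start the slack is at most `W + S + S ^ 2 ≤ 3 * S ^ 2` and the slope at most `S`. At the
end `one_le_slack_mul` bounds the slack from below, at the price of one more factor `slope ≤ S`. -/
theorem four_pow_le {S : ℝ} (hS : 1 ≤ S) (hlam : lam 0 ≤ S) (hW : (W : ℝ) ≤ S)
    (ha : ∀ i < N, -S ≤ ((∑ k ∈ s i, a k : ℤ) : ℝ))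
    (hb : ∀ i < N, slope b s i ≤ S) : (4 : ℝ) ^ N ≤ 12 * S ^ 4 := by
  have hS4 : 1 ≤ S ^ 4 := one_le_pow₀ hS
  rcases N with _ | _ | N
  · simp; linarith
  · norm_num; linarith
  · have h1 := h.four_pow_mul_le (i := N + 1) (by omega)
    have h2 := h.one_le_slack_mul (i := N) (by omega)
    have h3 := h.slope_ge_one (i := N + 1) (by omega)
    have h4 : slope b s N ≤ slope b s 0 := h.slope_anti (by omega) (by omega)
    have p0 := h.slope_pos (i := 0) (by omega)
    have pN := h.slope_pos (i := N) (by omega)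
    have ps := h.slack_pos (i := N + 1) (by omega)
    have hb0 := hb 0 (by omega)
    have hs0 : slack a b W lam s 0 ≤ 3 * S ^ 2 := by
      have e1 := ha 0 (by omega)
      have e2 : lam 0 * slope b s 0 ≤ S * S := by
        rcases le_or_gt (lam 0) 0 with h | h
        · nlinarith
        · exact mul_le_mul hlam hb0 p0.le (by linarith)
      unfold slack
      nlinarith
    have hs0' := h.slack_pos (i := 0) (by omega)
    have h5 : (4 : ℝ) ^ (N + 1) ≤ slack a b W lam s 0 * slope b s 0 * slope b s 0 := by
      calc (4 : ℝ) ^ (N + 1) ≤ 4 ^ (N + 1) * (slack a b W lam s (N + 1) * slope b s N) :=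
            le_mul_of_one_le_right (by positivity) h2
        _ ≤ 4 ^ (N + 1) * (slack a b W lam s (N + 1) * slope b s 0) := by gcongr
        _ ≤ 4 ^ (N + 1) * ((slack a b W lam s (N + 1) * slope b s (N + 1)) * slope b s 0) := by
            gcongr
            exact le_mul_of_one_le_right ps.le h3
        _ = 4 ^ (N + 1) * (slack a b W lam s (N + 1) * slope b s (N + 1)) * slope b s 0 := by ring
        _ ≤ _ := by gcongr
    have h6 : slack a b W lam s 0 * slope b s 0 * slope b s 0 ≤ 3 * S ^ 2 * S * S := by
      gcongr
    rw [pow_succ]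
    nlinarith

/-- By `key`, a ratio of slopes above one half leaves at most one half for the ratio of slacks. -/
theorem half_slack {i : ℕ} (hi : i + 1 < N) (hs : slope b s i < 2 * slope b s (i + 1)) :
    2 * slack a b W lam s (i + 1) ≤ slack a b W lam s i := by
  have h1 := h.key hi
  have p1 := h.slack_pos (i := i) (by omega)
  have p2 := h.slope_pos (i := i) (by omega)
  by_contra! hcon
  nlinarith

/-- As long as the slope does not fall by a factor of two, the distances to the last iterate,
weighted by the slopes, halve every three steps. -/
theorem slope_half {n m x : ℕ} (hF : ∀ t, F t → t ⊆ Finset.range n)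
    (hm : (m + 1) ^ (n + 1) < 2 ^ m) (hx : x + 3 * m < N) :
    2 * slope b s (x + 3 * m) ≤ slope b s x := by
  by_contra! hcon
  set y := x + 3 * m with hy
  have hβ : ∀ i, x ≤ i → i ≤ y → slope b s x < 2 * slope b s i ∧ slope b s i ≤ slope b s x :=
    fun i h1 h2 => ⟨lt_of_lt_of_le hcon (by linarith [h.slope_anti h2 hx]),
      h.slope_anti h1 (by omega)⟩
  -- All slopes between `x` and `y` agree up to a factor of 2, so the slack halves in every single
  -- step.
  have hhalf : ∀ i, x ≤ i → i < y → 2 * slack a b W lam s (i + 1) ≤ slack a b W lam s i :=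
    fun i h1 h2 => h.half_slack (by omega) (lt_of_le_of_lt (hβ i h1 (by omega)).2
      (hβ (i + 1) (by omega) (by omega)).1)
  have p0 := h.slope_pos (i := x) (by omega)
  -- The step from `lam i` has length `slack i / slope i ≤ 2 * slack i / slope x`; the geometric
  -- series doubles the constant.
  have hdist : ∀ d i, x ≤ i → i + d = y →
      (lam i - lam y) * slope b s x ≤ 4 * slack a b W lam s i := by
    intro d
    induction d with
    | zero =>
      intro i h1 h2
      obtain rfl : i = y := by omega
      simpa using (h.slack_pos hx).le
    | succ d ih =>
      intro i h1 h2
      have e1 := ih (i + 1) (by omega) (by omega)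
      have e2 := hhalf i h1 (by omega)
      have e3 := h.slack_eq (i := i) (by omega)
      have e4 := hβ i h1 (by omega)
      have e5 := h.lam_lt (i := i) (by omega)
      nlinarith
  let f : ℕ → ℝ := fun i => (lam (i + 1) - lam y) * slope b s i
  -- The distance to `lam y` is at least the length of the next step, and slopes decrease.
  have hlow : ∀ i, x ≤ i → i + 2 ≤ y → slack a b W lam s (i + 1) ≤ f i := by
    intro i h1 h2
    have hle : ∀ d j, j + d = y → lam y ≤ lam j := by
      intro d
      induction d with
      | zero => intro j hj; obtain rfl : j = y := by omega
                exact le_rfl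
      | succ d ih => intro j hj; exact (ih (j + 1) (by omega)).trans (h.lam_lt (by omega)).le
    have e1 := hle (y - (i + 2)) (i + 2) (by omega)
    have e2 := h.slack_eq (i := i + 1) (by omega)
    have e3 := h.slope_anti (i := i) (j := i + 1) (by omega) (by omega)
    have e4 := h.slope_pos (i := i) (by omega)
    have e5 := h.lam_lt (i := i + 1) (by omega)
    simp only [f]
    nlinarith
  -- Three halvings of the slack turn the constant 4 of `hdist` into `1 / 2`. Together with `hlow`
  -- this gives `2 * f (i + 3) ≤ f i`.
  have hup : ∀ i, x ≤ i → i + 4 ≤ y → 2 * f (i + 3) ≤ slack a b W lam s (i + 1) := by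
    intro i h1 h2
    have e1 := hdist (y - (i + 4)) (i + 4) (by omega) (by omega)
    have e2 := (hβ (i + 3) (by omega) (by omega)).2
    have e3 := hhalf (i + 1) (by omega) (by omega)
    have e4 := hhalf (i + 2) (by omega) (by omega)
    have e5 := hhalf (i + 3) (by omega) (by omega)
    have e6 := h.slope_pos (i := i + 3) (by omega)
    have e7 := h.slack_pos (i := i + 4) (by omega)
    have e8 : f (i + 3) ≤ 4 * slack a b W lam s (i + 4) := by
      simp only [f]
      rcases le_or_gt 0 (lam (i + 4) - lam y) with h | h
      · exact (mul_le_mul_of_nonneg_left e2 h).trans e1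
      · exact (mul_nonpos_of_nonpos_of_nonneg h.le e6.le).trans (by linarith)
    linarith
  -- By definition of `lam (i + 1)`, `f i` is the amount by which the weight of `s i` at `lam y`
  -- exceeds `W`. The unused index `n` carries the summand `-W`, so it is a subset sum of `n + 1`
  -- fixed numbers.
  have hfsum : ∀ i, x ≤ i → i < y → f i =
      ∑ k ∈ insert n (s i), if k = n then (-W : ℝ) else (a k + lam y * b k) := by
    intro i h1 h2
    have hsub := hF _ (h.mem i (by omega))
    have hn : n ∉ s i := fun hn => by simpa using hsub hn
    rw [Finset.sum_insert hn, if_pos rfl, Finset.sum_congr rfl (g := fun k =>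
      (a k : ℝ) + lam y * b k) fun k hk => if_neg (ne_of_mem_of_not_mem hk hn),
      Finset.sum_add_distrib, ← Finset.mul_sum]
    have e1 := h.next i (by omega)
    simp only [f, slope]
    push_cast at e1 ⊢
    linarith
  have hcontr := two_pow_le_of_halving (Finset.range (n + 1))
    (fun k => if k = n then (-W : ℝ) else (a k + lam y * b k))
    (fun i => insert n (s (x + 3 * i))) m
    (fun i hi => by
      rw [Finset.range_add_one]
      exact Finset.insert_subset_insert _ (hF _ (h.mem _ (by omega))))
    (fun i hi => by
      rw [← hfsum _ (by omega) (by omega)]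
      exact lt_of_lt_of_le (h.slack_pos (by omega)) (hlow _ (by omega) (by omega)))
    (fun i hi => by
      rw [← hfsum _ (by omega) (by omega), ← hfsum _ (by omega) (by omega)]
      exact (hup (x + 3 * i) (by omega) (by omega)).trans (hlow _ (by omega) (by omega)))
  rw [Finset.card_range] at hcontr
  omega

/-- Newton's method is strongly polynomial. -/
theorem length_le {n m : ℕ} (hF : ∀ t, F t → t ⊆ Finset.range n)
    (hm : (m + 1) ^ (n + 1) < 2 ^ m) : N ≤ 3 * m * m := by
  by_contra! hcon
  have hlt : ∀ i < m, i * (3 * m) < N := fun i hi => by nlinarith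
  -- The slopes themselves are subset sums, and they halve after every `3 * m` iterations.
  have hcontr := two_pow_le_of_halving (Finset.range n) (fun k => -(b k : ℝ))
    (fun i => s (i * (3 * m))) m (fun i hi => hF _ (h.mem _ (hlt i hi)))
    (fun i hi => by
      have := h.slope_pos (hlt i hi)
      simpa [slope] using this)
    (fun i hi => by
      have h1 := h.slope_half (x := i * (3 * m)) hF hm (by have := hlt _ hi; linarith)
      have h2 : i * (3 * m) + 3 * m = (i + 1) * (3 * m) := by ring
      rw [h2] at h1
      simpa [slope] using h1)
  rw [Finset.card_range] at hcontr
  have : (m + 1) ^ n ≤ (m + 1) ^ (n + 1) := Nat.pow_le_pow_right (by omega) (by omega)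
  omega

end NewtonChain

/-- Provides an `m` of order `n * log n` for `length_le`. With `n + 1 < 2 ^ l` and `l < 2 ^ l` one
has `m + 1 < 2 ^ (4 * l)`, and `m = 4 * l * (n + 1)`. -/
theorem pow_lt_two_pow (n : ℕ) :
    (4 * (n + 1) * (Nat.log 2 (n + 1) + 1) + 1) ^ (n + 1) <
      2 ^ (4 * (n + 1) * (Nat.log 2 (n + 1) + 1)) := by
  set l := Nat.log 2 (n + 1) + 1 with hl
  have h1 : n + 1 < 2 ^ l := Nat.lt_pow_succ_log_self (by norm_num) _
  have h2 : l < 2 ^ l := Nat.lt_two_pow_self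
  have h3 : 4 * (n + 1) * l + 1 < 2 ^ (4 * l) := by
    have h4 : 2 ≤ 2 ^ l := by
      calc 2 = 2 ^ 1 := rfl
        _ ≤ 2 ^ l := Nat.pow_le_pow_right (by norm_num) (by omega)
    have h5 : 2 ^ (4 * l) = 2 ^ l * 2 ^ l * (2 ^ l * 2 ^ l) := by ring
    rw [h5]
    have h6 : 4 ≤ 2 ^ l * 2 ^ l := Nat.mul_le_mul h4 h4
    have h7 : (n + 1) * l + 1 ≤ 2 ^ l * 2 ^ l := by
      have : (n + 1) * l ≤ (n + 1) * 2 ^ l := Nat.mul_le_mul_left _ h2.le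
      nlinarith
    have h8 : 4 * ((n + 1) * l + 1) ≤ 2 ^ l * 2 ^ l * (2 ^ l * 2 ^ l) := Nat.mul_le_mul h6 h7
    nlinarith
  have h4 : 4 * (n + 1) * l = 4 * l * (n + 1) := by ring
  calc _ < (2 ^ (4 * l)) ^ (n + 1) := Nat.pow_lt_pow_left h3 (by omega)
    _ = _ := by rw [← pow_mul, h4]

end KnapsackDP

/-! ### Notation and simplification rules for expressions and states. -/

namespace RAMLang
variable {V : Type}

instance : Add (Ex V) := ⟨.add⟩
instance : Sub (Ex V) := ⟨.sub⟩
instance : Mul (Ex V) := ⟨.mul⟩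
instance : Div (Ex V) := ⟨.div⟩
instance (k : ℕ) : OfNat (Ex V) k := ⟨.lit k⟩
instance : Coe V (Ex V) := ⟨.var⟩

namespace Ex
variable (σ : St V) (x y : Ex V)
@[simp] theorem eval_lit (c : ℤ) : (lit c : Ex V).eval σ = c := rfl
@[simp] theorem eval_ofNat (k : ℕ) : (no_index (OfNat.ofNat k : Ex V)).eval σ = ((OfNat.ofNat k : ℕ) : ℤ) := rfl
@[simp] theorem eval_var (v : V) : (var v).eval σ = σ.reg v := rfl
@[simp] theorem eval_add : (x + y).eval σ = x.eval σ + y.eval σ := rfl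
@[simp] theorem eval_sub : (x - y).eval σ = x.eval σ - y.eval σ := rfl
@[simp] theorem eval_mul : (x * y).eval σ = x.eval σ * y.eval σ := rfl
@[simp] theorem eval_div : (x / y).eval σ = x.eval σ / y.eval σ := rfl
@[simp] theorem eval_get (r : Fin 4) : (get r x y).eval σ = σ.arr r (x.eval σ) (y.eval σ) := rfl
@[simp] theorem eval_raw : (raw x).eval σ = σ.raw (x.eval σ) := rfl
@[simp] theorem safe_lit (c : ℤ) : (lit c : Ex V).Safe σ := trivial
@[simp] theorem safe_ofNat (k : ℕ) : (no_index (OfNat.ofNat k : Ex V)).Safe σ := trivial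
@[simp] theorem safe_var (v : V) : (var v).Safe σ := trivial
@[simp] theorem safe_add : (x + y).Safe σ ↔ x.Safe σ ∧ y.Safe σ := Iff.rfl
@[simp] theorem safe_sub : (x - y).Safe σ ↔ x.Safe σ ∧ y.Safe σ := Iff.rfl
@[simp] theorem safe_mul : (x * y).Safe σ ↔ x.Safe σ ∧ y.Safe σ := Iff.rfl
@[simp] theorem safe_div : (x / y).Safe σ ↔ x.Safe σ ∧ y.Safe σ := Iff.rfl
@[simp] theorem safe_get (r : Fin 4) :
    (get r x y).Safe σ ↔ (x.Safe σ ∧ y.Safe σ) ∧ 0 ≤ x.eval σ ∧ 0 ≤ y.eval σ := Iff.rfl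
@[simp] theorem safe_raw : (raw x).Safe σ ↔ x.Safe σ ∧ 0 ≤ x.eval σ := Iff.rfl
@[simp] theorem size_lit (c : ℤ) : (lit c : Ex V).size = 1 := rfl
@[simp] theorem size_ofNat (k : ℕ) : (no_index (OfNat.ofNat k : Ex V)).size = 1 := rfl
@[simp] theorem size_var (v : V) : (var v).size = 2 := rfl
@[simp] theorem size_add : (x + y).size = x.size + y.size + 1 := rfl
@[simp] theorem size_sub : (x - y).size = x.size + y.size + 1 := rfl
@[simp] theorem size_mul : (x * y).size = x.size + y.size + 1 := rfl
@[simp] theorem size_div : (x / y).size = x.size + y.size + 1 := rfl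
@[simp] theorem size_get (r : Fin 4) : (get r x y).size = x.size + y.size + 8 := rfl
@[simp] theorem size_raw : (raw x).size = x.size + 1 := rfl
end Ex

namespace St
variable (σ : St V)
@[simp] theorem set_reg [DecidableEq V] (v w : V) (x : ℤ) : (σ.set v x).reg w = if w = v then x else σ.reg w := rfl
@[simp] theorem set_arr [DecidableEq V] (v : V) (x : ℤ) : (σ.set v x).arr = σ.arr := rfl
@[simp] theorem set_raw [DecidableEq V] (v : V) (x : ℤ) : (σ.set v x).raw = σ.raw := rfl
@[simp] theorem put_reg (r : Fin 4) (i j x : ℤ) : (σ.put r i j x).reg = σ.reg := rfl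
@[simp] theorem put_raw (r : Fin 4) (i j x : ℤ) : (σ.put r i j x).raw = σ.raw := rfl
@[simp] theorem put_arr (r r' : Fin 4) (i j i' j' x : ℤ) : (σ.put r i j x).arr r' i' j' =
    if r' = r ∧ i' = i ∧ j' = j then x else σ.arr r' i' j' := rfl
@[simp] theorem rput_reg (i x : ℤ) : (σ.rput i x).reg = σ.reg := rfl
@[simp] theorem rput_arr (i x : ℤ) : (σ.rput i x).arr = σ.arr := rfl
@[simp] theorem rput_raw (i i' x : ℤ) : (σ.rput i x).raw i' = if i' = i then x else σ.raw i' := rfl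
end St

/-- The registers of the program. -/
inductive Var
  | kk | b2 | n | W | E | S | Z | Q1 | inf | k | base | top | lev | T | r | two | sg | num | den
  | cont | i | j | q | w | t | x | y | A | bs | P | rest | F | m | cn | cd | dn | dd | z | fn | fd
  | kd | best | bp | pp | go
  deriving DecidableEq

/-! ### The approximation scheme as a structured program. -/

namespace Prog
open Var Cmd

/-- The scaled profit of an item. -/
def qEx (e : Ex Var) : Ex Var := .raw (4 + e) * n * E * E / T

/-- The weight of an item at the current parameter value, multiplied by a common factor and
perturbed such that ties are broken in favour of larger slopes. -/
def wEx (e : Ex Var) : Ex Var :=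
  S * (.raw (4 + n + e) * den + num * sg * .raw (4 + 2 * n + e)) - sg * .raw (4 + 2 * n + e)

/-- The cell update of the dynamic program. -/
def dpCell : Cmd Var :=
  .seq (.ite (q - j) (.set t 0) (.set t (j - q))) <|
  .seq (.set x (.get 0 i j)) <|
  .seq (.set y (.get 0 i t + w)) <|
  .ite (x - y) (.put 0 (i + 1) j y) (.put 0 (i + 1) j x)

/-- Fill a row of the table of the dynamic program. -/
def dpRow : Cmd Var :=
  .seq (.set q (qEx i)) <| .seq (.set w (wEx i)) <| .loop j Q1 dpCell

/-- Fill the table of the dynamic program. -/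
def dpFill : Cmd Var :=
  .seq (.loop j Q1 (.put 0 0 j inf)) <| .seq (.put 0 0 0 0) <| .loop i n dpRow

/-- One step of the backward pass through the table. -/
def traceStep : Cmd Var :=
  .seq (.set i (n - 1 - m)) <|
  .ite (.get 0 i rest - .get 0 (i + 1) rest)
    (.seq (.set A (A + .raw (4 + n + i))) <|
     .seq (.set bs (bs + sg * .raw (4 + 2 * n + i))) <|
     .seq (.set P (P + .raw (4 + i))) <|
     .seq (.put 3 i 0 1) <|
     .seq (.set q (qEx i)) <|
     .ite (q - rest) (.set rest 0) (.set rest (rest - q)))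
    (.put 3 i 0 0)

/-- Read the set that attains the optimum off the table. -/
def trace : Cmd Var :=
  .seq (.set A 0) <| .seq (.set bs 0) <| .seq (.set P 0) <| .seq (.set rest (Q1 - 1)) <|
  .loop m n traceStep

/-- Store the current set in a record. -/
def emit (slot kind : Ex Var) : Cmd Var :=
  .seq (.put 1 slot 0 (sg * num)) <| .seq (.put 1 slot 1 den) <| .seq (.put 1 slot 2 P) <|
  .seq (.put 1 slot 3 kind) <| .loop m n (.put 2 slot m (.get 3 m 0))

/-- An iteration of Newton's method. -/
def newtonStep : Cmd Var :=
  .seq dpFill <| .seq trace <|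
  .seq (.set F (W * den - (A * den + num * bs))) <|
  .ite rest (.set cont 0) <|
  .ite (0 - F) (.set cont 0) <|
  .ite bs (.seq (emit (Z + 1) (0 - sg)) (.set cont 0)) <|
  .ite (0 - bs)
    (.seq (.ite F .skip (.set cont 0)) <| .seq (.set num (A - W)) <| .seq (.set den (0 - bs)) <|
      emit Z sg)
    (.seq (emit Z sg) <| .seq (emit (Z + 1) (0 - sg)) <| .set cont 0)

/-- Newton's method for one profit level and one direction. -/
def newton : Cmd Var :=
  .seq (.set num S) <| .seq (.set den 1) <| .seq (.set cont 1) <|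
  .seq (.loopWhile cont newtonStep) <| .set Z (Z + 2)

/-- Both directions for one profit level. -/
def level : Cmd Var :=
  .seq (.set T (base * (E + lev))) <| .loop r two <| .seq (.set sg (1 - 2 * r)) newton

/-- All profit levels between the profit of item `k` and `n` times this profit. -/
def scales : Cmd Var :=
  .seq (.set base (.raw (4 + k))) <| .seq (.set top (n * base)) <|
  .loopWhile (top + 1 - base) (.seq (.loop lev E level) (.set base (base + base)))

/-- Read the input and compute the constants. -/
def init : Cmd Var :=
  .seq (.set n (.raw 0)) <| .seq (.set W (.raw 1)) <|
  .seq (.set E (2 * .raw 3 / .raw 2 + 1)) <| .seq (.set S (W + 1)) <|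
  .seq (.loop i n (.set S (S + .raw (4 + n + i) * .raw (4 + n + i) +
    .raw (4 + 2 * n + i) * .raw (4 + 2 * n + i)))) <|
  .seq (.set Q1 (n * (E - 1) + 1)) <| .seq (.set inf (16 * (S * S * S))) <| .set two 2

/-- Find the smallest parameter value of a record that is larger than `cn / cd`. -/
def nextValue : Cmd Var :=
  .seq (.set dn 1) <| .seq (.set dd 0) <| .loop z Z <|
  .seq (.set fn (.get 1 z 0)) <| .seq (.set fd (.get 1 z 1)) <|
  .ite (fn * cd - cn * fd) (.ite (dn * fd - fn * dd) (.seq (.set dn fn) (.set dd fd)) .skip) .skip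

/-- Compare record `z` with the best record so far. -/
def better : Cmd Var :=
  .ite (.get 1 z 2 - bp) (.seq (.set bp (.get 1 z 2)) (.set best z)) .skip

/-- Find the best record for the interval that ends in `dn / dd`. -/
def findBest : Cmd Var :=
  .seq (.set best Z) <| .seq (.set bp 0) <| .loop z Z <|
  .seq (.set fn (.get 1 z 0)) <| .seq (.set fd (.get 1 z 1)) <| .seq (.set kd (.get 1 z 3)) <|
  .ite kd (.ite (dn * fd - fn * dd) better .skip) <|
  .ite (0 - kd) (.ite (dn * fd - fn * dd) .skip better) .skip

/-- Output one interval and the breakpoint at its right end. -/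
def outputStep : Cmd Var :=
  .seq nextValue <| .seq findBest <|
  .seq (.ite kk (.ite (bp - pp) (.rput (3 * kk - 1) 0) (.rput (3 * kk - 1) 1)) .skip) <|
  .seq (.set pp bp) <|
  .seq (.loop m n (.rput (b2 + kk * n + m) (.get 2 best m))) <|
  .ite dd
    (.seq (.rput (3 * kk) dn) <| .seq (.rput (3 * kk + 1) dd) <| .seq (.set cn dn) <|
      .seq (.set cd dd) <| .set kk (kk + 1))
    (.set go 0)

/-- Output the parametric solution. -/
def output : Cmd Var :=
  .seq (.set cn (0 - 1)) <| .seq (.set cd 0) <| .seq (.set b2 (3 * (Z + 1))) <|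
  .seq (.set go 1) <| .loopWhile go outputStep

/-- The approximation scheme. -/
def main : Cmd Var := .seq (.seq init (.loop k n scales)) output

end Prog
end RAMLang

/-! ### Bounds for the numbers and correctness of the dynamic program. -/

open RAMLang KnapsackDP

/-- A parametric weight knapsack instance with items indexed by natural numbers. -/
structure Items where
  n : ℕ
  W : ℕ
  p : ℕ → ℕ
  a : ℕ → ℤ
  b : ℕ → ℤ

namespace Items

variable (D : Items)

/-- The numbers that the algorithm derives from its input: `E` is the number of profit levels
per scale, `S` bounds the parameter values, `u` bounds all numbers that the algorithm stores. -/
structure Params (E S u : ℕ) : Prop where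
  n_pos : 0 < D.n
  p_pos : ∀ i < D.n, 0 < D.p i
  E_ge : 3 ≤ E
  S_eq : (S : ℤ) = D.W + 1 + ∑ i ∈ Finset.range D.n, (D.a i * D.a i + D.b i * D.b i)
  u_ge : 40 * S ^ 3 ≤ u
  u_ge' : 40 * D.n ^ 2 * E ^ 2 * (∑ i ∈ Finset.range D.n, D.p i + 1) ≤ u

/-- The input and the constants are in their places. -/
structure Base (E S : ℕ) (σ : St Var) : Prop where
  reg_n : σ.reg .n = D.n
  reg_W : σ.reg .W = D.W
  reg_E : σ.reg .E = E
  reg_S : σ.reg .S = S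
  reg_Q1 : σ.reg .Q1 = ((D.n * (E - 1) + 1 : ℕ) : ℤ)
  reg_inf : σ.reg .inf = 16 * (S : ℤ) ^ 3
  reg_two : σ.reg .two = ((2 : ℕ) : ℤ)
  raw_p : ∀ i : ℕ, i < D.n → σ.raw (4 + i) = D.p i
  raw_a : ∀ i : ℕ, i < D.n → σ.raw (4 + D.n + i) = D.a i
  raw_b : ∀ i : ℕ, i < D.n → σ.raw (4 + 2 * D.n + i) = D.b i

/-- The scaled profits for the level `T`. -/
def scaled (E T : ℕ) (i : ℕ) : ℕ := D.p i * D.n * E * E / T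

/-- The perturbed weights at the parameter value `num / den` of the instance whose slopes are
multiplied by `sg`. -/
def weight (S : ℕ) (num den sg : ℤ) (i : ℕ) : ℤ :=
  S * (D.a i * den + num * sg * D.b i) - sg * D.b i

theorem Base.of_frame {D : Items} {E S : ℕ} {σ σ' : St Var} (h : D.Base E S σ) {c : Cmd Var}
    (hF : Frame c σ σ') (hr : ∀ v ∈ [Var.n, .W, .E, .S, .Q1, .inf, .two], c.writesReg v = false)
    (hm : c.writesRaw = false) : D.Base E S σ' := by
  have e := hF.raw hm
  simp only [List.mem_cons, List.not_mem_nil, or_false, forall_eq_or_imp, forall_eq] at hr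
  obtain ⟨h1, h2, h3, h4, h5, h6, h7⟩ := hr
  exact ⟨by rw [hF.reg _ h1, h.reg_n], by rw [hF.reg _ h2, h.reg_W], by rw [hF.reg _ h3, h.reg_E],
    by rw [hF.reg _ h4, h.reg_S], by rw [hF.reg _ h5, h.reg_Q1], by rw [hF.reg _ h6, h.reg_inf],
    by rw [hF.reg _ h7, h.reg_two], by rw [e]; exact h.raw_p, by rw [e]; exact h.raw_a, by rw [e]; exact h.raw_b⟩

namespace Params

variable {D} {E S u : ℕ} (hP : D.Params E S u)
include hP

/-- Squares are used in `S` because they need no case distinction on signs; for integers `|x| ≤ x *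
x`. -/
theorem sum_abs_le :
    D.W + 1 + ∑ i ∈ Finset.range D.n, |D.a i| + ∑ i ∈ Finset.range D.n, |D.b i| ≤ (S : ℤ) := by
  have key : ∀ x : ℤ, |x| ≤ x * x := fun x => by
    rw [← abs_mul_abs_self]
    rcases eq_or_ne x 0 with rfl | h
    · simp
    · nlinarith [Int.one_le_abs h]
  rw [hP.S_eq, Finset.sum_add_distrib]
  have h1 := Finset.sum_le_sum fun i (_ : i ∈ Finset.range D.n) => key (D.a i)
  have h2 := Finset.sum_le_sum fun i (_ : i ∈ Finset.range D.n) => key (D.b i)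
  linarith

theorem S_pos : 1 ≤ S := by
  have := hP.sum_abs_le
  have h1 : 0 ≤ ∑ i ∈ Finset.range D.n, |D.a i| := Finset.sum_nonneg fun _ _ => abs_nonneg _
  have h2 : 0 ≤ ∑ i ∈ Finset.range D.n, |D.b i| := Finset.sum_nonneg fun _ _ => abs_nonneg _
  omega

/-- Shows that the penalty `16 * S ^ 3` exceeds twice the total absolute weight, as `dpSet_spec`
requires. -/
theorem sum_abs_weight_le {num den sg : ℤ} (hden : 0 < den) (hden' : den ≤ S) (hnum : |num| ≤ S)
    (hsg : |sg| = 1) :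
    ∑ i ∈ Finset.range D.n, |D.weight S num den sg i| ≤ 2 * (S : ℤ) ^ 3 := by
  have hS := hP.S_pos
  have hS' : (1 : ℤ) ≤ S := by exact_mod_cast hS
  have key : ∀ i, |D.weight S num den sg i| ≤ 2 * (S : ℤ) ^ 2 * (|D.a i| + |D.b i|) := by
    intro i
    have ha := abs_nonneg (D.a i)
    have hb := abs_nonneg (D.b i)
    have e1 : |D.a i * den| ≤ |D.a i| * S := by
      rw [abs_mul, abs_of_pos hden]; gcongr
    have e2 : |num * sg * D.b i| ≤ |D.b i| * S := by
      rw [abs_mul, abs_mul, hsg, mul_one, mul_comm]; gcongr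
    have e3 : |sg * D.b i| = |D.b i| := by rw [abs_mul, hsg, one_mul]
    calc |D.weight S num den sg i|
        ≤ |(S : ℤ) * (D.a i * den + num * sg * D.b i)| + |sg * D.b i| := abs_sub _ _
      _ ≤ (S : ℤ) * (|D.a i * den| + |num * sg * D.b i|) + |D.b i| := by
          rw [abs_mul, e3, Nat.abs_cast]; gcongr; exact abs_add_le _ _
      _ ≤ (S : ℤ) * (|D.a i| * S + |D.b i| * S) + |D.b i| := by gcongr
      _ ≤ _ := by
        have : |D.b i| ≤ (S : ℤ) ^ 2 * |D.b i| := le_mul_of_one_le_left hb (one_le_pow₀ hS')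
        nlinarith [mul_nonneg (sq_nonneg (S : ℤ)) ha]
  have h1 := hP.sum_abs_le
  calc _ ≤ ∑ i ∈ Finset.range D.n, 2 * (S : ℤ) ^ 2 * (|D.a i| + |D.b i|) :=
        Finset.sum_le_sum fun i _ => key i
    _ = 2 * (S : ℤ) ^ 2 * (∑ i ∈ Finset.range D.n, |D.a i| + ∑ i ∈ Finset.range D.n, |D.b i|) := by
        rw [← Finset.mul_sum, Finset.sum_add_distrib]
    _ ≤ 2 * (S : ℤ) ^ 2 * S := by gcongr; omega
    _ = _ := by ring

theorem abs_dp_le {num den sg : ℤ} (hden : 0 < den) (hden' : den ≤ S) (hnum : |num| ≤ S)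
    (hsg : |sg| = 1) (T : ℕ) {i : ℕ} (hi : i ≤ D.n) (j : ℕ) :
    |dp (D.weight S num den sg) (D.scaled E T) (16 * (S : ℤ) ^ 3) i j| ≤ 20 * (S : ℤ) ^ 3 := by
  have h1 := KnapsackDP.abs_dp_le (D.weight S num den sg) (D.scaled E T) (16 * (S : ℤ) ^ 3) i j
    (by positivity)
  have h2 := hP.sum_abs_weight_le hden hden' hnum hsg
  have h3 : ∑ i ∈ Finset.range i, |D.weight S num den sg i| ≤
      ∑ i ∈ Finset.range D.n, |D.weight S num den sg i| :=
    Finset.sum_le_sum_of_subset_of_nonneg (Finset.range_subset_range.2 hi)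
      fun _ _ _ => abs_nonneg _
  have h4 : (0 : ℤ) ≤ (S : ℤ) ^ 3 := by positivity
  linarith

theorem abs_weight_le {num den sg : ℤ} (hden : 0 < den) (hden' : den ≤ S) (hnum : |num| ≤ S)
    (hsg : |sg| = 1) {i : ℕ} (hi : i < D.n) : |D.weight S num den sg i| ≤ 2 * (S : ℤ) ^ 3 :=
  (Finset.single_le_sum (f := fun i => |D.weight S num den sg i|) (fun _ _ => abs_nonneg _)
    (Finset.mem_range.2 hi)).trans (hP.sum_abs_weight_le hden hden' hnum hsg)

theorem S3_le : 40 * (S : ℤ) ^ 3 ≤ u := by exact_mod_cast hP.u_ge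

theorem S_le : 40 * (S : ℤ) ≤ u := by
  have h1 := hP.S3_le
  have hS : (1 : ℤ) ≤ S := by exact_mod_cast hP.S_pos
  have : (S : ℤ) ≤ S ^ 3 := le_self_pow₀ hS (by norm_num)
  linarith

theorem scaled_le {T i : ℕ} (hi : i < D.n) : D.scaled E T i ≤ u := by
  have h1 : D.p i ≤ ∑ i ∈ Finset.range D.n, D.p i :=
    Finset.single_le_sum (f := D.p) (fun _ _ => Nat.zero_le _) (Finset.mem_range.2 hi)
  have hn := hP.n_pos
  refine (Nat.div_le_self _ _).trans (le_trans ?_ hP.u_ge')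
  calc D.p i * D.n * E * E = D.n * E ^ 2 * D.p i := by ring
    _ ≤ (40 * D.n ^ 2) * E ^ 2 * (∑ i ∈ Finset.range D.n, D.p i + 1) := by
      gcongr
      · nlinarith
      · omega

theorem nE_le : 40 * D.n ^ 2 * E ^ 2 ≤ u :=
  (Nat.le_mul_of_pos_right _ (by omega)).trans hP.u_ge'

theorem n_le : D.n + 3 ≤ u := by
  have h1 := hP.nE_le
  have h2 := hP.n_pos
  have h3 := hP.E_ge
  have h4 : D.n ≤ D.n ^ 2 := Nat.le_self_pow (by norm_num) _
  have h5 : 1 ≤ E ^ 2 := Nat.one_le_pow _ _ (by omega)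
  nlinarith

theorem Q1_le : D.n * (E - 1) + 1 ≤ u := by
  have h1 := hP.nE_le
  have h2 := hP.n_pos
  have h3 := hP.E_ge
  have h4 : D.n ≤ D.n ^ 2 := Nat.le_self_pow (by norm_num) _
  have h5 : E ≤ E ^ 2 := Nat.le_self_pow (by norm_num) _
  have h6 : D.n * (E - 1) ≤ D.n ^ 2 * E ^ 2 := Nat.mul_le_mul h4 (by omega)
  have h7 : 1 ≤ D.n ^ 2 * E ^ 2 := Nat.one_le_iff_ne_zero.2 (by positivity)
  nlinarith

end Params

/-- The current parameter value and the current level. -/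
structure Point (S T : ℕ) (num den sg : ℤ) (σ : St Var) : Prop where
  reg_T : σ.reg .T = T
  reg_num : σ.reg .num = num
  reg_den : σ.reg .den = den
  reg_sg : σ.reg .sg = sg
  den_pos : 0 < den
  den_le : den ≤ S
  num_le : |num| ≤ S
  sg_abs : |sg| = 1

theorem Point.of_frame {S T : ℕ} {num den sg : ℤ} {σ σ' : St Var}
    (h : Point S T num den sg σ) {c : Cmd Var} (hF : Frame c σ σ')
    (hr : ∀ v ∈ [Var.T, .num, .den, .sg], c.writesReg v = false) : Point S T num den sg σ' := by
  simp only [List.mem_cons, List.not_mem_nil, or_false, forall_eq_or_imp, forall_eq] at hr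
  obtain ⟨h1, h2, h3, h4⟩ := hr
  exact ⟨by rw [hF.reg _ h1, h.reg_T], by rw [hF.reg _ h2, h.reg_num], by rw [hF.reg _ h3, h.reg_den],
    by rw [hF.reg _ h4, h.reg_sg], h.den_pos, h.den_le, h.num_le, h.sg_abs⟩

variable {D} {E S u T : ℕ} {num den sg : ℤ}

theorem eval_qEx {σ : St Var} (hB : D.Base E S σ) (hT : σ.reg .T = T) {e : Ex Var} {i : ℕ}
    (he : e.eval σ = i) (hi : i < D.n) : (Prog.qEx e).eval σ = D.scaled E T i := by
  simp [Prog.qEx, he, hB.raw_p i hi, hB.reg_n, hB.reg_E, hT, scaled]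

theorem eval_wEx {σ : St Var} (hB : D.Base E S σ) (h : Point S T num den sg σ) {e : Ex Var} {i : ℕ}
    (he : e.eval σ = i) (hi : i < D.n) : (Prog.wEx e).eval σ = D.weight S num den sg i := by
  simp [Prog.wEx, he, hB.raw_a i hi, hB.raw_b i hi, hB.reg_n, hB.reg_S, h.reg_num, h.reg_den, h.reg_sg, weight]

/-- The cell update computes the next cell of the dynamic program. -/
theorem dpCell_spec (hP : D.Params E S u) {σ : St Var} {i j : ℕ} (hi : i < D.n)
    (hj : j < D.n * (E - 1) + 1) (hσi : σ.reg .i = i) (hσj : σ.reg .j = j)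
    (hq : σ.reg .q = D.scaled E T i) (hw : σ.reg .w = D.weight S num den sg i)
    (hden : 0 < den) (hden' : den ≤ S) (hnum : |num| ≤ S) (hsg : |sg| = 1)
    (hV : ∀ j' : ℕ, j' < D.n * (E - 1) + 1 → σ.arr 0 i j' =
      dp (D.weight S num den sg) (D.scaled E T) (16 * (S : ℤ) ^ 3) i j') :
    Tr u Prog.dpCell 100 σ fun σ' => ∀ i' j' : ℤ, σ'.arr 0 i' j' = if i' = i + 1 ∧ j' = j then
      dp (D.weight S num den sg) (D.scaled E T) (16 * (S : ℤ) ^ 3) (i + 1) j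
      else σ.arr 0 i' j' := by
  have hu := hP.Q1_le
  have hS3 := hP.S3_le
  have hS0 : (0 : ℤ) ≤ (S : ℤ) ^ 3 := by positivity
  set v := dp (D.weight S num den sg) (D.scaled E T) (16 * (S : ℤ) ^ 3) with hv
  have hbd : ∀ i' j' : ℕ, i' ≤ D.n → -(20 * (S : ℤ) ^ 3) ≤ v i' j' ∧ v i' j' ≤ 20 * (S : ℤ) ^ 3 :=
    fun i' j' hi' => abs_le.1 (hP.abs_dp_le hden hden' hnum hsg T hi' j')
  have hwb := abs_le.1 (hP.abs_weight_le hden hden' hnum hsg hi)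
  have b1 := hbd i j hi.le
  have b2 := hbd i (j - D.scaled E T i) hi.le
  have hrec : v (i + 1) j = min (v i j) (v i (j - D.scaled E T i) + D.weight S num den sg i) := rfl
  have b3 := hbd (i + 1) j hi
  refine Tr.of_wp (Wp.seq (Wp.of_tr (T := 20)
    (R := fun σ₁ : St Var => σ₁.reg .t = ((j - D.scaled E T i : ℕ) : ℤ))
    (Tr.of_wp (Wp.ite ?_ (fun h => Wp.set ?_ ?_ ?_) (fun h => Wp.set ?_ ?_ ?_)))
    fun t ht' σ₁ hF ht => ?_))
  rotate_left 7
  · have h1 : σ₁.reg .i = i := by rw [hF.reg _ rfl, hσi]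
    have h2 : σ₁.reg .j = j := by rw [hF.reg _ rfl, hσj]
    have h3 : σ₁.reg .w = D.weight S num den sg i := by rw [hF.reg _ rfl, hw]
    have h4 := hF.arr 0 rfl
    have h5 := hV j hj
    have h6 := hV (j - D.scaled E T i) (by omega)
    refine Wp.seq (Wp.set ?_ ?_ <| Wp.seq <| Wp.set ?_ ?_ <|
      Wp.ite ?_ (fun h => Wp.put ?_ ?_ ?_ ?_ ?_) (fun h => Wp.put ?_ ?_ ?_ ?_ ?_))
    all_goals simp [St.set_reg, St.set_arr, St.put_arr, h1, h2, h3, h4, h5, h6, ht] at *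
    all_goals try omega
    · refine ⟨by omega, fun i' j' => ?_⟩
      rw [hrec, min_eq_right h.le]
    · refine ⟨by omega, fun i' j' => ?_⟩
      rw [hrec, min_eq_left h]
  all_goals simp [hσj, hq] at *
  all_goals omega

/-- The row update computes the next row of the dynamic program. -/
theorem dpRow_spec (hP : D.Params E S u) {σ : St Var} {i : ℕ} (hi : i < D.n)
    (hB : D.Base E S σ) (hσi : σ.reg .i = i) (hp : Point S T num den sg σ)
    (hV : ∀ j' : ℕ, j' < D.n * (E - 1) + 1 → σ.arr 0 i j' =
      dp (D.weight S num den sg) (D.scaled E T) (16 * (S : ℤ) ^ 3) i j') :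
    Tr u Prog.dpRow ((D.n * (E - 1) + 1) * 114 + 100) σ fun σ' =>
      (∀ j' : ℕ, j' < D.n * (E - 1) + 1 → σ'.arr 0 ((i + 1 : ℕ) : ℤ) j' =
        dp (D.weight S num den sg) (D.scaled E T) (16 * (S : ℤ) ^ 3) (i + 1) j') ∧
      ∀ i' : ℤ, i' ≤ i → σ'.arr 0 i' = σ.arr 0 i' := by
  have hu := hP.Q1_le
  have hS3 := hP.S3_le
  have hS0 : (0 : ℤ) ≤ (S : ℤ) ^ 3 := by positivity
  have hq := hP.scaled_le (T := T) hi
  have hwb := abs_le.1 (hP.abs_weight_le hp.den_pos hp.den_le hp.num_le hp.sg_abs hi)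
  refine Tr.of_wp (Wp.seq (Wp.set ?_ ?_ (Wp.seq (Wp.set ?_ ?_ ?_))))
  · simp [Prog.qEx, hσi]
    omega
  · rw [eval_qEx hB hp.reg_T (i := i) (by simpa using hσi) hi]; omega
  · simp [Prog.wEx, hB.reg_n, hσi]
    omega
  · have hB' := hB.of_frame (Frame.set σ .q ((Prog.qEx (.var .i)).eval σ)) (by decide) rfl
    have hp' := hp.of_frame (Frame.set σ .q ((Prog.qEx (.var .i)).eval σ)) (by decide)
    rw [eval_wEx hB' hp' (i := i) (by simpa using hσi) hi]
    constructor <;> linarith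
  · have hB' := hB.of_frame (Frame.set σ .q ((Prog.qEx (.var .i)).eval σ)) (by decide) rfl
    have hp' := hp.of_frame (Frame.set σ .q ((Prog.qEx (.var .i)).eval σ)) (by decide)
    rw [eval_wEx hB' hp' (i := i) (by simpa using hσi) hi,
      eval_qEx hB hp.reg_T (i := i) (by simpa using hσi) hi]
    refine Wp.of_tr (Tr.loop (N := D.n * (E - 1) + 1) (T := 100) (fun k σ₁ =>
      (∀ j' : ℕ, j' < k → σ₁.arr 0 ((i + 1 : ℕ) : ℤ) j' =
        dp (D.weight S num den sg) (D.scaled E T) (16 * (S : ℤ) ^ 3) (i + 1) j') ∧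
      ∀ i' : ℤ, i' ≤ i → σ₁.arr 0 i' = σ.arr 0 i') (by decide) rfl rfl
      (by simp [hB.reg_Q1]) hu (by simp) ?_ (fun σ₁ h _ => h)) ?_
    · rintro k hk σ₁ ⟨h1, h2⟩ hkv hF
      refine Tr.mono (dpCell_spec hP hi hk (num := num) (den := den) (sg := sg) (T := T) ?_ hkv ?_ ?_ hp.den_pos
        hp.den_le hp.num_le hp.sg_abs ?_) le_rfl ?_
      · rw [hF.reg _ rfl]; simpa using hσi
      · rw [hF.reg _ rfl]; simp
      · rw [hF.reg _ rfl]; simp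
      · intro j' hj'
        rw [h2 i le_rfl, hV j' hj']
      · intro σ₂ hF₂ h₂
        refine ⟨fun j' hj' => ?_, fun i' hi' => ?_⟩
        · rw [St.set_arr, h₂]
          rcases Nat.lt_succ_iff_lt_or_eq.1 hj' with h | rfl
          · rw [if_neg (by omega), h1 j' h]
          · simp
        · funext j'
          rw [St.set_arr, h₂, if_neg (by omega), h2 i' hi']
    · rintro t ht σ' - ⟨h1, h2⟩
      refine ⟨?_, h1, h2⟩
      simp [Prog.qEx, Prog.wEx]
      omega

/-- The table of the dynamic program is filled correctly. -/
theorem dpFill_spec (hP : D.Params E S u) {σ : St Var}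
    (hB : D.Base E S σ) (hp : Point S T num den sg σ) :
    Tr u Prog.dpFill (D.n * ((D.n * (E - 1) + 1) * 114 + 114) + (D.n * (E - 1) + 1) * 40 + 50) σ
      fun σ' => ∀ i : ℕ, i ≤ D.n → ∀ j : ℕ, j < D.n * (E - 1) + 1 → σ'.arr 0 i j =
        dp (D.weight S num den sg) (D.scaled E T) (16 * (S : ℤ) ^ 3) i j := by
  have hu := hP.Q1_le
  have hn := hP.n_le
  have hS3 := hP.S3_le
  have hS0 : (0 : ℤ) ≤ (S : ℤ) ^ 3 := by positivity
  refine Tr.of_wp (Wp.seq (Wp.of_tr (Tr.loop (N := D.n * (E - 1) + 1) (T := 13) (fun k σ₁ =>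
      ∀ j' : ℕ, j' < k → σ₁.arr 0 0 j' = 16 * (S : ℤ) ^ 3) (by decide) rfl rfl hB.reg_Q1 hu
      (by simp) ?_ (fun σ₁ h _ => h)) fun t ht σ₁ hF₁ h₁ => ?_))
  · intro k hk σ₁ h1 hkv hF
    have hinf : σ₁.reg .inf = 16 * (S : ℤ) ^ 3 := by rw [hF.reg _ rfl, hB.reg_inf]
    refine Tr.of_wp (Wp.put ?_ ?_ ?_ ?_ ?_)
    all_goals simp [hkv, hinf]
    · constructor <;> linarith
    · intro j' hj' hne
      exact h1 j' (by omega)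
  · refine Wp.seq (Wp.put (by simp) (by simp) (by simp) (by simp) ?_)
    refine Wp.of_tr (Tr.loop (N := D.n) (T := (D.n * (E - 1) + 1) * 114 + 100) (fun k σ₂ =>
      ∀ i' : ℕ, i' ≤ k → ∀ j' : ℕ, j' < D.n * (E - 1) + 1 → σ₂.arr 0 i' j' =
        dp (D.weight S num den sg) (D.scaled E T) (16 * (S : ℤ) ^ 3) i' j') (by decide) rfl rfl
      ?_ (by omega) ?_ ?_ (fun σ₁ h _ => h)) ?_
    · rw [St.put_reg, hF₁.reg _ rfl, hB.reg_n]
    · intro i' hi' j' hj'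
      obtain rfl : i' = 0 := by omega
      by_cases h : j' = 0
      · simp [h, dp]
      · simp [h, dp, h₁ j' hj']
    · intro k hk σ₂ h2 hkv hF₂
      have hB₁ : D.Base E S (σ₁.put 0 0 0 0) := (hB.of_frame hF₁ (by decide) rfl).of_frame
        (Frame.put _ _ _ _ _) (by decide) rfl
      have hp₁ : Point S T num den sg (σ₁.put 0 0 0 0) := (hp.of_frame hF₁ (by decide)).of_frame
        (Frame.put _ _ _ _ _) (by decide)
      refine (dpRow_spec hP hk (hB₁.of_frame hF₂ (by decide) rfl) hkv
        (hp₁.of_frame hF₂ (by decide)) (h2 k le_rfl)).mono le_rfl ?_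
      rintro σ₃ - ⟨h3, h4⟩ i' hi' j' hj'
      rw [St.set_arr]
      rcases Nat.le_succ_iff.1 hi' with h | rfl
      · rw [h4 i' (by omega), h2 i' h j' hj']
      · exact h3 j' hj'
    · intro t' ht' σ' _ h
      refine ⟨?_, h⟩
      have e1 : (D.n * (E - 1) + 1) * 114 + 100 + 14 = (D.n * (E - 1) + 1) * 114 + 114 := by ring
      rw [e1] at ht'
      simp only [Ex.size_ofNat]
      omega

end Items

/-! ### The backward pass through the table. -/

namespace Items
variable {D : Items} {E S u T : ℕ} {num den sg : ℤ}

theorem abs_sum_le_of_subset {n : ℕ} (f : ℕ → ℤ) {s : Finset ℕ} (hs : s ⊆ Finset.range n) :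
    |∑ k ∈ s, f k| ≤ ∑ k ∈ Finset.range n, |f k| :=
  (Finset.abs_sum_le_sum_abs _ _).trans
    (Finset.sum_le_sum_of_subset_of_nonneg hs fun _ _ _ => abs_nonneg _)

namespace Params
variable (hP : D.Params E S u)
include hP

/-- The summand `W + 1` of `S` makes `S` a valid start for Newton's method: sets of negative slope
fit at `S`, and sets of positive slope do not. -/
theorem abs_sum_a_le {s : Finset ℕ} (hs : s ⊆ Finset.range D.n) :
    |∑ k ∈ s, D.a k| + D.W + 1 ≤ (S : ℤ) := by
  have h1 := abs_sum_le_of_subset D.a hs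
  have h2 := hP.sum_abs_le
  have h3 : 0 ≤ ∑ i ∈ Finset.range D.n, |D.b i| := Finset.sum_nonneg fun _ _ => abs_nonneg _
  linarith

theorem abs_sum_b_le {s : Finset ℕ} (hs : s ⊆ Finset.range D.n) :
    |∑ k ∈ s, D.b k| + 1 ≤ (S : ℤ) := by
  have h1 := abs_sum_le_of_subset D.b hs
  have h2 := hP.sum_abs_le
  have h3 : 0 ≤ ∑ i ∈ Finset.range D.n, |D.a i| := Finset.sum_nonneg fun _ _ => abs_nonneg _
  linarith

theorem W_le : (D.W : ℤ) + 1 ≤ S := by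
  have := hP.abs_sum_a_le (Finset.empty_subset _)
  simpa using this

theorem sum_p_le {s : Finset ℕ} (hs : s ⊆ Finset.range D.n) : ∑ k ∈ s, D.p k ≤ u := by
  have h1 : ∑ k ∈ s, D.p k ≤ ∑ k ∈ Finset.range D.n, D.p k :=
    Finset.sum_le_sum_of_subset_of_nonneg hs fun _ _ _ => Nat.zero_le _
  have hn := hP.n_pos
  have hE := hP.E_ge
  refine le_trans ?_ hP.u_ge'
  calc ∑ k ∈ s, D.p k ≤ 1 * (∑ k ∈ Finset.range D.n, D.p k + 1) := by omega
    _ ≤ _ := by gcongr; exact Nat.one_le_iff_ne_zero.2 (by positivity)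

end Params

/-- The state after the backward pass holds the set `s`. -/
structure Traced (D : Items) (sg : ℤ) (s : Finset ℕ) (rest : ℕ) (σ : St Var) : Prop where
  A : σ.reg .A = ∑ k ∈ s, D.a k
  bs : σ.reg .bs = sg * ∑ k ∈ s, D.b k
  P : σ.reg .P = ((∑ k ∈ s, D.p k : ℕ) : ℤ)
  rest : σ.reg .rest = rest
  bits : ∀ i : ℕ, i < D.n → σ.arr 3 i 0 = if i ∈ s then 1 else 0

/-- Loop invariant: after `k` steps the items from `n - k` on are decided, and `dpSet` of row `n -
k` at the current `rest` is the part of the set that is still to be read off. The pass starts at the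
target `n * (E - 1)`. -/
theorem trace_spec (hP : D.Params E S u) {σ : St Var}
    (hB : D.Base E S σ) (hp : Point S T num den sg σ)
    (hV : ∀ i : ℕ, i ≤ D.n → ∀ j : ℕ, j < D.n * (E - 1) + 1 → σ.arr 0 i j =
        dp (D.weight S num den sg) (D.scaled E T) (16 * (S : ℤ) ^ 3) i j) :
    Tr u Prog.trace (D.n * 164 + 60) σ (Traced D sg
      (dpSet (D.weight S num den sg) (D.scaled E T) (16 * (S : ℤ) ^ 3) D.n (D.n * (E - 1)))
      (dpRest (D.weight S num den sg) (D.scaled E T) (16 * (S : ℤ) ^ 3) D.n (D.n * (E - 1)))) := by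
  have hu := hP.Q1_le
  have hn := hP.n_le
  have hS := hP.S_le
  set w := D.weight S num den sg
  set q := D.scaled E T
  set s := dpSet w q (16 * (S : ℤ) ^ 3) D.n (D.n * (E - 1)) with hs
  have hsub : s ⊆ Finset.range D.n := dpSet_subset _ _ _ _ _
  have hsg := hp.sg_abs
  have hbnd : ∀ s' ⊆ Finset.range D.n, (|∑ k ∈ s', D.a k| ≤ S ∧ |sg * ∑ k ∈ s', D.b k| ≤ S ∧
      ∑ k ∈ s', D.p k ≤ u) := fun s' hs' => by
    have h1 := hP.abs_sum_a_le hs'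
    have h2 := hP.abs_sum_b_le hs'
    refine ⟨by omega, by rw [abs_mul, hsg]; omega, hP.sum_p_le hs'⟩
  have hbs := hbnd s hsub
  refine Tr.of_wp (Wp.seq (Wp.set (by simp) (by simp) <| Wp.seq <| Wp.set (by simp) (by simp) <|
    Wp.seq <| Wp.set (by simp) (by simp) <| Wp.seq <| Wp.set (by simp) ?_ ?_))
  · simp [hB.reg_Q1]; omega
  refine Wp.of_tr (Tr.loop (N := D.n) (T := 150) (fun k σ₁ => k ≤ D.n ∧ ∃ j : ℕ, j ≤ D.n * (E - 1) ∧
    σ₁.reg .rest = j ∧ dpRest w q (16 * (S : ℤ) ^ 3) (D.n - k) j =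
      dpRest w q (16 * (S : ℤ) ^ 3) D.n (D.n * (E - 1)) ∧
    σ₁.reg .A + ∑ l ∈ dpSet w q (16 * (S : ℤ) ^ 3) (D.n - k) j, D.a l = ∑ l ∈ s, D.a l ∧
    σ₁.reg .bs + sg * ∑ l ∈ dpSet w q (16 * (S : ℤ) ^ 3) (D.n - k) j, D.b l =
      sg * ∑ l ∈ s, D.b l ∧
    σ₁.reg .P + ((∑ l ∈ dpSet w q (16 * (S : ℤ) ^ 3) (D.n - k) j, D.p l : ℕ) : ℤ) =
      ((∑ l ∈ s, D.p l : ℕ) : ℤ) ∧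
    (∀ i : ℕ, i < D.n → D.n - k ≤ i → σ₁.arr 3 i 0 = if i ∈ s then 1 else 0) ∧
    ∀ i < D.n - k, i ∈ s ↔ i ∈ dpSet w q (16 * (S : ℤ) ^ 3) (D.n - k) j)
    (by decide) rfl rfl (by simp [hB.reg_n]) (by omega) ?_ ?_ (fun σ₁ h _ => h)) ?_
  · refine ⟨Nat.zero_le _, D.n * (E - 1), le_rfl, by simp [hB.reg_Q1], by simp, by simp [hs],
      by simp [hs], by simp [hs], fun i h1 h2 => by omega, fun i hi => by simp [hs]⟩
  · rintro k hk σ₁ ⟨-, j, hj, hr, hrest, hA, hb, hp', hbits, hmem⟩ hkv hF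
    obtain ⟨i, hi⟩ : ∃ i, D.n - k = i + 1 := ⟨D.n - k - 1, by omega⟩
    have hi' : D.n - (k + 1) = i := by omega
    have hin : i < D.n := by omega
    rw [hi] at hrest hA hb hp' hbits hmem
    have hF' : D.Base E S σ₁ := (((((hB.of_frame (Frame.set _ _ _) (by decide) rfl).of_frame
      (Frame.set _ _ _) (by decide) rfl).of_frame (Frame.set _ _ _) (by decide) rfl).of_frame
      (Frame.set _ _ _) (by decide) rfl)).of_frame hF (by decide) rfl
    have hT : σ₁.reg .T = T := by rw [hF.reg _ rfl]; simp [hp.reg_T]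
    have hsg' : σ₁.reg .sg = sg := by rw [hF.reg _ rfl]; simp [hp.reg_sg]
    have harr : σ₁.arr 0 = σ.arr 0 := hF.arr 0 rfl
    have hv1 := hV i hin.le j (by omega)
    have hv2 := hV (i + 1) hin j (by omega)
    push_cast at hv2
    have hiv : (D.n : ℤ) - 1 - k = i := by omega
    have hqv : (D.p i : ℤ) * D.n * E * E / T = q i := by simp [q, scaled]
    have hqu : q i ≤ u := hP.scaled_le hin
    have hb1 := hbnd _ ((dpSet_subset w q (16 * (S : ℤ) ^ 3) i j).trans
      (Finset.range_subset_range.2 hin.le))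
    have hb2 := hbnd _ ((dpSet_subset w q (16 * (S : ℤ) ^ 3) i (j - q i)).trans
      (Finset.range_subset_range.2 hin.le))
    simp only [abs_le] at hbs hb1 hb2
    simp only [dpSet, dpRest] at hrest hA hb hp' hmem
    rw [hi']
    refine Tr.of_wp (Wp.seq (Wp.set (by simp) ?_ ?_))
    · simp [hF'.reg_n, hkv]; omega
    refine Wp.ite ?_ (fun h => ?_) (fun h => ?_)
    · simp [hF'.reg_n, hkv, hr]; omega
    · simp [hF'.reg_n, hkv, hr, hiv, harr, hv1, hv2] at h
      rw [if_pos h] at hrest hA hb hp' hmem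
      rw [Finset.sum_insert (notMem_dpSet w q _ i _)] at hA hb hp'
      have ra := hF'.raw_a i hin
      have rb := hF'.raw_b i hin
      have rp := hF'.raw_p i hin
      push_cast at hp'
      have hbu : -(u : ℤ) ≤ σ₁.reg .bs + sg * D.b i ∧ σ₁.reg .bs + sg * D.b i ≤ u := by
        rw [mul_add] at hb
        constructor <;> linarith [hbs.2.1.1, hbs.2.1.2, hb2.2.1.1, hb2.2.1.2]
      have hPu : -(u : ℤ) ≤ σ₁.reg .P + D.p i ∧ σ₁.reg .P + D.p i ≤ u := by
        have h1 := hbs.2.2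
        have h2 := hb2.2.2
        zify at h1 h2
        have h3 : (0 : ℤ) ≤ ∑ l ∈ s, (D.p l : ℤ) := Finset.sum_nonneg fun _ _ => by positivity
        have h4 : (0 : ℤ) ≤ ∑ l ∈ dpSet w q (16 * (S : ℤ) ^ 3) i (j - q i), (D.p l : ℤ) :=
          Finset.sum_nonneg fun _ _ => by positivity
        constructor <;> linarith
      have his : i ∈ s := (hmem i (by omega)).2 (Finset.mem_insert_self _ _)
      have hni := notMem_dpSet w q (16 * (S : ℤ) ^ 3) i (j - q i)
      -- Both branches of the truncated subtraction of `q i` from `rest` end in a state of this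
      -- form.
      have fin : ∀ t : ℕ, ∀ σ' : St Var, t ≤ 150 → σ'.reg .rest = ((j - q i : ℕ) : ℤ) →
          σ'.reg .A = σ₁.reg .A + D.a i → σ'.reg .bs = σ₁.reg .bs + sg * D.b i →
          σ'.reg .P = σ₁.reg .P + D.p i →
          (∀ l : ℕ, σ'.arr 3 l 0 = if l = i then 1 else σ₁.arr 3 l 0) → t ≤ 150 ∧
          (k + 1 ≤ D.n ∧ ∃ j : ℕ, j ≤ D.n * (E - 1) ∧
          (σ'.set .m ((k + 1 : ℕ) : ℤ)).reg .rest = j ∧ dpRest w q (16 * (S : ℤ) ^ 3) i j =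
            dpRest w q (16 * (S : ℤ) ^ 3) D.n (D.n * (E - 1)) ∧
          (σ'.set .m ((k + 1 : ℕ) : ℤ)).reg .A + ∑ l ∈ dpSet w q (16 * (S : ℤ) ^ 3) i j, D.a l =
            ∑ l ∈ s, D.a l ∧
          (σ'.set .m ((k + 1 : ℕ) : ℤ)).reg .bs +
            sg * ∑ l ∈ dpSet w q (16 * (S : ℤ) ^ 3) i j, D.b l = sg * ∑ l ∈ s, D.b l ∧
          (σ'.set .m ((k + 1 : ℕ) : ℤ)).reg .P +
            ((∑ l ∈ dpSet w q (16 * (S : ℤ) ^ 3) i j, D.p l : ℕ) : ℤ) =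
            ((∑ l ∈ s, D.p l : ℕ) : ℤ) ∧
          (∀ l : ℕ, l < D.n → i ≤ l →
            (σ'.set .m ((k + 1 : ℕ) : ℤ)).arr 3 l 0 = if l ∈ s then 1 else 0) ∧
          ∀ l < i, l ∈ s ↔ l ∈ dpSet w q (16 * (S : ℤ) ^ 3) i j) := by
        intro t σ' ht e1 e2 e3 e4 e5
        refine ⟨ht, hk, j - q i, by omega, by simpa using e1, hrest, ?_, ?_, ?_, ?_, ?_⟩
        · simp [e2]; linarith
        · simp [e3]; linarith
        · simp [e4]; linarith
        · intro l hl hil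
          rw [St.set_arr, e5]
          split_ifs with h1 h2 h2
          · rfl
          · exact absurd (h1 ▸ his) h2
          · rw [hbits l hl (by omega), if_pos h2]
          · rw [hbits l hl (by omega), if_neg h2]
        · intro l hl
          rw [hmem l (by omega), Finset.mem_insert]
          exact or_iff_right (by omega)
      refine Wp.seq (Wp.set ?_ ?_ <| Wp.seq <| Wp.set ?_ ?_ <| Wp.seq <| Wp.set ?_ ?_ <|
        Wp.seq <| Wp.put ?_ ?_ ?_ ?_ <| Wp.seq <| Wp.set ?_ ?_ <| Wp.ite ?_
        (fun h' => Wp.set ?_ ?_ (fin _ _ ?_ ?_ ?_ ?_ ?_ ?_))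
        (fun h' => Wp.set ?_ ?_ (fin _ _ ?_ ?_ ?_ ?_ ?_ ?_)))
      all_goals try simp [hF'.reg_n, hkv, hr, hiv, rp, Prog.qEx, hT, hF'.reg_E, hqv] at h'
      all_goals simp [hF'.reg_n, hkv, hr, hiv, ra, rb, rp, Prog.qEx, hT, hF'.reg_E, hqv, hsg']
      all_goals first | exact hbu | exact hPu | omega
    · simp [hF'.reg_n, hkv, hr, hiv, harr, hv1, hv2] at h
      rw [if_neg (by omega)] at hrest hA hb hp' hmem
      have his : i ∉ s := fun h => notMem_dpSet _ _ _ i j ((hmem i (by omega)).1 h)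
      refine Wp.put ?_ ?_ ?_ ?_ ⟨?_, hk, j, hj, ?_, hrest, ?_, ?_, ?_, ?_, ?_⟩
      all_goals try simp [hF'.reg_n, hkv, hiv]
      · exact hr
      · exact hA
      · exact hb
      · exact_mod_cast hp'
      · intro l hl hil
        split_ifs with h1 h2 h2
        · exact absurd (h1 ▸ h2) his
        · rfl
        · rw [hbits l hl (by omega), if_pos h2]
        · rw [hbits l hl (by omega), if_neg h2]
      · intro l hl
        exact hmem l (by omega)
  · rintro t ht σ' - ⟨-, j, hj, hr, hrest, hA, hb, hp', hbits, -⟩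
    simp only [Nat.sub_self, dpSet, dpRest, Finset.sum_empty] at hrest hA hb hp' hbits
    refine ⟨?_, by simpa using hA, by simpa using hb, by simpa using hp', by rw [hr, hrest],
      fun i hi => hbits i hi (Nat.zero_le _)⟩
    simp
    omega

end Items

/-- Variant of `Wp.put` that replaces the evaluated expressions by given values, which keeps the
next state readable. -/
theorem RAMLang.Wp.put_eq {V : Type} [DecidableEq V] {u : ℕ} {σ : St V} {Q : ℕ → St V → Prop}
    {r : Fin 4} {i j e : Ex V} {I J X : ℤ} (he : e.Safe σ ∧ e.eval σ = X)
    (hi : i.Safe σ ∧ i.eval σ = I) (hI : 0 ≤ I) (hj : j.Safe σ ∧ j.eval σ = J) (hJ : 0 ≤ J)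
    (hu : -(u : ℤ) ≤ X ∧ X ≤ u)
    (hQ : Q (e.size + i.size + j.size + 8) (σ.put r I J X)) : Wp u (.put r i j e) σ Q := by
  obtain ⟨he, rfl⟩ := he
  obtain ⟨hi, rfl⟩ := hi
  obtain ⟨hj, rfl⟩ := hj
  exact Wp.put he ⟨hi, hI⟩ ⟨hj, hJ⟩ hu hQ

/-! ### Records: item sets together with a half-line on which they fit. -/

namespace Items
variable {D : Items} {E S u T : ℕ} {num den sg : ℤ}

/-- The expressions `slot` and `kind` are evaluated in several states, so their values are required
in every state with the same `Z` and `sg` respectively. The size bounds are for the running time. -/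
theorem emit_spec (hn : D.n ≤ u) {σ : St Var} {slot kind : Ex Var} {z : ℕ} {kd P : ℤ} {s : Finset ℕ}
    (hslot : ∀ σ' : St Var, σ'.reg .Z = σ.reg .Z → slot.eval σ' = z ∧ slot.Safe σ')
    (hkind : ∀ σ' : St Var, σ'.reg .sg = σ.reg .sg → kind.eval σ' = kd ∧ kind.Safe σ')
    (hss : slot.size ≤ 4) (hks : kind.size ≤ 4) (hkd : |kd| ≤ u)
    (hreg : σ.reg .n = D.n) (hnum : |σ.reg .sg * σ.reg .num| ≤ u) (hden : |σ.reg .den| ≤ u)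
    (hP : σ.reg .P = P) (hPu : |P| ≤ u)
    (hbits : ∀ i : ℕ, i < D.n → σ.arr 3 i 0 = if i ∈ s then 1 else 0) :
    Tr u (Prog.emit slot kind) (D.n * 50 + 120) σ fun σ' =>
      σ'.arr 1 z 0 = σ.reg .sg * σ.reg .num ∧ σ'.arr 1 z 1 = σ.reg .den ∧ σ'.arr 1 z 2 = P ∧
      σ'.arr 1 z 3 = kd ∧ (∀ i : ℕ, i < D.n → σ'.arr 2 z i = if i ∈ s then 1 else 0) ∧
      ∀ z' : ℤ, z' ≠ z → σ'.arr 1 z' = σ.arr 1 z' ∧ σ'.arr 2 z' = σ.arr 2 z' := by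
  simp only [abs_le] at hnum hden hPu hkd
  have hz : (0 : ℤ) ≤ z := by positivity
  have hs0 : ∀ σ' : St Var, σ'.reg .Z = σ.reg .Z → slot.Safe σ' ∧ slot.eval σ' = z := fun σ' h =>
    ⟨(hslot σ' h).2, (hslot σ' h).1⟩
  have hkind' : ∀ σ' : St Var, σ'.reg .sg = σ.reg .sg → kind.Safe σ' ∧ kind.eval σ' = kd :=
    fun σ' h => (hkind σ' h).symm
  refine Tr.of_wp (Wp.seq (Wp.put_eq ⟨by simp, rfl⟩ (hs0 _ rfl) hz (j := 0) (J := 0) (by simp) le_rfl hnum <|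
    Wp.seq <| Wp.put_eq ⟨by simp, rfl⟩ (hs0 _ rfl) hz (j := 1) (J := 1) (by simp) (by simp) hden <|
    Wp.seq <| Wp.put_eq (X := P) (by simp [hP]) (hs0 _ rfl) hz (j := 2) (J := 2) (by simp) (by simp) hPu <|
    Wp.seq <| Wp.put_eq (hkind' _ rfl) (hs0 _ rfl) hz (j := 3) (J := 3) (by simp) (by simp) hkd <|
    Wp.of_tr (Tr.loop (N := D.n) (T := 30) (fun k σ₁ =>
      (∀ i : ℕ, i < k → σ₁.arr 2 z i = if i ∈ s then 1 else 0) ∧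
      ∀ z' : ℤ, z' ≠ z → σ₁.arr 2 z' = σ.arr 2 z') (by decide) rfl rfl hreg hn ?_ ?_
      (fun σ₁ h _ => h)) fun t ht σ' hF h => ?_))
  · exact ⟨fun i hi => absurd hi (Nat.not_lt_zero _), fun z' _ => by funext i; simp⟩
  · rintro k hk σ₁ ⟨h1, h2⟩ hkv hF
    have e3 : σ₁.arr 3 k 0 = if k ∈ s then 1 else 0 := by
      rw [hF.arr 3 rfl]; simp [hbits k hk]
    have hZ : σ₁.reg .Z = σ.reg .Z := hF.reg _ rfl
    refine Tr.of_wp (Wp.put_eq (X := if k ∈ s then 1 else 0) (J := k) ?_ (hs0 _ hZ) hz ?_ ?_ ?_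
      ⟨?_, ?_, ?_⟩)
    · simp [hkv, e3]
    · simp [hkv]
    · simp
    · split_ifs <;> omega
    · simp; omega
    · intro i hi
      rcases Nat.lt_succ_iff_lt_or_eq.1 hi with h | rfl
      · simp [h.ne, h1 i h]
      · simp
    · intro z' hz'
      funext i
      simp [hz', h2 z' hz']
  · have e1 := hF.arr 1 rfl
    refine ⟨?_, ?_, ?_, ?_, ?_, h.1, fun z' hz' => ⟨?_, h.2 z' hz'⟩⟩
    · simp; omega
    all_goals rw [e1]
    · simp
    · simp
    · simp
    · simp
    · funext i
      simp [hz']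

variable (D) in
/-- The items in `s` fit into the knapsack at the parameter value `lam`. -/
def Feas (lam : ℝ) (s : Finset ℕ) : Prop :=
  ((∑ k ∈ s, D.a k : ℤ) : ℝ) + lam * ((∑ k ∈ s, D.b k : ℤ) : ℝ) ≤ D.W

variable (D) in
/-- Slot `z` holds a record for the item set `s`, with the parameter value `num / den` where `s`
starts (`kd = 1`) or ceases (`kd = -1`) to be feasible. -/
structure IsRec (S : ℕ) (σ : St Var) (z : ℕ) (num den kd : ℤ) (s : Finset ℕ) : Prop where
  sub : s ⊆ Finset.range D.n
  num_eq : σ.arr 1 z 0 = num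
  den_eq : σ.arr 1 z 1 = den
  profit : σ.arr 1 z 2 = ((∑ k ∈ s, D.p k : ℕ) : ℤ)
  kind : σ.arr 1 z 3 = kd
  bits : ∀ i : ℕ, i < D.n → σ.arr 2 z i = if i ∈ s then 1 else 0
  den_pos : 0 < den
  den_le : den ≤ S
  num_le : |num| ≤ S
  kd_abs : |kd| = 1
  feas : ∀ lam : ℝ, (kd : ℝ) * num ≤ kd * (lam * den) → D.Feas lam s

/-- Slot `z` is unused. -/
def Unused (σ : St Var) (z : ℕ) : Prop := ∀ j : ℤ, σ.arr 1 z j = 0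

variable (D) in
/-- Slot `z` is unused or holds a record. -/
def RecOk (S : ℕ) (σ : St Var) (z : ℕ) : Prop :=
  Unused σ z ∨ ∃ num den kd s, D.IsRec S σ z num den kd s

variable (D) in
/-- Slot `z` holds a record for the item set `s`, which is feasible at `lam`. -/
def Covers (S : ℕ) (σ : St Var) (z : ℕ) (lam : ℝ) (s : Finset ℕ) : Prop :=
  ∃ num den kd, D.IsRec S σ z num den kd s ∧ (kd : ℝ) * num ≤ kd * (lam * den)

theorem IsRec.congr {σ σ' : St Var} {z : ℕ} {kd : ℤ} {s : Finset ℕ}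
    (h : D.IsRec S σ z num den kd s) (h1 : σ'.arr 1 z = σ.arr 1 z) (h2 : σ'.arr 2 z = σ.arr 2 z) :
    D.IsRec S σ' z num den kd s :=
  ⟨h.sub, by rw [h1, h.num_eq], by rw [h1, h.den_eq], by rw [h1, h.profit], by rw [h1, h.kind],
    by rw [h2]; exact h.bits, h.den_pos, h.den_le, h.num_le, h.kd_abs, h.feas⟩

theorem RecOk.congr {σ σ' : St Var} {z : ℕ} (h : D.RecOk S σ z)
    (h1 : σ'.arr 1 z = σ.arr 1 z) (h2 : σ'.arr 2 z = σ.arr 2 z) : D.RecOk S σ' z := by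
  rcases h with h | ⟨num, den, kd, s, h⟩
  · exact Or.inl fun j => by rw [h1, h]
  · exact Or.inr ⟨num, den, kd, s, h.congr h1 h2⟩

theorem Covers.congr {σ σ' : St Var} {z : ℕ} {lam : ℝ} {s : Finset ℕ} (h : D.Covers S σ z lam s)
    (h1 : σ'.arr 1 z = σ.arr 1 z) (h2 : σ'.arr 2 z = σ.arr 2 z) : D.Covers S σ' z lam s := by
  obtain ⟨num, den, kd, h, hl⟩ := h
  exact ⟨num, den, kd, h.congr h1 h2, hl⟩

/-- A record is stored in the original coordinates: the parameter `num / den` of the reflected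
instance becomes `sg * num / den`. -/
theorem emit_isRec (hP : D.Params E S u) {σ : St Var} {slot kind : Ex Var} {z : ℕ} {kd : ℤ}
    {s : Finset ℕ} {r : ℕ} (hsub : s ⊆ Finset.range D.n)
    (hslot : ∀ σ' : St Var, σ'.reg .Z = σ.reg .Z → slot.eval σ' = z ∧ slot.Safe σ')
    (hkind : ∀ σ' : St Var, σ'.reg .sg = σ.reg .sg → kind.eval σ' = kd ∧ kind.Safe σ')
    (hss : slot.size ≤ 4) (hks : kind.size ≤ 4) (hkd : |kd| = 1)
    (hB : D.Base E S σ) (hp : Point S T num den sg σ) (ht : Traced D sg s r σ)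
    (hfeas : ∀ lam : ℝ, (kd : ℝ) * (sg * num) ≤ kd * (lam * den) → D.Feas lam s) :
    Tr u (Prog.emit slot kind) (D.n * 50 + 120) σ fun σ' =>
      D.IsRec S σ' z (sg * num) den kd s ∧
      ∀ z' : ℤ, z' ≠ z → σ'.arr 1 z' = σ.arr 1 z' ∧ σ'.arr 2 z' = σ.arr 2 z' := by
  have hS := hP.S_le
  have hS1 := hP.S_pos
  have hn := hP.n_le
  have h1 := hp.num_le
  have h2 := hp.den_le
  have h3 := hp.den_pos
  have e : |sg * num| = |num| := by rw [abs_mul, hp.sg_abs, one_mul]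
  refine (emit_spec (by omega) hslot hkind hss hks (by rw [hkd]; omega) hB.reg_n
    (by rw [hp.reg_sg, hp.reg_num, e]; omega) (by rw [hp.reg_den, abs_of_pos h3]; omega) ht.P
    (by rw [Nat.abs_cast]; exact_mod_cast hP.sum_p_le hsub) ht.bits).mono le_rfl ?_
  rintro σ' - ⟨r0, r1, r2, r3, hb, ho⟩
  rw [hp.reg_sg, hp.reg_num] at r0
  rw [hp.reg_den] at r1
  exact ⟨⟨hsub, r0, r1, r2, r3, hb, h3, h2, by rw [e]; exact h1, hkd, by exact_mod_cast hfeas⟩, ho⟩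

/-- The set fits at `num / den` in the reflected instance, and moving from there to `sg * lam` does
not increase its weight. -/
theorem feas_of_le (hden : 0 < den) (hsg : |sg| = 1) {s : Finset ℕ}
    (h : (∑ k ∈ s, D.a k) * den + num * (sg * ∑ k ∈ s, D.b k) ≤ D.W * den) {lam : ℝ}
    (hl : (sg * lam * den - num) * ((sg * ∑ k ∈ s, D.b k : ℤ) : ℝ) ≤ 0) : D.Feas lam s := by
  have hd : (0 : ℝ) < den := by exact_mod_cast hden
  have h2 : (sg : ℝ) * sg = 1 := by
    rcases (abs_eq zero_le_one).1 hsg with h | h <;> simp [h]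
  unfold Feas
  generalize ∑ k ∈ s, D.a k = A at *
  generalize ∑ k ∈ s, D.b k = B at *
  have h' : (A : ℝ) * den + num * (sg * B) ≤ D.W * den := by exact_mod_cast h
  push_cast at hl
  have e : (sg * lam * den - num) * (sg * B : ℝ) = sg * sg * (lam * den * B) - num * (sg * B) := by
    ring
  rw [e, h2] at hl
  refine le_of_mul_le_mul_right ?_ hd
  linarith

/-- The weight is unchanged if both the slope and the parameter are multiplied by `sg`, since `sg *
sg = 1`. -/
theorem Feas.mirror (hsg : |sg| = 1) {s : Finset ℕ} {lam : ℝ} (h : D.Feas lam s) :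
    ((∑ k ∈ s, D.a k : ℤ) : ℝ) + sg * lam * ((sg * ∑ k ∈ s, D.b k : ℤ) : ℝ) ≤ D.W := by
  have h2 : (sg : ℝ) * sg = 1 := by
    rcases (abs_eq zero_le_one).1 hsg with h | h <;> simp [h]
  unfold Feas at h
  push_cast at h ⊢
  have e : (sg : ℝ) * lam * (sg * ∑ k ∈ s, (D.b k : ℝ)) = sg * sg * (lam * ∑ k ∈ s, (D.b k : ℝ)) := by
    ring
  rw [e, h2, one_mul]
  exact h

variable (D) in
/-- The item sets of scaled profit at least `n * (E - 1)` at level `T`. -/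
def Fam (E T : ℕ) (s : Finset ℕ) : Prop :=
  s ⊆ Finset.range D.n ∧ D.n * (E - 1) ≤ ∑ k ∈ s, D.scaled E T k

/-- Only the symmetric difference contributes, which saves the factor 2 of the triangle inequality.
In `dpSet_opt` this keeps the perturbation below `S`. -/
theorem sum_sub_sum_le {n : ℕ} (f : ℕ → ℤ) {s t : Finset ℕ} (hs : s ⊆ Finset.range n)
    (ht : t ⊆ Finset.range n) : ∑ k ∈ s, f k - ∑ k ∈ t, f k ≤ ∑ k ∈ Finset.range n, |f k| := by
  rw [← Finset.sum_sdiff_sub_sum_sdiff]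
  have h1 : ∑ k ∈ s \ t, f k ≤ ∑ k ∈ s \ t, |f k| := Finset.sum_le_sum fun _ _ => le_abs_self _
  have h2 : -∑ k ∈ t \ s, f k ≤ ∑ k ∈ t \ s, |f k| := by
    rw [← Finset.sum_neg_distrib]
    exact Finset.sum_le_sum fun _ _ => neg_le_abs _
  have h3 : Disjoint (s \ t) (t \ s) := by
    rw [Finset.disjoint_left]; intro x; simp +contextual
  have h4 : ∑ k ∈ s \ t, |f k| + ∑ k ∈ t \ s, |f k| ≤ ∑ k ∈ Finset.range n, |f k| := by
    rw [← Finset.sum_union h3]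
    exact Finset.sum_le_sum_of_subset_of_nonneg
      (Finset.union_subset (Finset.sdiff_subset.trans hs) (Finset.sdiff_subset.trans ht))
      fun _ _ _ => abs_nonneg _
  linarith

theorem sum_weight (s : Finset ℕ) : ∑ k ∈ s, D.weight S num den sg k =
    S * ((∑ k ∈ s, D.a k) * den + num * (sg * ∑ k ∈ s, D.b k)) - sg * ∑ k ∈ s, D.b k := by
  simp only [weight, Finset.sum_sub_distrib, ← Finset.mul_sum, Finset.sum_add_distrib,
    ← Finset.sum_mul]
  ring

/-- The optimal set of the dynamic program. -/
theorem dpSet_opt (hP : D.Params E S u) (hden : 0 < den) (hden' : den ≤ S) (hnum : |num| ≤ S)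
    (hsg : |sg| = 1) {t : Finset ℕ} (ht : D.Fam E T t) {s : Finset ℕ}
    (hs : s = dpSet (D.weight S num den sg) (D.scaled E T) (16 * (S : ℤ) ^ 3) D.n (D.n * (E - 1))) :
    dpRest (D.weight S num den sg) (D.scaled E T) (16 * (S : ℤ) ^ 3) D.n (D.n * (E - 1)) = 0 ∧
    (∑ k ∈ s, D.a k) * den + num * (sg * ∑ k ∈ s, D.b k) ≤
      (∑ k ∈ t, D.a k) * den + num * (sg * ∑ k ∈ t, D.b k) ∧
    ((∑ k ∈ s, D.a k) * den + num * (sg * ∑ k ∈ s, D.b k) =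
      (∑ k ∈ t, D.a k) * den + num * (sg * ∑ k ∈ t, D.b k) →
      sg * ∑ k ∈ t, D.b k ≤ sg * ∑ k ∈ s, D.b k) := by
  have hS := hP.S_pos
  have hS3 : (1 : ℤ) ≤ (S : ℤ) ^ 3 := one_le_pow₀ (by exact_mod_cast hS)
  have h1 := dpSet_spec (D.weight S num den sg) (D.scaled E T) (16 * (S : ℤ) ^ 3)
    (by have := hP.sum_abs_weight_le hden hden' hnum hsg; linarith) ht.1 ht.2
  rw [← hs, sum_weight, sum_weight] at h1
  have hsub : s ⊆ Finset.range D.n := hs ▸ dpSet_subset _ _ _ _ _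
  have h2 := sum_sub_sum_le (fun k => sg * D.b k) hsub ht.1
  simp only [abs_mul, hsg, one_mul, ← Finset.mul_sum] at h2
  have h3 := hP.sum_abs_le
  have h4 : 0 ≤ ∑ i ∈ Finset.range D.n, |D.a i| := Finset.sum_nonneg fun _ _ => abs_nonneg _
  refine ⟨h1.1, ?_, fun h => ?_⟩
  -- `S` times the difference of the unperturbed weights is at most a difference of slopes, hence at
  -- most `∑ |b k| < S`. So the integer difference is not positive.
  · by_contra! h
    nlinarith [h1.2]
  · rw [h] at h1
    linarith [h1.2]

end Items

namespace KnapsackDP.NewtonChain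

/-- The parameter `lam N` at which `t` was found is already present; only the next parameter and the
set of step `N` are new. -/
theorem snoc {F : Finset ℕ → Prop} {a b : ℕ → ℤ} {W : ℤ} {N : ℕ} {lam : ℕ → ℝ}
    {s : ℕ → Finset ℕ} (h : NewtonChain F a b W N lam s) {t : Finset ℕ} {x : ℝ} (hF : F t)
    (hneg : ∑ k ∈ t, b k < 0)
    (hgap : ((∑ k ∈ t, a k : ℤ) : ℝ) + lam N * ((∑ k ∈ t, b k : ℤ) : ℝ) < W)
    (hnext : x * ((∑ k ∈ t, b k : ℤ) : ℝ) = W - ((∑ k ∈ t, a k : ℤ) : ℝ))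
    (hopt : ∀ t', F t' → ((∑ k ∈ t, a k : ℤ) : ℝ) + lam N * ((∑ k ∈ t, b k : ℤ) : ℝ) ≤
      ((∑ k ∈ t', a k : ℤ) : ℝ) + lam N * ((∑ k ∈ t', b k : ℤ) : ℝ)) :
    NewtonChain F a b W (N + 1) (Function.update lam (N + 1) x) (Function.update s N t) := by
  have key : ∀ i < N + 1, i < N ∧ Function.update lam (N + 1) x i = lam i ∧
      Function.update lam (N + 1) x (i + 1) = lam (i + 1) ∧ Function.update s N t i = s i ∨
      i = N ∧ Function.update lam (N + 1) x i = lam N ∧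
      Function.update lam (N + 1) x (i + 1) = x ∧ Function.update s N t i = t := by
    intro i hi
    rcases Nat.lt_succ_iff_lt_or_eq.1 hi with h | rfl
    · refine Or.inl ⟨h, ?_, ?_, ?_⟩ <;> rw [Function.update_of_ne (by omega)]
    · exact Or.inr ⟨rfl, by rw [Function.update_of_ne (by omega)], by simp, by simp⟩
  constructor <;> intro i hi <;> obtain ⟨hi, e1, e2, e3⟩ | ⟨hi, e1, e2, e3⟩ := key i hi
  all_goals simp only [e1, e2, e3]
  exacts [h.mem i hi, hF, h.neg i hi, hneg, h.gap i hi, hgap, h.next i hi, hnext, h.opt i hi, hopt]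

end KnapsackDP.NewtonChain

/-! ### Correctness of Newton's method. -/

namespace Items
variable {D : Items} {E S u T : ℕ} {num den sg : ℤ}

variable (D) in
/-- The outcome of Newton's method that starts in the state `σ₀`, with the slots `z` and `z + 1`. -/
structure NewtonPost (E S T : ℕ) (sg : ℤ) (σ₀ : St Var) (z : ℕ) (σ : St Var) : Prop where
  fst : D.RecOk S σ z
  snd : D.RecOk S σ (z + 1)
  other : ∀ z' : ℤ, z' ≠ z → z' ≠ z + 1 → σ.arr 1 z' = σ₀.arr 1 z' ∧ σ.arr 2 z' = σ₀.arr 2 z'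
  cover : ∀ s, D.Fam E T s → sg * ∑ k ∈ s, D.b k ≤ 0 → ∀ lam, D.Feas lam s →
    ∃ z' s', (z' = z ∨ z' = z + 1) ∧ D.Fam E T s' ∧ D.Covers S σ z' lam s'

variable (D) in
/-- The situation after `N` steps of Newton's method that starts in the state `σ₀`. -/
structure NewtonInv (E S T : ℕ) (sg : ℤ) (σ₀ : St Var) (z N : ℕ) (num den : ℤ) (σ : St Var) :
    Prop where
  base : D.Base E S σ
  point : Point S T num den sg σ
  reg_Z : σ.reg .Z = z
  chain : ∃ lam s, NewtonChain (D.Fam E T) D.a (fun k => sg * D.b k) D.W N lam s ∧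
    lam 0 = S ∧ lam N = num / den
  fst : (N = 0 ∧ Unused σ z) ∨ ∃ s, D.Fam E T s ∧ D.IsRec S σ z (sg * num) den sg s
  snd : Unused σ (z + 1)
  other : ∀ z' : ℤ, z' ≠ z → z' ≠ z + 1 → σ.arr 1 z' = σ₀.arr 1 z' ∧ σ.arr 2 z' = σ₀.arr 2 z'

theorem sq_cast_eq_one (hsg : |sg| = 1) : (sg : ℝ) * sg = 1 := by
  rcases (abs_eq zero_le_one).1 hsg with h | h <;> simp [h]

/-- If no set of the family with nonpositive slope is feasible at the current parameter value,
then the records cover everything. -/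
theorem NewtonInv.post_of_infeasible (hP : D.Params E S u) {σ₀ σ : St Var} {z N : ℕ}
    (h : D.NewtonInv E S T sg σ₀ z N num den σ)
    (H : ∀ s, D.Fam E T s → sg * ∑ k ∈ s, D.b k ≤ 0 →
      D.W * den < (∑ k ∈ s, D.a k) * den + num * (sg * ∑ k ∈ s, D.b k)) :
    D.NewtonPost E S T sg σ₀ z σ := by
  have hsg := h.point.sg_abs
  have hd : (0 : ℝ) < den := by exact_mod_cast h.point.den_pos
  have h2 := sq_cast_eq_one hsg
  -- A set of nonpositive slope that does not fit at the current parameter does not fit to the left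
  -- of it either.
  have key : ∀ s, D.Fam E T s → sg * ∑ k ∈ s, D.b k ≤ 0 → ∀ lam, D.Feas lam s →
      (num : ℝ) ≤ sg * lam * den := by
    intro s hs hb lam hl
    have h3 := H s hs hb
    have h4 := hl.mirror hsg
    by_contra! hcon
    have h5 : ((sg * ∑ k ∈ s, D.b k : ℤ) : ℝ) ≤ 0 := by exact_mod_cast hb
    have h6 : (D.W : ℝ) * den < ((∑ k ∈ s, D.a k : ℤ) : ℝ) * den +
        num * ((sg * ∑ k ∈ s, D.b k : ℤ) : ℝ) := by exact_mod_cast h3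
    nlinarith
  have hfst : D.RecOk S σ z := by
    rcases h.fst with h | ⟨s, -, h⟩
    exacts [Or.inl h.2, Or.inr ⟨_, _, _, _, h⟩]
  refine ⟨hfst, Or.inl h.snd, h.other, fun s hs hb lam hl => ?_⟩
  rcases h.fst with ⟨rfl, -⟩ | ⟨t, ht, hr⟩
  -- No step has been made, so the parameter is still `S`. There every set of negative slope fits,
  -- and the weight of a set of slope 0 is constant; hence no set of nonpositive slope fits
  -- anywhere.
  · exfalso
    obtain ⟨lams, ss, -, e1, e2⟩ := h.chain
    have e3 : (num : ℝ) = S * den := by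
      rw [e1] at e2; field_simp at e2; linarith
    have e4 : num = S * den := by exact_mod_cast e3
    have h3 := H s hs hb
    rw [e4] at h3
    have h5 := hP.abs_sum_a_le hs.1
    rcases hb.lt_or_eq with hb | hb
    · have h6 := neg_abs_le (∑ k ∈ s, D.a k)
      have h7 := le_abs_self (∑ k ∈ s, D.a k)
      have hd' := h.point.den_pos
      have : (D.W : ℤ) < ∑ k ∈ s, D.a k + S * (sg * ∑ k ∈ s, D.b k) := by
        by_contra! hcon
        nlinarith
      nlinarith
    · have h4 := hl.mirror hsg
      rw [hb] at h3 h4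
      simp only [Int.cast_zero, mul_zero, add_zero] at h3 h4
      have h6 : ∑ k ∈ s, D.a k ≤ D.W := by exact_mod_cast h4
      nlinarith [h.point.den_pos]
  · refine ⟨z, t, Or.inl rfl, ht, _, _, _, hr, ?_⟩
    have h3 := key s hs hb lam hl
    push_cast
    linear_combination h3 + h2 * num

theorem NewtonPost.congr {σ₀ σ σ' : St Var} {z : ℕ} (h : D.NewtonPost E S T sg σ₀ z σ)
    (h1 : σ'.arr 1 = σ.arr 1) (h2 : σ'.arr 2 = σ.arr 2) : D.NewtonPost E S T sg σ₀ z σ' :=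
  ⟨h.fst.congr (by rw [h1]) (by rw [h2]), h.snd.congr (by rw [h1]) (by rw [h2]),
    by rw [h1, h2]; exact h.other, fun s hs hb lam hl => by
      obtain ⟨z', s', hz, hs', hc⟩ := h.cover s hs hb lam hl
      exact ⟨z', s', hz, hs', hc.congr (by rw [h1]) (by rw [h2])⟩⟩

theorem Traced.of_frame {s : Finset ℕ} {r : ℕ} {σ σ' : St Var} (h : Traced D sg s r σ)
    {c : Cmd Var} (hF : Frame c σ σ') (hr : ∀ v ∈ [Var.A, .bs, .P, .rest], c.writesReg v = false)
    (ha : c.writesArr 3 = false) : Traced D sg s r σ' := by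
  simp only [List.mem_cons, List.not_mem_nil, or_false, forall_eq_or_imp, forall_eq] at hr
  obtain ⟨h1, h2, h3, h4⟩ := hr
  exact ⟨by rw [hF.reg _ h1, h.A], by rw [hF.reg _ h2, h.bs], by rw [hF.reg _ h3, h.P],
    by rw [hF.reg _ h4, h.rest], by rw [hF.arr 3 ha]; exact h.bits⟩

/-- The cases follow the slope of the optimal set at the current parameter. If nothing fits, the
previous record already marks the end of the half-line. A set of positive slope fits everywhere to
the left and complements the previous record. A set of negative slope gives the next parameter,
where its weight equals `W`. A set of slope 0 fits everywhere. -/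
theorem newtonStep_spec (hP : D.Params E S u) {σ₀ σ : St Var} {z N : ℕ}
    (h : D.NewtonInv E S T sg σ₀ z N num den σ) :
    Tr u Prog.newtonStep (D.n * ((D.n * (E - 1) + 1) * 114 + 378) +
      (D.n * (E - 1) + 1) * 40 + 600) σ fun σ' =>
      (σ'.reg .cont = 0 ∧ D.NewtonPost E S T sg σ₀ z σ') ∨ ∃ num' den',
        σ'.reg .cont = σ.reg .cont ∧ D.NewtonInv E S T sg σ₀ z (N + 1) num' den' σ' := by
  have hu := hP.S3_le
  have hS1 : (1 : ℤ) ≤ S := by exact_mod_cast hP.S_pos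
  have hS3 : (S : ℤ) * S ≤ S ^ 3 := by nlinarith [mul_nonneg (show (0 : ℤ) ≤ S by omega) (show (0 : ℤ) ≤ S by omega)]
  have hp := h.point
  have hsg := hp.sg_abs
  have hden := hp.den_pos
  have hdS := hp.den_le
  have hnS := abs_le.1 hp.num_le
  refine Tr.of_wp (Wp.seq (Wp.of_tr (dpFill_spec hP h.base hp) fun t1 ht1 σ1 hF1 hV => ?_))
  have hB1 := h.base.of_frame hF1 (by decide) rfl
  have hp1 := hp.of_frame hF1 (by decide)
  refine Wp.seq (Wp.of_tr (trace_spec hP hB1 hp1 hV) fun t2 ht2 σ2 hF2 hTr => ?_)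
  have hB2 := hB1.of_frame hF2 (by decide) rfl
  have hp2 := hp1.of_frame hF2 (by decide)
  have hopt := fun (t : Finset ℕ) (ht : D.Fam E T t) =>
    dpSet_opt hP hden hdS hp.num_le hsg ht rfl
  have hfam := le_sum_dpSet (D.weight S num den sg) (D.scaled E T) (16 * (S : ℤ) ^ 3) D.n
    (D.n * (E - 1))
  have hsub := dpSet_subset (D.weight S num den sg) (D.scaled E T) (16 * (S : ℤ) ^ 3) D.n
    (D.n * (E - 1))
  have a1 : σ2.arr 1 = σ.arr 1 := (hF2.arr 1 rfl).trans (hF1.arr 1 rfl)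
  have a2 : σ2.arr 2 = σ.arr 2 := (hF2.arr 2 rfl).trans (hF1.arr 2 rfl)
  have rc : σ2.reg .cont = σ.reg .cont := (hF2.reg .cont rfl).trans (hF1.reg .cont rfl)
  have rZ : σ2.reg .Z = z := ((hF2.reg .Z rfl).trans (hF1.reg .Z rfl)).trans h.reg_Z
  generalize dpSet (D.weight S num den sg) (D.scaled E T) (16 * (S : ℤ) ^ 3) D.n
    (D.n * (E - 1)) = s at *
  generalize dpRest (D.weight S num den sg) (D.scaled E T) (16 * (S : ℤ) ^ 3) D.n
    (D.n * (E - 1)) = r at *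
  have hA := hP.abs_sum_a_le hsub
  have hb := hP.abs_sum_b_le hsub
  have hb' : |sg * ∑ k ∈ s, D.b k| + 1 ≤ S := by rw [abs_mul, hsg, one_mul]; exact hb
  have hW := hP.W_le
  set α := ∑ k ∈ s, D.a k with hα
  set β := ∑ k ∈ s, D.b k with hβ
  have bA := abs_le.1 (show |α| ≤ S by omega)
  have bb := abs_le.1 (show |sg * β| ≤ S by omega)
  have b1 : |(D.W : ℤ) * den - (α * den + num * (sg * β))| ≤ 3 * S ^ 3 := by
    have e1 : |(D.W : ℤ) * den| ≤ S * S := by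
      rw [abs_mul, Nat.abs_cast, abs_of_pos hden]; gcongr; omega
    have e2 : |α * den| ≤ S * S := by
      rw [abs_mul, abs_of_pos hden]; gcongr; omega
    have e3 : |num * (sg * β)| ≤ S * S := by
      rw [abs_mul]; gcongr; exacts [hp.num_le, by omega]
    calc _ ≤ |(D.W : ℤ) * den| + |α * den + num * (sg * β)| := abs_sub _ _
      _ ≤ |(D.W : ℤ) * den| + (|α * den| + |num * (sg * β)|) := by gcongr; exact abs_add_le _ _
      _ ≤ _ := by linarith
  have b2 := abs_le.1 b1
  refine Wp.seq (Wp.set (by simp) ?_ ?_)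
  · simp [hB2.reg_W, hp2.reg_den, hTr.A, hp2.reg_num, hTr.bs]
    constructor <;> linarith
  have hFv : Ex.eval σ2 (Ex.var .W * Ex.var .den - (Ex.var .A * Ex.var .den +
      Ex.var .num * Ex.var .bs)) = (D.W : ℤ) * den - (α * den + num * (sg * β)) := by
    simp [hB2.reg_W, hp2.reg_den, hTr.A, hp2.reg_num, hTr.bs, hα, hβ]
  rw [hFv]
  set Fv := (D.W : ℤ) * den - (α * den + num * (sg * β)) with hFd
  have hB3 := hB2.of_frame (Frame.set σ2 .F Fv) (by decide) rfl
  have hp3 := hp2.of_frame (Frame.set σ2 .F Fv) (by decide)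
  have hT3 := hTr.of_frame (Frame.set σ2 .F Fv) (by decide) rfl
  have rc3 : (σ2.set .F Fv).reg .cont = σ.reg .cont := by simpa using rc
  have rZ3 : (σ2.set .F Fv).reg .Z = z := by simpa using rZ
  have rF3 : (σ2.set .F Fv).reg .F = Fv := by simp
  have a13 : (σ2.set .F Fv).arr 1 = σ.arr 1 := a1
  have a23 : (σ2.set .F Fv).arr 2 = σ.arr 2 := a2
  generalize σ2.set .F Fv = σ3 at *
  clear hF2 hF1 hV hTr hB1 hp1 hB2 hp2 a1 a2 rc rZ
  have htime : t1 + t2 + D.n * 100 + 490 ≤ D.n * ((D.n * (E - 1) + 1) * 114 + 378) +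
      (D.n * (E - 1) + 1) * 40 + 600 := by
    have : D.n * ((D.n * (E - 1) + 1) * 114 + 378) =
      D.n * ((D.n * (E - 1) + 1) * 114 + 114) + 264 * D.n := by ring
    omega
  refine Wp.ite (by simp) (fun hr => Wp.set (by simp) (by simp) ⟨?_, Or.inl ⟨by simp, ?_⟩⟩)
    (fun hr => ?_)
  · simp; omega
  · refine (h.post_of_infeasible hP fun t ht => ?_).congr a13 a23
    have := (hopt t ht).1
    simp [hT3.rest, this] at hr
  obtain rfl : r = 0 := by simp [hT3.rest] at hr; exact hr
  replace hfam : D.Fam E T s := ⟨hsub, hfam⟩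
  refine Wp.ite (by simp) (fun hr => Wp.set (by simp) (by simp) ⟨?_, Or.inl ⟨by simp, ?_⟩⟩)
    (fun hr => ?_)
  · simp; omega
  · refine (h.post_of_infeasible hP fun t ht _ => ?_).congr a13 a23
    simp [rF3] at hr
    linarith [(hopt t ht).2.1]
  replace hr : α * den + num * (sg * β) ≤ D.W * den := by simp [rF3] at hr; linarith
  have hs2 := sq_cast_eq_one hsg
  have hd : (0 : ℝ) < den := by exact_mod_cast hden
  have start : N = 0 → num = S * den := by
    rintro rfl
    obtain ⟨lams, ss, -, e1, e2⟩ := h.chain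
    have e3 : (num : ℝ) = S * den := by
      rw [e1] at e2; field_simp at e2; linarith
    exact_mod_cast e3
  have hsgu : |(-sg)| = 1 := by rw [abs_neg, hsg]
  have hne : (z : ℤ) ≠ ((z + 1 : ℕ) : ℤ) := by push_cast; omega
  have hfst : ∀ σ' : St Var, σ'.arr 1 z = σ3.arr 1 z → σ'.arr 2 z = σ3.arr 2 z →
      D.RecOk S σ' z := by
    intro σ' h1 h2
    rw [a13] at h1
    rw [a23] at h2
    rcases h.fst with h' | ⟨s, -, h'⟩
    exacts [RecOk.congr (Or.inl h'.2) h1 h2, RecOk.congr (Or.inr ⟨_, _, _, _, h'⟩) h1 h2]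
  have slot0 : ∀ σ' : St Var, σ'.reg .Z = z →
      (Ex.var Var.Z).eval σ' = z ∧ (Ex.var Var.Z).Safe σ' := fun σ' h => by simp [h]
  have slot1 : ∀ σ' : St Var, σ'.reg .Z = z →
      (Ex.var Var.Z + 1).eval σ' = ((z + 1 : ℕ) : ℤ) ∧ (Ex.var Var.Z + 1).Safe σ' :=
    fun σ' h => by simp [h]
  have kind0 : ∀ σ' : St Var, σ'.reg .sg = sg →
      (Ex.var Var.sg).eval σ' = sg ∧ (Ex.var Var.sg).Safe σ' := fun σ' h => by simp [h]
  have kind1 : ∀ σ' : St Var, σ'.reg .sg = sg →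
      (0 - Ex.var Var.sg).eval σ' = -sg ∧ (0 - Ex.var Var.sg).Safe σ' := fun σ' h => by simp [h]
  refine Wp.ite (by simp) (fun hbs => ?_) (fun hbs => ?_)
  · replace hbs : 0 < sg * β := by simpa [hT3.bs] using hbs
    have hbs' : (0 : ℝ) ≤ ((sg * β : ℤ) : ℝ) := by exact_mod_cast hbs.le
    refine Wp.seq (Wp.of_tr (emit_isRec hP (z := z + 1) (kd := -sg) hsub
      (fun σ' h' => slot1 σ' (h'.trans rZ3)) (fun σ' h' => kind1 σ' (h'.trans hp3.reg_sg))
      (by simp) (by simp) hsgu hB3 hp3 hT3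
      (fun lam hl => feas_of_le hden hsg hr (mul_nonpos_of_nonpos_of_nonneg ?_ hbs'))) ?_)
    · push_cast at hl
      linear_combination hl + (num : ℝ) * hs2
    rintro t4 ht4 σ4 hF4 ⟨hrec, hoth⟩
    refine Wp.set (by simp) (by simp) ⟨?_, Or.inl ⟨by simp, NewtonPost.congr (σ := σ4)
      ⟨?_, Or.inr ⟨_, _, _, _, hrec⟩, ?_, ?_⟩ rfl rfl⟩⟩
    · simp; omega
    · exact hfst _ (hoth z hne).1 (hoth z hne).2
    · intro z' h1 h2
      rw [(hoth z' (by exact_mod_cast h2)).1, (hoth z' (by exact_mod_cast h2)).2, a13, a23]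
      exact h.other z' h1 h2
    · intro t ht htb lam hl
      rcases le_total (sg * lam * den) (num : ℝ) with hc | hc
      · refine ⟨z + 1, s, Or.inr rfl, hfam, _, _, _, hrec, ?_⟩
        push_cast
        linear_combination hc + (-num : ℝ) * hs2
      · rcases h.fst with ⟨h0, -⟩ | ⟨t', ht', hr'⟩
        -- A set of slope at least 1 that fits at the start `S` would satisfy `a + S ≤ W`, contrary
        -- to `|a| + W + 1 ≤ S`.
        · exfalso
          rw [start h0] at hr
          have : α + S * (sg * β) ≤ D.W := by
            refine le_of_mul_le_mul_right ?_ hden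
            linarith
          have h3 := neg_abs_le α
          have h4 := mul_le_mul_of_nonneg_left (show 1 ≤ sg * β by omega)
            (show (0 : ℤ) ≤ S by omega)
          linarith
        · refine ⟨z, t', Or.inl rfl, ht', _, _, _, hr'.congr
            ((hoth z hne).1.trans (by rw [a13])) ((hoth z hne).2.trans (by rw [a23])), ?_⟩
          · push_cast
            linear_combination hc + (num : ℝ) * hs2
  replace hbs : sg * β ≤ 0 := by simpa [hT3.bs] using hbs
  refine Wp.ite (by simp) (fun hbs' => ?_) (fun hbs' => ?_)
  · replace hbs' : sg * β < 0 := by simpa [hT3.bs] using hbs'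
    have hbR : ((sg * β : ℤ) : ℝ) < 0 := by exact_mod_cast hbs'
    refine Wp.seq (Wp.of_tr (T := 10)
      (R := fun σ' => (0 < Fv → σ'.reg .cont = σ.reg .cont) ∧ (Fv ≤ 0 → σ'.reg .cont = 0))
      (Tr.of_wp (Wp.ite (by simp) (fun h' => Wp.skip ?_) (fun h' => Wp.set (by simp) (by simp) ?_)))
      fun t4 ht4 σ4 hF4 hc => ?_)
    · simp [rF3] at h'; simp [rc3, h']
    · simp [rF3] at h'; simp [h']
    have hB4 := hB3.of_frame hF4 (by decide) rfl
    have hT4 := hT3.of_frame hF4 (by decide) rfl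
    have hp4 := hp3.of_frame hF4 (by decide)
    have rZ4 : σ4.reg .Z = z := (hF4.reg .Z rfl).trans rZ3
    have a14 : σ4.arr 1 = σ.arr 1 := (hF4.arr 1 rfl).trans a13
    have a24 : σ4.arr 2 = σ.arr 2 := (hF4.arr 2 rfl).trans a23
    have e1 : (Ex.var Var.A - Ex.var Var.W).eval σ4 = α - D.W := by simp [hT4.A, hB4.reg_W, hα]
    have e2 : (0 - Ex.var Var.bs).eval (σ4.set .num (α - D.W)) = -(sg * β) := by
      simp [hT4.bs, hβ]
    refine Wp.seq (Wp.set (by simp) ?_ ?_)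
    · rw [e1]
      have := abs_le.1 (show |α| ≤ S by omega)
      have := neg_abs_le α
      have := hP.S_le
      omega
    rw [e1]
    refine Wp.seq (Wp.set (by simp) ?_ ?_)
    · rw [e2]
      have := hP.S_le
      omega
    rw [e2]
    have hB6 := (hB4.of_frame (Frame.set σ4 .num (α - D.W)) (by decide) rfl).of_frame
      (Frame.set _ .den (-(sg * β))) (by decide) rfl
    have hT6 := (hT4.of_frame (Frame.set σ4 .num (α - D.W)) (by decide) rfl).of_frame
      (Frame.set _ .den (-(sg * β))) (by decide) rfl
    have hp6 : Point S T (α - D.W) (-(sg * β)) sg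
        ((σ4.set .num (α - D.W)).set .den (-(sg * β))) :=
      ⟨by simp [hp4.reg_T], by simp, by simp, by simp [hp4.reg_sg], by omega, by omega, by
        have := abs_sub α (D.W : ℤ)
        rw [Nat.abs_cast] at this
        omega, hsg⟩
    have rc6 : ((σ4.set .num (α - D.W)).set .den (-(sg * β))).reg .cont = σ4.reg .cont := by simp
    have rZ6 : ((σ4.set .num (α - D.W)).set .den (-(sg * β))).reg .Z = z := by simp [rZ4]
    have a16 : ((σ4.set .num (α - D.W)).set .den (-(sg * β))).arr 1 = σ.arr 1 := a14
    have a26 : ((σ4.set .num (α - D.W)).set .den (-(sg * β))).arr 2 = σ.arr 2 := a24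
    generalize (σ4.set .num (α - D.W)).set .den (-(sg * β)) = σ6 at *
    refine Wp.of_tr (emit_isRec hP (z := z) (kd := sg) hsub
      (fun σ' h' => slot0 σ' (h'.trans rZ6)) (fun σ' h' => kind0 σ' (h'.trans hp6.reg_sg))
      (by simp) (by simp) hsg hB6 hp6 hT6
      (fun lam hl => feas_of_le (num := α - D.W) hp6.den_pos hsg (by rw [← hα, ← hβ]; linarith)
        (mul_nonpos_of_nonneg_of_nonpos ?_ hbR.le))) ?_
    · push_cast at hl ⊢
      linear_combination hl - ((α : ℝ) - D.W) * hs2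
    rintro t7 ht7 σ7 hF7 ⟨hrec, hoth⟩
    have hother : ∀ z' : ℤ, z' ≠ z → z' ≠ z + 1 →
        σ7.arr 1 z' = σ₀.arr 1 z' ∧ σ7.arr 2 z' = σ₀.arr 2 z' := by
      intro z' h1 h2
      rw [(hoth z' h1).1, (hoth z' h1).2, a16, a26]
      exact h.other z' h1 h2
    have hsnd : Unused σ7 (z + 1) := fun j => by
      rw [(hoth ((z + 1 : ℕ) : ℤ) (by simp)).1, a16]; exact h.snd j
    refine ⟨?_, ?_⟩
    · simp; omega
    rcases lt_or_ge 0 Fv with hFp | hFn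
    · refine Or.inr ⟨α - D.W, -(sg * β), ?_, hB6.of_frame hF7 (by decide) rfl,
        hp6.of_frame hF7 (by decide), (hF7.reg .Z rfl).trans rZ6, ?_,
        Or.inr ⟨s, hfam, hrec⟩, hsnd, hother⟩
      · rw [hF7.reg .cont rfl, rc6, hc.1 hFp]
      · obtain ⟨lams, ss, hch, e1, e2⟩ := h.chain
        refine ⟨_, _, hch.snoc (t := s) (x := ((α - D.W : ℤ) : ℝ) / ((-(sg * β) : ℤ) : ℝ)) hfam
          ?_ ?_ ?_ ?_, ?_, ?_⟩
        · rw [← Finset.mul_sum]; exact hbs'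
        · rw [← Finset.mul_sum, e2]
          have h6 : (α : ℝ) * den + num * ((sg * β : ℤ) : ℝ) < D.W * den := by
            exact_mod_cast (by omega : α * den + num * (sg * β) < D.W * den)
          have h7 : (α : ℝ) + num / den * ((sg * β : ℤ) : ℝ) =
            (α * den + num * ((sg * β : ℤ) : ℝ)) / den := by field_simp
          rw [h7, div_lt_iff₀ hd]
          exact_mod_cast h6
        · rw [← Finset.mul_sum]
          have h8 : ((-(sg * β) : ℤ) : ℝ) = -((sg * β : ℤ) : ℝ) := by push_cast; ring
          rw [h8]
          have h9 : ((sg * β : ℤ) : ℝ) ≠ 0 := hbR.ne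
          change _ * ((sg * β : ℤ) : ℝ) = ((D.W : ℤ) : ℝ) - ((α : ℤ) : ℝ)
          rw [div_mul_eq_mul_div, div_neg, mul_div_cancel_right₀ _ h9]
          push_cast
          ring
        · intro t ht
          rw [← Finset.mul_sum, ← Finset.mul_sum, e2]
          have h6 : (α : ℝ) * den + num * ((sg * β : ℤ) : ℝ) ≤
            ((∑ k ∈ t, D.a k : ℤ) : ℝ) * den + num * ((sg * ∑ k ∈ t, D.b k : ℤ) : ℝ) := by
            exact_mod_cast (hopt t ht).2.1
          have h7 : ∀ x y : ℝ, x + num / den * y = (x * den + num * y) / den := by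
            intro x y; field_simp
          rw [h7, h7]
          gcongr
        · rw [Function.update_of_ne (by omega), e1]
        · rw [Function.update_self]
    -- Without slack the parameter does not move. A set `t` of nonpositive slope that fits further
    -- left fits here as well, so it ties with `s`. Ties were broken in favour of larger slopes, so
    -- `t` has negative slope and is too heavy further left, a contradiction.
    · have hFv0 : α * den + num * (sg * β) = D.W * den := by omega
      refine Or.inl ⟨?_, Or.inr ⟨_, _, _, _, hrec⟩, Or.inl hsnd, hother, ?_⟩
      · rw [hF7.reg .cont rfl, rc6, hc.2 hFn]
      intro t ht htb lam hl
      refine ⟨z, s, Or.inl rfl, hfam, _, _, _, hrec, ?_⟩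
      suffices hh : ((α - D.W : ℤ) : ℝ) ≤ sg * lam * ((-(sg * β) : ℤ) : ℝ) by
        push_cast at hh ⊢
        linear_combination hh + ((α : ℝ) - D.W) * hs2
      have h4 := hl.mirror hsg
      have h5 := hopt t ht
      have h6 : ((sg * ∑ k ∈ t, D.b k : ℤ) : ℝ) ≤ 0 := by exact_mod_cast htb
      by_contra! hcon
      have h7 : (sg * lam * den : ℝ) < num := by
        have h8 : ((α : ℝ) - D.W) * den = num * -((sg * β : ℤ) : ℝ) := by
          have : (α : ℝ) * den + num * ((sg * β : ℤ) : ℝ) = D.W * den := by exact_mod_cast hFv0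
          linarith
        have h9 : (sg * lam * den : ℝ) * -((sg * β : ℤ) : ℝ) < num * -((sg * β : ℤ) : ℝ) := by
          rw [← h8]
          have := mul_lt_mul_of_pos_right hcon hd
          push_cast at this ⊢
          linarith
        exact lt_of_mul_lt_mul_right h9 (by linarith)
      have h8 : ((∑ k ∈ t, D.a k : ℤ) : ℝ) * den + num * ((sg * ∑ k ∈ t, D.b k : ℤ) : ℝ) ≤
          D.W * den := by
        have h4d := mul_le_mul_of_nonneg_right h4 hd.le
        have := mul_nonneg_of_nonpos_of_nonpos (sub_neg.2 h7).le h6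
        linarith
      have h9 : (∑ k ∈ t, D.a k) * den + num * (sg * ∑ k ∈ t, D.b k) ≤ D.W * den := by
        exact_mod_cast h8
      have h10 := h5.2.2 (by linarith [h5.2.1])
      have h11 : ((sg * ∑ k ∈ t, D.b k : ℤ) : ℝ) < 0 := by exact_mod_cast h10.trans_lt hbs'
      have h12 : (D.W : ℝ) * den ≤
          ((∑ k ∈ t, D.a k : ℤ) : ℝ) * den + num * ((sg * ∑ k ∈ t, D.b k : ℤ) : ℝ) := by
        exact_mod_cast hFv0.symm.le.trans h5.2.1
      have h4d := mul_le_mul_of_nonneg_right h4 hd.le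
      have := mul_pos_of_neg_of_neg (sub_neg.2 h7) h11
      linarith
  · replace hbs' : sg * β = 0 := by
      simp [hT3.bs, ← hβ] at hbs'; omega
    have hbR : ((sg * β : ℤ) : ℝ) = 0 := by exact_mod_cast hbs'
    -- A set of slope 0 that fits once fits everywhere. It is stored for both half-lines that meet
    -- at the current parameter.
    have hfeas : ∀ lam, D.Feas lam s := fun lam => feas_of_le hden hsg hr (by rw [← hβ, hbR]; simp)
    refine Wp.seq (Wp.of_tr (emit_isRec hP (z := z) (kd := sg) hsub
      (fun σ' h' => slot0 σ' (h'.trans rZ3)) (fun σ' h' => kind0 σ' (h'.trans hp3.reg_sg))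
      (by simp) (by simp) hsg hB3 hp3 hT3 (fun lam hl => hfeas lam)) ?_)
    rintro t4 ht4 σ4 hF4 ⟨hrec, hoth⟩
    have rZ4 : σ4.reg .Z = z := (hF4.reg .Z rfl).trans rZ3
    have hp4 := hp3.of_frame hF4 (by decide)
    refine Wp.seq (Wp.of_tr (emit_isRec hP (z := z + 1) (kd := -sg) hsub
      (fun σ' h' => slot1 σ' (h'.trans rZ4)) (fun σ' h' => kind1 σ' (h'.trans hp4.reg_sg))
      (by simp) (by simp) hsgu (hB3.of_frame hF4 (by decide) rfl) hp4
      (hT3.of_frame hF4 (by decide) rfl) (fun lam hl => hfeas lam)) ?_)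
    rintro t5 ht5 σ5 hF5 ⟨hrec', hoth'⟩
    replace hrec := hrec.congr (hoth' z hne).1 (hoth' z hne).2
    refine Wp.set (by simp) (by simp) ⟨?_, Or.inl ⟨by simp, NewtonPost.congr (σ := σ5)
      ⟨Or.inr ⟨_, _, _, _, hrec⟩, Or.inr ⟨_, _, _, _, hrec'⟩, ?_, ?_⟩ rfl rfl⟩⟩
    · simp; omega
    · intro z' h1 h2
      rw [(hoth' z' (by exact_mod_cast h2)).1, (hoth' z' (by exact_mod_cast h2)).2,
        (hoth z' h1).1, (hoth z' h1).2, a13, a23]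
      exact h.other z' h1 h2
    · intro t ht htb lam hl
      rcases le_total (sg * lam * den) (num : ℝ) with hc | hc
      · refine ⟨z + 1, s, Or.inr rfl, hfam, _, _, _, hrec', ?_⟩
        push_cast
        linear_combination hc + (-num : ℝ) * hs2
      · refine ⟨z, s, Or.inl rfl, hfam, _, _, _, hrec, ?_⟩
        push_cast
        linear_combination hc + (num : ℝ) * hs2

end Items

/-! ### Profit levels and scales. -/

namespace Items
variable {D : Items} {E S u T IT : ℕ} {num den sg : ℤ}

/-- A bound for the running time of an iteration of Newton's method. -/
def stepTime (n E : ℕ) : ℕ :=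
  n * ((n * (E - 1) + 1) * 114 + 378) + (n * (E - 1) + 1) * 40 + 600

variable (D) in
/-- Newton's method takes at most `IT` iterations. -/
def IterBound (E S IT : ℕ) : Prop :=
  ∀ (T : ℕ) (sg : ℤ) (N : ℕ) (lam : ℕ → ℝ) (s : ℕ → Finset ℕ), |sg| = 1 →
    NewtonChain (D.Fam E T) D.a (fun k => sg * D.b k) D.W N lam s → lam 0 = S → N ≤ IT

/-- Every iteration that continues extends a Newton chain, so there are at most `IT` of them; one
more iteration stops the loop. -/
theorem newton_spec (hP : D.Params E S u) (hIT : D.IterBound E S IT) {σ : St Var} {z : ℕ}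
    (hB : D.Base E S σ) (hT : σ.reg .T = T) (hsg : σ.reg .sg = sg) (hsg1 : |sg| = 1)
    (hZ : σ.reg .Z = z) (hz : z + 2 ≤ u) (h0 : Unused σ z) (h1 : Unused σ (z + 1)) :
    Tr u Prog.newton ((IT + 1) * (stepTime D.n E + 5) + 30) σ fun σ' =>
      σ'.reg .Z = ((z + 2 : ℕ) : ℤ) ∧ D.NewtonPost E S T sg σ z σ' := by
  have hS := hP.S_le
  have hS1 := hP.S_pos
  refine Tr.of_wp (Wp.seq (Wp.set (by simp) ?_ <| Wp.seq <| Wp.set (by simp) ?_ <| Wp.seq <|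
    Wp.set (by simp) ?_ <| Wp.seq <| Wp.of_tr (Tr.loopWhile (e := .var .cont) (T := stepTime D.n E)
      (fun m σ' => (σ'.reg .cont = 1 ∧ ∃ N num den, N + m = IT + 1 ∧
        D.NewtonInv E S T sg σ z N num den σ') ∨
        (σ'.reg .cont = 0 ∧ D.NewtonPost E S T sg σ z σ')) (IT + 1) ?_ (fun _ _ _ => trivial)
        ?_ (fun _ σ' h he => (?_ : D.NewtonPost E S T sg σ z σ'))) fun t ht σ' hF h => ?_))
  · simp [hB.reg_S]; omega
  · simp; omega
  · simp; omega
  · refine Or.inl ⟨by simp, 0, S, 1, by simp, ?_, ?_, ?_, ?_, ?_, ?_, fun z' _ _ => ⟨rfl, rfl⟩⟩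
    · exact ((hB.of_frame (Frame.set _ _ _) (by decide) rfl).of_frame (Frame.set _ _ _)
        (by decide) rfl).of_frame (Frame.set _ _ _) (by decide) rfl
    · exact ⟨by simp [hT], by simp [hB.reg_S], by simp, by simp [hsg], by simp, by omega,
        by simp, hsg1⟩
    · simp [hZ]
    · exact ⟨fun _ => S, fun _ => ∅, ⟨by simp, by simp, by simp, by simp, by simp⟩, rfl, by simp⟩
    · exact Or.inl ⟨rfl, h0⟩
    · exact h1
  · rintro m σ' (⟨hc, N, num, den, hm, hI⟩ | ⟨hc, -⟩) he
    · refine (newtonStep_spec hP hI).mono le_rfl ?_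
      -- The steps made so far form a chain that starts at `S`. Hence the number `m = IT + 1 - N` of
      -- iterations left is positive.
      have hN : N ≤ IT := by
        obtain ⟨lam, s, hch, e, -⟩ := hI.chain
        exact hIT _ _ _ _ _ hsg1 hch e
      rintro σ₂ - (⟨hc', hp⟩ | ⟨num', den', hc', hI'⟩)
      · exact ⟨0, by omega, Or.inr ⟨hc', hp⟩⟩
      · exact ⟨m - 1, by omega, Or.inl ⟨by rw [hc', hc], N + 1, num', den', by omega, hI'⟩⟩
    · simp [hc] at he
  · rcases h with ⟨hc, -⟩ | ⟨-, h⟩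
    · simp [hc] at he
    · exact h
  · have hZ' : σ'.reg .Z = z := by rw [hF.reg _ rfl]; simp [hZ]
    refine Wp.set (by simp) ?_ ⟨?_, ?_, NewtonPost.congr h rfl rfl⟩
    · simp [hZ']; omega
    · simp at ht ⊢; omega
    · simp [hZ']

variable (D) in
/-- The slots below `Z` are in order, the others are empty. -/
structure Table (S Z : ℕ) (σ : St Var) : Prop where
  reg_Z : σ.reg .Z = Z
  ok : ∀ z < Z, D.RecOk S σ z
  empty : ∀ z : ℤ, Z ≤ z → ∀ j : ℤ, σ.arr 1 z j = 0 ∧ σ.arr 2 z j = 0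

variable (D) in
/-- The records of the family of level `T` with slot number below `Z` cover the family. -/
def Done (E S : ℕ) (σ : St Var) (Z T : ℕ) : Prop :=
  ∀ s, D.Fam E T s → ∀ lam, D.Feas lam s → ∃ z < Z, ∃ s', D.Fam E T s' ∧ D.Covers S σ z lam s'

/-- The slots below `Z` are the same in both states. -/
def SameBelow (Z : ℕ) (σ σ' : St Var) : Prop :=
  ∀ z : ℕ, z < Z → σ'.arr 1 z = σ.arr 1 z ∧ σ'.arr 2 z = σ.arr 2 z

theorem SameBelow.trans {Z Z' : ℕ} {σ σ₁ σ₂ : St Var} (h : SameBelow Z σ σ₁)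
    (h' : SameBelow Z' σ₁ σ₂) (hZ : Z ≤ Z') : SameBelow Z σ σ₂ := fun z hz =>
  ⟨((h' z (hz.trans_le hZ)).1).trans (h z hz).1, ((h' z (hz.trans_le hZ)).2).trans (h z hz).2⟩

theorem Done.mono {Z Z' : ℕ} {σ σ' : St Var} (h : D.Done E S σ Z T) (hZ : Z ≤ Z')
    (hs : SameBelow Z σ σ') : D.Done E S σ' Z' T := fun s hs' lam hl => by
  obtain ⟨z, hz, s', hs'', hc⟩ := h s hs' lam hl
  exact ⟨z, hz.trans_le hZ, s', hs'', hc.congr (hs z hz).1 (hs z hz).2⟩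

theorem Table.of_eq {Z : ℕ} {σ σ' : St Var} (h : D.Table S Z σ) (h1 : σ'.arr 1 = σ.arr 1)
    (h2 : σ'.arr 2 = σ.arr 2) (hZ : σ'.reg .Z = σ.reg .Z) : D.Table S Z σ' :=
  ⟨hZ.trans h.reg_Z, fun z hz => (h.ok z hz).congr (by rw [h1]) (by rw [h2]),
    by rw [h1, h2]; exact h.empty⟩

theorem NewtonPost.sameBelow {σ σ' : St Var} {Z : ℕ} (h : D.NewtonPost E S T sg σ Z σ') :
    SameBelow Z σ σ' := fun z hz => h.other z (by exact_mod_cast hz.ne) (by omega)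

theorem NewtonPost.table {σ σ' : St Var} {Z : ℕ} (h : D.NewtonPost E S T sg σ Z σ')
    (ht : D.Table S Z σ) (hZ : σ'.reg .Z = ((Z + 2 : ℕ) : ℤ)) : D.Table S (Z + 2) σ' := by
  refine ⟨hZ, fun z hz => ?_, fun z hz j => ?_⟩
  · rcases lt_or_ge z Z with h' | h'
    · exact (ht.ok z h').congr (h.sameBelow z h').1 (h.sameBelow z h').2
    · obtain rfl | rfl : z = Z ∨ z = Z + 1 := by omega
      exacts [h.fst, h.snd]
  · push_cast at hz
    rw [(h.other z (by omega) (by omega)).1, (h.other z (by omega) (by omega)).2]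
    exact ht.empty z (by omega) j

/-- The first round has `sg = 1` and covers the sets with `∑ b ≤ 0`; the second has `sg = -1` and
covers those with `∑ b ≥ 0`. Each round takes two slots. -/
theorem level_spec (hP : D.Params E S u) (hIT : D.IterBound E S IT) {σ : St Var} {z b l : ℕ}
    (hB : D.Base E S σ) (hb : σ.reg .base = b) (hl : σ.reg .lev = l) (hu : b * (E + l) ≤ u)
    (hz : z + 4 ≤ u) (ht : D.Table S z σ) :
    Tr u Prog.level (2 * ((IT + 1) * (stepTime D.n E + 5) + 60) + 30) σ fun σ' =>
      D.Table S (z + 4) σ' ∧ SameBelow z σ σ' ∧ D.Done E S σ' (z + 4) (b * (E + l)) := by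
  have hu2 : 2 ≤ u := by omega
  have hBT : (b : ℤ) * (E + l) ≤ u := by exact_mod_cast hu
  refine Tr.of_wp (Wp.seq (Wp.set (by simp) ?_ <| Wp.of_tr (Tr.loop (N := 2)
    (T := (IT + 1) * (stepTime D.n E + 5) + 40) (fun k σ₁ => D.Table S (z + 2 * k) σ₁ ∧
      SameBelow z σ σ₁ ∧ ∀ sg' : ℤ, (sg' = 1 ∧ 1 ≤ k ∨ sg' = -1 ∧ 2 ≤ k) →
      ∀ s, D.Fam E (b * (E + l)) s → sg' * ∑ i ∈ s, D.b i ≤ 0 → ∀ lam, D.Feas lam s →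
      ∃ z' < z + 2 * k, ∃ s', D.Fam E (b * (E + l)) s' ∧ D.Covers S σ₁ z' lam s')
    (by decide) rfl rfl ?_ hu2 ?_ ?_ (fun σ₁ h _ => h)) fun t ht' σ' hF h => ?_))
  · simp [hb, hB.reg_E, hl]
    exact ⟨by linarith [show (0 : ℤ) ≤ b * (E + l) by positivity], hBT⟩
  · simp [hB.reg_two]
  · exact ⟨ht.of_eq rfl rfl (by simp), fun _ _ => ⟨rfl, rfl⟩, fun sg' h => by omega⟩
  · rintro k hk σ₁ ⟨h1, h2, h3⟩ hkv hF
    have hB1 := (hB.of_frame (Frame.set _ _ _) (by decide) rfl).of_frame hF (by decide) rfl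
    have hT1 : σ₁.reg .T = ((b * (E + l) : ℕ) : ℤ) := by
      rw [hF.reg _ rfl]; simp [hb, hB.reg_E, hl]
    have hsg1 : |(1 - 2 * k : ℤ)| = 1 := by interval_cases k <;> simp
    refine Tr.of_wp (Wp.seq (Wp.set (by simp) ?_ ?_))
    · simp [hkv]; omega
    refine Wp.of_tr (newton_spec hP hIT (T := b * (E + l)) (sg := 1 - 2 * k) (z := z + 2 * k)
      (hB1.of_frame (Frame.set _ _ _) (by decide) rfl) (by simpa using hT1) (by simp [hkv]) hsg1
      (by simpa using h1.reg_Z) (by omega) (fun j => (h1.empty _ le_rfl j).1)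
      (fun j => (h1.empty _ (by push_cast; omega) j).1)) ?_
    rintro t' ht' σ₂ - ⟨hZ, hp⟩
    refine ⟨?_, Table.of_eq (σ := σ₂) (hp.table (h1.of_eq rfl rfl (by simp)) hZ) rfl rfl (by simp),
      (h2.trans hp.sameBelow (by omega) :), ?_⟩
    · simp; omega
    intro sg' hsg' s hs hbs lam hlam
    by_cases hnew : sg' = 1 - 2 * k
    · obtain ⟨z', s', hz', hs', hc⟩ := hp.cover s hs (hnew ▸ hbs) lam hlam
      exact ⟨z', by omega, s', hs', hc.congr rfl rfl⟩
    · obtain ⟨z', hz', s', hs', hc⟩ := h3 sg' (by omega) s hs hbs lam hlam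
      exact ⟨z', by omega, s', hs', hc.congr (hp.sameBelow z' hz').1 (hp.sameBelow z' hz').2⟩
  · refine ⟨?_, h.1, (h.2.1 :), fun s hs lam hlam => ?_⟩
    · simp; omega
    · rcases le_total (∑ i ∈ s, D.b i) 0 with hc | hc
      · exact h.2.2 1 (by simp) s hs (by simpa using hc) lam hlam
      · exact h.2.2 (-1) (by simp) s hs (by simpa using hc) lam hlam

/-- A bound for the running time of the levels of a single scale. -/
def scaleTime (n E IT : ℕ) : ℕ := E * (2 * ((IT + 1) * (stepTime n E + 5) + 60) + 50) + 40

/-- The base profit doubles from `p k` until it exceeds `n * p k`, which takes at most `log n + 1`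
rounds. Each round fills `4 * E` slots: `E` levels, two directions, two slots. -/
theorem scales_spec (hP : D.Params E S u) (hIT : D.IterBound E S IT) {σ : St Var} {z k : ℕ}
    (hk : k < D.n) (hB : D.Base E S σ) (hkv : σ.reg .k = k)
    (hz : z + 4 * E * (Nat.log 2 D.n + 1) ≤ u) (ht : D.Table S z σ) :
    Tr u Prog.scales ((Nat.log 2 D.n + 1) * scaleTime D.n E IT + 40) σ fun σ' =>
      ∃ z' ≤ z + 4 * E * (Nat.log 2 D.n + 1), z ≤ z' ∧ D.Table S z' σ' ∧ SameBelow z σ σ' ∧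
      ∀ i l : ℕ, 2 ^ i ≤ D.n → l < E → D.Done E S σ' z' (2 ^ i * D.p k * (E + l)) := by
  have hn := hP.n_le
  have hpk := hP.p_pos k hk
  have hE := hP.E_ge
  have hn1 := hP.n_pos
  have hpu : 40 * D.n * E * D.p k ≤ u := by
    refine le_trans ?_ hP.u_ge'
    have h1 : D.p k ≤ ∑ i ∈ Finset.range D.n, D.p i :=
      Finset.single_le_sum (f := D.p) (fun _ _ => Nat.zero_le _) (Finset.mem_range.2 hk)
    have h2 : D.n ≤ D.n ^ 2 := Nat.le_self_pow (by norm_num) _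
    have h3 : E ≤ E ^ 2 := Nat.le_self_pow (by norm_num) _
    gcongr; omega
  have hEu : E ≤ u := by
    refine le_trans ?_ hpu
    calc E = 1 * E * 1 := by ring
      _ ≤ (40 * D.n) * E * D.p k := by gcongr <;> omega
  have hnpu : D.n * D.p k * 40 ≤ u := by
    refine le_trans ?_ hpu
    calc D.n * D.p k * 40 = 40 * D.n * 1 * D.p k := by ring
      _ ≤ _ := by gcongr; omega
  have hpu1 : D.p k ≤ D.n * D.p k := Nat.le_mul_of_pos_left _ hn1
  have hnpz : (D.n : ℤ) * D.p k * 40 ≤ u := by exact_mod_cast hnpu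
  refine Tr.of_wp (Wp.seq (Wp.set (by simp [hkv]; omega) ?_ <| Wp.seq <| Wp.set (by simp) ?_ <|
    Wp.of_tr (Tr.loopWhile (T := scaleTime D.n E IT - 10)
      (fun m σ' => ∃ j : ℕ, m + j = Nat.log 2 D.n + 1 ∧ D.Base E S σ' ∧
        σ'.reg .top = ((D.n * D.p k : ℕ) : ℤ) ∧
        σ'.reg .base = ((2 ^ j * D.p k : ℕ) : ℤ) ∧ 2 ^ j ≤ 2 * D.n ∧ D.Table S (z + 4 * E * j) σ' ∧
        SameBelow z σ σ' ∧
        ∀ i l : ℕ, i < j → l < E → D.Done E S σ' (z + 4 * E * j) (2 ^ i * D.p k * (E + l)))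
      (Nat.log 2 D.n + 1) ?_ (fun _ _ _ => by simp) ?_
      (fun m σ' h he => (?_ : ∃ z' ≤ z + 4 * E * (Nat.log 2 D.n + 1), z ≤ z' ∧ D.Table S z' σ' ∧
        SameBelow z σ σ' ∧ ∀ i l : ℕ, 2 ^ i ≤ D.n → l < E →
          D.Done E S σ' z' (2 ^ i * D.p k * (E + l)))))
      fun t ht σ' hF h => ⟨?_, h⟩))
  · have := hB.raw_p k hk
    simp [hkv, this]; omega
  · have := hB.raw_p k hk
    simp [hkv, this, hB.reg_n]; omega
  · have := hB.raw_p k hk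
    refine ⟨0, rfl, (hB.of_frame (Frame.set _ _ _) (by decide) rfl).of_frame (Frame.set _ _ _)
      (by decide) rfl, ?_, ?_, by omega, ht.of_eq rfl rfl (by simp), fun _ _ => ⟨rfl, rfl⟩,
      fun i l hi => by omega⟩
    · simp [hkv, this, hB.reg_n]
    · simp [hkv, this]
  · rintro m σ₁ ⟨j, hm, hB1, htop, hbase, hj, ht1, hs1, hd1⟩ he
    simp only [Ex.eval_sub, Ex.eval_add, Ex.eval_var, Ex.eval_ofNat, htop, hbase] at he
    have hjn : 2 ^ j ≤ D.n := by
      have : 2 ^ j * D.p k ≤ D.n * D.p k := by zify; push_cast at he ⊢; linarith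
      exact Nat.le_of_mul_le_mul_right this hpk
    have hjl : j ≤ Nat.log 2 D.n := Nat.le_log_of_pow_le (by norm_num) hjn
    have hzj : z + 4 * E * (j + 1) ≤ u := by
      refine le_trans ?_ hz; gcongr
    have hbu : 2 ^ j * D.p k ≤ D.n * D.p k := by gcongr
    refine Tr.of_wp (Wp.seq (Wp.of_tr (Tr.loop (N := E)
      (T := 2 * ((IT + 1) * (stepTime D.n E + 5) + 60) + 30) (fun l σ₂ =>
        D.Table S (z + 4 * E * j + 4 * l) σ₂ ∧ SameBelow (z + 4 * E * j) σ₁ σ₂ ∧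
        ∀ l' < l, D.Done E S σ₂ (z + 4 * E * j + 4 * l) (2 ^ j * D.p k * (E + l')))
      (by decide) rfl rfl hB1.reg_E hEu ?_ ?_ (fun σ₂ h _ => h)) fun t ht' σ₂ hF₂ h₂ => ?_))
    · exact ⟨ht1.of_eq rfl rfl (by simp), fun _ _ => ⟨rfl, rfl⟩, fun l hl => by omega⟩
    · rintro l hl σ₂ ⟨h1, h2, h3⟩ hlv hF₂
      have e4 : 4 * E * (j + 1) = 4 * E * j + 4 * E := by ring
      refine (level_spec hP hIT (hB1.of_frame hF₂ (by decide) rfl) (b := 2 ^ j * D.p k)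
        (by rw [hF₂.reg _ rfl, hbase]) hlv ?_ (by omega) h1).mono le_rfl ?_
      · refine le_trans ?_ hpu
        calc 2 ^ j * D.p k * (E + l) ≤ D.n * D.p k * (40 * E) := by gcongr; omega
          _ = _ := by ring
      · rintro σ₃ - ⟨g1, g2, g3⟩
        refine ⟨g1.of_eq rfl rfl (by simp), (h2.trans g2 (by omega) :), fun l' hl' => ?_⟩
        rcases Nat.lt_succ_iff_lt_or_eq.1 hl' with h | rfl
        · exact (h3 l' h).mono (by omega) g2
        · exact g3.mono (by omega) (fun _ _ => ⟨rfl, rfl⟩)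
    · obtain ⟨g1, g2, g3⟩ := h₂
      have hbase₂ : σ₂.reg .base = ((2 ^ j * D.p k : ℕ) : ℤ) := by rw [hF₂.reg _ rfl, hbase]
      have e4 : z + 4 * E * (j + 1) = z + 4 * E * j + 4 * E := by ring
      refine Wp.set (by simp) ?_ ⟨?_, m - 1, by omega, j + 1, by omega, ?_, ?_, ?_, ?_, ?_, ?_, ?_⟩
      · simp only [Ex.eval_add, Ex.eval_var, hbase₂]; omega
      · have := Nat.mul_le_mul_left E (show 2 * ((IT + 1) * (stepTime D.n E + 5) + 60) + 30 + 14 ≤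
          2 * ((IT + 1) * (stepTime D.n E + 5) + 60) + 50 by omega)
        simp [scaleTime]; omega
      · exact (hB1.of_frame hF₂ (by decide) rfl).of_frame (Frame.set _ _ _) (by decide) rfl
      · simp [hF₂.reg .top rfl, htop]
      · simp [hbase₂]; ring
      · rw [pow_succ]; omega
      · rw [e4]; exact g1.of_eq rfl rfl (by simp)
      · exact (hs1.trans g2 (by omega) :)
      · intro i l hi hl
        rw [e4]
        rcases Nat.lt_succ_iff_lt_or_eq.1 hi with h | rfl
        · exact (hd1 i l h hl).mono (by omega) g2
        · exact (g3 l hl).mono (by omega) (fun _ _ => ⟨rfl, rfl⟩)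
  · obtain ⟨j, hm, hB1, htop, hbase, hj, ht1, hs1, hd1⟩ := h
    simp only [Ex.eval_sub, Ex.eval_add, Ex.eval_var, Ex.eval_ofNat, htop, hbase] at he
    refine ⟨_, ?_, by omega, ht1, hs1, fun i l hi hl => hd1 i l ?_ hl⟩
    · gcongr; omega
    · by_contra! hcon
      have h1 : 2 ^ j ≤ 2 ^ i := Nat.pow_le_pow_right (by norm_num) hcon
      have h2 : 2 ^ j * D.p k ≤ D.n * D.p k := by gcongr; omega
      zify at h2
      push_cast at he
      linarith
  · have e5 : scaleTime D.n E IT - 10 + ((Ex.var Var.top + 1 - Ex.var Var.base).size + 3) =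
        scaleTime D.n E IT := by
      simp [scaleTime]
    rw [e5] at ht
    simp at ht ⊢; omega

end Items

/-! ### Initialisation and the approximation quality of the records. -/

namespace Items
variable {D : Items} {E S u T IT : ℕ} {num den sg : ℤ}

variable (D) in
/-- The raw memory holds the input. -/
structure Input (eN eD : ℤ) (σ : St Var) : Prop where
  raw_n : σ.raw 0 = D.n
  raw_W : σ.raw 1 = D.W
  raw_num : σ.raw 2 = eN
  raw_den : σ.raw 3 = eD
  raw_p : ∀ i : ℕ, i < D.n → σ.raw (4 + i) = D.p i
  raw_a : ∀ i : ℕ, i < D.n → σ.raw (4 + D.n + i) = D.a i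
  raw_b : ∀ i : ℕ, i < D.n → σ.raw (4 + 2 * D.n + i) = D.b i

theorem init_spec (hP : D.Params E S u) {eN eD : ℤ} {σ : St Var} (hI : D.Input eN eD σ)
    (hE : 2 * eD / eN + 1 = E) :
    Tr u Prog.init (D.n * 100 + 150) σ (D.Base E S) := by
  have hn := hP.n_le
  have hS := hP.S_le
  have hS3 := hP.S3_le
  have hQ := hP.Q1_le
  have hE3 := hP.E_ge
  have hSp : (1 : ℤ) ≤ S := by exact_mod_cast hP.S_pos
  have hn1 := hP.n_pos
  have hEu : E ≤ u := by
    have h1 : E - 1 ≤ D.n * (E - 1) := Nat.le_mul_of_pos_left _ hn1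
    omega
  -- The partial sums that lead to `S` never exceed `S`, so they respect the bound on stored
  -- integers.
  have hpart : ∀ k ≤ D.n, (0 : ℤ) ≤ D.W + 1 + ∑ i ∈ Finset.range k, (D.a i * D.a i + D.b i * D.b i) ∧
      D.W + 1 + ∑ i ∈ Finset.range k, (D.a i * D.a i + D.b i * D.b i) ≤ (S : ℤ) := by
    intro k hk
    have h0 : ∀ i ∈ Finset.range D.n, 0 ≤ D.a i * D.a i + D.b i * D.b i := fun i _ =>
      add_nonneg (mul_self_nonneg _) (mul_self_nonneg _)
    have hsub := Finset.range_subset_range.2 hk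
    have h1 := Finset.sum_le_sum_of_subset_of_nonneg hsub fun i hi _ => h0 i hi
    have h2 := Finset.sum_nonneg fun i hi => h0 i (hsub hi)
    have h3 := hP.S_eq
    constructor <;> linarith
  have hW := hP.W_le
  refine Tr.of_wp (Wp.seq (Wp.set (by simp) ?_ <| Wp.seq <| Wp.set (by simp) ?_ <|
    Wp.seq <| Wp.set (by simp) ?_ <| Wp.seq <| Wp.set (by simp) ?_ <|
    Wp.seq <| Wp.of_tr (Tr.loop (N := D.n) (T := 60) (fun k σ₁ => σ₁.reg .S =
      D.W + 1 + ∑ i ∈ Finset.range k, (D.a i * D.a i + D.b i * D.b i))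
      (by decide) rfl rfl ?_ (by omega) ?_ ?_ (fun σ₁ h _ => h)) fun t ht σ₁ hF h => ?_))
  · simp [hI.raw_n]; omega
  · simp [hI.raw_W]; omega
  · simp [hI.raw_num, hI.raw_den, hE]; omega
  · simp [hI.raw_W]; omega
  · simp [hI.raw_n]
  · simp [hI.raw_W]
  · intro k hk σ₁ h hkv hF
    have e1 : σ₁.raw = σ.raw := hF.raw rfl
    have e2 : σ₁.reg .n = D.n := by rw [hF.reg _ rfl]; simp [hI.raw_n]
    have e3 : (Ex.var Var.S + Ex.raw (4 + Ex.var Var.n + Ex.var Var.i) * Ex.raw (4 + Ex.var Var.n + Ex.var Var.i) +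
        Ex.raw (4 + 2 * Ex.var Var.n + Ex.var Var.i) * Ex.raw (4 + 2 * Ex.var Var.n + Ex.var Var.i)).eval σ₁ =
        D.W + 1 + ∑ i ∈ Finset.range (k + 1), (D.a i * D.a i + D.b i * D.b i) := by
      simp [e1, e2, hkv, hI.raw_a k hk, hI.raw_b k hk, h, Finset.sum_range_succ]
      ring
    refine Tr.of_wp (Wp.set ?_ ?_ ⟨?_, ?_⟩)
    · simp [e2, hkv]; omega
    · rw [e3]
      have := hpart (k + 1) hk
      constructor <;> linarith
    · simp
    · simp only [St.set_reg]
      rw [if_neg (by decide), if_pos trivial, e3]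
  · have e1 : σ₁.raw = σ.raw := hF.raw rfl
    have e2 : σ₁.reg .n = D.n := by rw [hF.reg _ rfl]; simp [hI.raw_n]
    have e3 : σ₁.reg .E = E := by rw [hF.reg _ rfl]; simp [hI.raw_num, hI.raw_den, hE]
    have e4 : σ₁.reg .W = D.W := by rw [hF.reg _ rfl]; simp [hI.raw_W]
    have e5 : σ₁.reg .S = S := by rw [h, hP.S_eq]
    have e6 : (D.n : ℤ) * (E - 1) + 1 = ((D.n * (E - 1) + 1 : ℕ) : ℤ) := by
      rw [Nat.cast_add, Nat.cast_mul, Nat.cast_sub (by omega)]; simp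
    have e7 : (S : ℤ) * S * S = S ^ 3 := by ring
    have hS30 : (0 : ℤ) ≤ (S : ℤ) ^ 3 := by positivity
    refine Wp.seq (Wp.set (by simp) ?_ <| Wp.seq <| Wp.set (by simp) ?_ <| Wp.set (by simp) ?_
      ⟨?_, ?_⟩)
    · simp only [Ex.eval_add, Ex.eval_mul, Ex.eval_sub, Ex.eval_var, Ex.eval_ofNat, e2, e3]
      rw [show (((1 : ℕ) : ℤ)) = 1 from rfl, e6]; omega
    · simp [e5, e7]; constructor <;> linarith
    · simp; omega
    · simp; omega
    · refine ⟨by simp [e2], by simp [e4], by simp [e3], by simp [e5], ?_, by simp [e5, e7], by simp,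
        ?_, ?_, ?_⟩
      · rw [← e6]; simp [e2, e3]
      all_goals simp only [St.set_raw, e1]
      exacts [hI.raw_p, hI.raw_a, hI.raw_b]

/-- The records are computed by the first part of the program. -/
theorem records_spec (hP : D.Params E S u) (hIT : D.IterBound E S IT) {eN eD : ℤ} {σ : St Var}
    (hI : D.Input eN eD σ) (hE : 2 * eD / eN + 1 = E) (hZ : σ.reg .Z = 0)
    (h1 : ∀ z j, σ.arr 1 z j = 0) (h2 : ∀ z j, σ.arr 2 z j = 0)
    (hu : D.n * (4 * E * (Nat.log 2 D.n + 1)) ≤ u) :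
    Tr u (.seq Prog.init (.loop .k .n Prog.scales))
      (D.n * ((Nat.log 2 D.n + 1) * scaleTime D.n E IT + 154) + 170) σ fun σ' =>
      D.Base E S σ' ∧ ∃ Z ≤ D.n * (4 * E * (Nat.log 2 D.n + 1)), D.Table S Z σ' ∧
      ∀ k i l : ℕ, k < D.n → 2 ^ i ≤ D.n → l < E → D.Done E S σ' Z (2 ^ i * D.p k * (E + l)) := by
  have hn := hP.n_le
  refine Tr.of_wp (Wp.seq (Wp.of_tr (init_spec hP hI hE) fun t ht σ₁ hF hB => ?_))
  have a1 := hF.arr 1 rfl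
  have a2 := hF.arr 2 rfl
  refine Wp.of_tr (Tr.loop (N := D.n) (T := (Nat.log 2 D.n + 1) * scaleTime D.n E IT + 40)
    (fun k σ₂ => ∃ Z ≤ k * (4 * E * (Nat.log 2 D.n + 1)), D.Table S Z σ₂ ∧
      ∀ k' i l : ℕ, k' < k → 2 ^ i ≤ D.n → l < E →
        D.Done E S σ₂ Z (2 ^ i * D.p k' * (E + l))) (by decide) rfl rfl hB.reg_n (by omega) ?_ ?_
    (fun σ₂ h hF₂ => (⟨hB.of_frame hF₂ (by decide) rfl, h⟩ : D.Base E S σ₂ ∧ _)))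
    fun t' ht' σ₂ _ h => ⟨?_, h⟩
  · refine ⟨0, by simp, ⟨?_, by simp, fun z _ j => ?_⟩, by simp⟩
    · simp [hF.reg .Z rfl, hZ]
    · simp [a1, a2, h1, h2]
  · rintro k hk σ₂ ⟨Z, hZ, ht2, hd⟩ hkv hF₂
    have e : (k + 1) * (4 * E * (Nat.log 2 D.n + 1)) =
      k * (4 * E * (Nat.log 2 D.n + 1)) + 4 * E * (Nat.log 2 D.n + 1) := by ring
    have hle : (k + 1) * (4 * E * (Nat.log 2 D.n + 1)) ≤ D.n * (4 * E * (Nat.log 2 D.n + 1)) := by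
      gcongr; omega
    refine (scales_spec hP hIT hk (hB.of_frame hF₂ (by decide) rfl) hkv (by omega) ht2).mono le_rfl
      ?_
    rintro σ₃ - ⟨Z', hZ', hZZ, ht3, hs, hd'⟩
    refine ⟨Z', by omega, ht3.of_eq rfl rfl (by simp), fun k' i l hk' hi hl => ?_⟩
    rcases Nat.lt_succ_iff_lt_or_eq.1 hk' with h | rfl
    · exact (hd k' i l h hi hl).mono hZZ hs
    · exact (hd' i l hi hl).mono le_rfl (fun _ _ => ⟨rfl, rfl⟩)
  · have : D.n * ((Nat.log 2 D.n + 1) * scaleTime D.n E IT + 40 + 14) + D.n * 100 =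
      D.n * ((Nat.log 2 D.n + 1) * scaleTime D.n E IT + 154) := by ring
    omega

/-- A set that reaches the target profit of level `T` belongs to the family of level `T`. -/
theorem fam_of_le {s : Finset ℕ} (hs : s ⊆ Finset.range D.n) (hT : 0 < T)
    (h : T ≤ (∑ k ∈ s, D.p k) * E) : D.Fam E T s := by
  refine ⟨hs, ?_⟩
  -- Rounding down loses at most 1 scaled unit per item, hence at most `n` in all. This is why the
  -- family asks for `n * (E - 1)` instead of `n * E`.
  have h1 : (∑ k ∈ s, D.p k) * (D.n * E * E) ≤ T * (∑ k ∈ s, D.scaled E T k + s.card) := by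
    have e : T * s.card = ∑ _k ∈ s, T := by simp [mul_comm]
    rw [Finset.sum_mul, mul_add, Finset.mul_sum, e, ← Finset.sum_add_distrib]
    refine Finset.sum_le_sum fun k _ => ?_
    have := Nat.div_add_mod (D.p k * D.n * E * E) T
    have h2 := Nat.mod_lt (D.p k * D.n * E * E) hT
    have e : D.p k * (D.n * E * E) = D.p k * D.n * E * E := by ring
    rw [e]
    unfold scaled
    omega
  have h2 : s.card ≤ D.n := by simpa using Finset.card_le_card hs
  have h3 : T * (D.n * E) ≤ T * (∑ k ∈ s, D.scaled E T k + s.card) := by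
    refine le_trans ?_ h1
    calc T * (D.n * E) ≤ (∑ k ∈ s, D.p k) * E * (D.n * E) := by gcongr
      _ = _ := by ring
  have h4 := Nat.le_of_mul_le_mul_left h3 hT
  have h5 : D.n * (E - 1) + D.n = D.n * E ∨ E = 0 := by
    rcases Nat.eq_zero_or_pos E with h | h
    · exact Or.inr h
    · left; rw [← Nat.mul_succ]; congr 1; omega
  rcases h5 with h5 | rfl
  · omega
  · simp

/-- The sets of the family of level `T` almost reach the target profit. -/
theorem Fam.le {s : Finset ℕ} (h : D.Fam E T s) (hn : 0 < D.n) :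
    T * (E - 1) ≤ (∑ k ∈ s, D.p k) * E ^ 2 := by
  refine Nat.le_of_mul_le_mul_left (c := D.n) ?_ hn
  calc D.n * (T * (E - 1)) = T * (D.n * (E - 1)) := by ring
    _ ≤ T * ∑ k ∈ s, D.scaled E T k := by gcongr; exact h.2
    _ ≤ ∑ k ∈ s, D.p k * D.n * E * E := by
      rw [Finset.mul_sum]
      exact Finset.sum_le_sum fun k _ => Nat.mul_div_le _ _
    _ = _ := by simp only [← Finset.sum_mul]; ring

/-- Let `k` be the most profitable item of `s`. The profit `P` of `s` lies between `p k` and `n * p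
k`, hence in some `[B, 2 * B)` with `B = 2 ^ i * p k`. The largest target `B * (E + l) / E` that
does not exceed `P` has `l < E`. The target loses a factor `E / (E + 1)` and the rounding of profits
a factor `(E - 1) / E`. -/
theorem exists_covers (hP : D.Params E S u) {σ : St Var} {Z : ℕ}
    (hd : ∀ k i l : ℕ, k < D.n → 2 ^ i ≤ D.n → l < E →
      D.Done E S σ Z (2 ^ i * D.p k * (E + l)))
    {s : Finset ℕ} (hs : s ⊆ Finset.range D.n) (hne : s.Nonempty) {lam : ℝ} (hl : D.Feas lam s) :
    ∃ z < Z, ∃ s', D.Covers S σ z lam s' ∧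
      (∑ k ∈ s, D.p k) * (E - 1) ≤ (∑ k ∈ s', D.p k) * (E + 1) := by
  obtain ⟨k, hk, hmax⟩ := s.exists_max_image D.p hne
  have hkn : k < D.n := Finset.mem_range.1 (hs hk)
  have hpk := hP.p_pos k hkn
  have hE := hP.E_ge
  set P := ∑ k ∈ s, D.p k with hPd
  have h1 : D.p k ≤ P := Finset.single_le_sum (f := D.p) (fun _ _ => Nat.zero_le _) hk
  have h2 : P ≤ D.n * D.p k := by
    refine (Finset.sum_le_card_nsmul s D.p (D.p k) hmax).trans ?_
    rw [smul_eq_mul]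
    gcongr
    simpa using Finset.card_le_card hs
  set i := Nat.log 2 (P / D.p k) with hi
  have h3 : P / D.p k ≠ 0 := (Nat.div_pos h1 hpk).ne'
  have h4 : 2 ^ i ≤ P / D.p k := Nat.pow_log_le_self 2 h3
  have h5 : P / D.p k < 2 ^ (i + 1) := Nat.lt_pow_succ_log_self (by norm_num) _
  have h6 : 2 ^ i * D.p k ≤ P := (Nat.le_div_iff_mul_le hpk).1 h4
  have h7 : P < 2 * (2 ^ i * D.p k) := by
    have := (Nat.div_lt_iff_lt_mul hpk).1 h5
    rw [pow_succ] at this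
    linarith
  have h8 : 2 ^ i ≤ D.n := h4.trans (Nat.div_le_of_le_mul (by rw [mul_comm]; exact h2))
  set B := 2 ^ i * D.p k with hB
  have hBpos : 0 < B := by positivity
  obtain ⟨m, hm⟩ : ∃ m, m = P * E / B := ⟨_, rfl⟩
  have h9 : B * m ≤ P * E := hm ▸ Nat.mul_div_le _ _
  have h10 : P * E < B * (m + 1) := hm ▸ Nat.lt_mul_div_succ _ hBpos
  have h11 : E ≤ m := hm ▸ (Nat.le_div_iff_mul_le hBpos).2 (by rw [mul_comm]; gcongr)
  have h12 : m < 2 * E := hm ▸ (Nat.div_lt_iff_lt_mul hBpos).2 (by nlinarith)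
  obtain ⟨l, rfl⟩ : ∃ l, m = E + l := ⟨m - E, by omega⟩
  have hfam : D.Fam E (B * (E + l)) s := fam_of_le hs (by positivity) h9
  obtain ⟨z, hz, s', hs', hc⟩ := hd k i l hkn h8 (by omega) s hfam lam hl
  refine ⟨z, hz, s', hc, ?_⟩
  have h13 := hs'.le hP.n_pos
  refine Nat.le_of_mul_le_mul_right (c := E ^ 2) ?_ (by positivity)
  -- `P` is less than the next target `B * (E + l + 1) / E`, and consecutive targets differ by a
  -- factor of at most `(E + 1) / E`.
  have h14 : P * E ^ 2 ≤ B * (E + l) * (E + 1) := by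
    calc P * E ^ 2 = P * E * E := by ring
      _ ≤ B * (E + l + 1) * E := by gcongr
      _ = B * (E + l) * E + B * E := by ring
      _ ≤ B * (E + l) * E + B * (E + l) := by gcongr
      _ = _ := by ring
  calc P * (E - 1) * E ^ 2 = P * E ^ 2 * (E - 1) := by ring
    _ ≤ B * (E + l) * (E + 1) * (E - 1) := by gcongr
    _ = B * (E + l) * (E - 1) * (E + 1) := by ring
    _ ≤ (∑ k ∈ s', D.p k) * E ^ 2 * (E + 1) := by gcongr
    _ = _ := by ring

end Items

/-! ### Searching the records for breakpoints and best sets. -/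

namespace Items
variable {D : Items} {E S u T IT : ℕ} {num den sg : ℤ}

theorem Table.bounds (hP : D.Params E S u) {σ : St Var} {Z : ℕ} (h : D.Table S Z σ) {z : ℕ}
    (hz : z < Z) : |σ.arr 1 z 0| ≤ u ∧ 0 ≤ σ.arr 1 z 1 ∧ σ.arr 1 z 1 ≤ u ∧
      (σ.arr 1 z 1 = 0 → σ.arr 1 z 0 = 0) ∧ 0 ≤ σ.arr 1 z 2 ∧ σ.arr 1 z 2 ≤ u ∧
      |σ.arr 1 z 3| ≤ 1 := by
  have hS := hP.S_le
  rcases h.ok z hz with h | ⟨num, den, kd, s, h⟩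
  · have h0 := fun j => h j
    simp [h0]
  · have h1 := h.num_le
    have h2 := h.den_le
    have h3 := h.den_pos
    have h4 := hP.sum_p_le h.sub
    rw [h.num_eq, h.den_eq, h.profit, h.kind, h.kd_abs]
    exact ⟨by omega, by omega, by omega, by omega, by omega, by omega, le_rfl⟩

/-- Fractions are compared by cross multiplication; `-1 / 0` and `1 / 0` stand for the two
infinities. An unused slot reads `0 / 0` and never passes the strict test. -/
theorem nextValue_spec (hP : D.Params E S u) {σ : St Var} {Z : ℕ} {cn cd : ℤ}
    (ht : D.Table S Z σ) (hZ : Z ≤ u) (hcn : σ.reg .cn = cn) (hcd : σ.reg .cd = cd) :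
    Tr u Prog.nextValue (Z * 110 + 30) σ fun σ' => ∃ dn dd : ℤ, σ'.reg .dn = dn ∧
      σ'.reg .dd = dd ∧ 0 ≤ dd ∧ (dd = 0 → dn = 1) ∧
      (0 < dd → ∃ z < Z, σ.arr 1 z 0 = dn ∧ σ.arr 1 z 1 = dd ∧ cn * dd < dn * cd) ∧
      ∀ z < Z, 0 < σ.arr 1 z 1 → cn * σ.arr 1 z 1 < σ.arr 1 z 0 * cd →
        dn * σ.arr 1 z 1 ≤ σ.arr 1 z 0 * dd := by
  have hn := hP.n_le
  refine Tr.of_wp (Wp.seq (Wp.set (by simp) (by simp; omega) <| Wp.seq <|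
    Wp.set (by simp) (by simp) <| Wp.of_tr (Tr.loop (N := Z) (T := 96) (fun k σ₁ =>
      ∃ dn dd : ℤ, σ₁.reg .dn = dn ∧
      σ₁.reg .dd = dd ∧ 0 ≤ dd ∧ (dd = 0 → dn = 1) ∧
      (0 < dd → ∃ z < Z, σ.arr 1 z 0 = dn ∧ σ.arr 1 z 1 = dd ∧ cn * dd < dn * cd) ∧
      ∀ z < k, 0 < σ.arr 1 z 1 → cn * σ.arr 1 z 1 < σ.arr 1 z 0 * cd →
        dn * σ.arr 1 z 1 ≤ σ.arr 1 z 0 * dd) (by decide) rfl rfl ?_ hZ ?_ ?_ (fun σ₁ h _ => h))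
        fun t ht σ' hF h => ⟨?_, h⟩))
  · simp [ht.reg_Z]
  · exact ⟨1, 0, by simp, by simp, le_rfl, fun _ => rfl, by simp, by simp⟩
  · rintro k hk σ₁ ⟨dn, dd, rdn, rdd, hdd, hdn, hex, hmin⟩ hkv hF
    obtain ⟨b1, b2, b3, b4, -⟩ := ht.bounds hP hk
    have a1 : σ₁.arr 1 = σ.arr 1 := hF.arr 1 rfl
    have c1 : σ₁.reg .cn = cn := by rw [hF.reg _ rfl]; simp [hcn]
    have c2 : σ₁.reg .cd = cd := by rw [hF.reg _ rfl]; simp [hcd]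
    have b1' := abs_le.1 b1
    have keep : ∀ σ' : St Var, σ'.reg .dn = σ₁.reg .dn → σ'.reg .dd = σ₁.reg .dd →
        (cn * σ.arr 1 k 1 < σ.arr 1 k 0 * cd → dn * σ.arr 1 k 1 ≤ σ.arr 1 k 0 * dd) →
        ∃ dn dd : ℤ, σ'.reg .dn = dn ∧ σ'.reg .dd = dd ∧ 0 ≤ dd ∧ (dd = 0 → dn = 1) ∧
        (0 < dd → ∃ z < Z, σ.arr 1 z 0 = dn ∧ σ.arr 1 z 1 = dd ∧ cn * dd < dn * cd) ∧
        ∀ z < k + 1, 0 < σ.arr 1 z 1 → cn * σ.arr 1 z 1 < σ.arr 1 z 0 * cd →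
          dn * σ.arr 1 z 1 ≤ σ.arr 1 z 0 * dd := by
      intro σ' e1 e2 h
      refine ⟨dn, dd, by rw [e1, rdn], by rw [e2, rdd], hdd, hdn, hex, fun z hz hz1 hz2 => ?_⟩
      rcases Nat.lt_succ_iff_lt_or_eq.1 hz with h' | rfl
      exacts [hmin z h' hz1 hz2, h hz2]
    have upd : ∀ σ' : St Var, σ'.reg .dn = σ.arr 1 k 0 → σ'.reg .dd = σ.arr 1 k 1 →
        cn * σ.arr 1 k 1 < σ.arr 1 k 0 * cd → σ.arr 1 k 0 * dd < dn * σ.arr 1 k 1 →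
        ∃ dn dd : ℤ, σ'.reg .dn = dn ∧ σ'.reg .dd = dd ∧ 0 ≤ dd ∧ (dd = 0 → dn = 1) ∧
        (0 < dd → ∃ z < Z, σ.arr 1 z 0 = dn ∧ σ.arr 1 z 1 = dd ∧ cn * dd < dn * cd) ∧
        ∀ z < k + 1, 0 < σ.arr 1 z 1 → cn * σ.arr 1 z 1 < σ.arr 1 z 0 * cd →
          dn * σ.arr 1 z 1 ≤ σ.arr 1 z 0 * dd := by
      intro σ' e1 e2 h1 h2
      have hfd : 0 < σ.arr 1 k 1 := by
        rcases b2.eq_or_lt with h | h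
        · rw [← h, b4 h.symm] at h1; simp at h1
        · exact h
      refine ⟨_, _, e1, e2, b2, fun h => absurd h hfd.ne', fun _ => ⟨k, hk, rfl, rfl, h1⟩, ?_⟩
      intro z hz hz1 hz2
      rcases Nat.lt_succ_iff_lt_or_eq.1 hz with h | rfl
      · have h3 := hmin z h hz1 hz2
        rcases hdd.eq_or_lt with h0 | h0
        · rw [← h0, hdn h0.symm] at h3; simp at h3; omega
        · refine le_of_mul_le_mul_right ?_ h0
          nlinarith
      · exact le_rfl
    clear hex hmin
    refine Tr.of_wp (Wp.seq (Wp.set ?_ ?_ <| Wp.seq <| Wp.set ?_ ?_ <| Wp.ite ?_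
      (fun h1 => Wp.ite ?_ (fun h2 => Wp.seq (Wp.set ?_ ?_ <| Wp.set ?_ ?_
          ⟨?_, upd _ ?_ ?_ ?_ ?_⟩))
        (fun h2 => Wp.skip ⟨?_, keep _ ?_ ?_ ?_⟩)) (fun h1 => Wp.skip ⟨?_, keep _ ?_ ?_ ?_⟩)))
    all_goals try simp [hkv, a1, c1, c2] at h1
    all_goals try simp [hkv, a1, rdn, rdd] at h2
    all_goals try simp [hkv, a1]
    all_goals omega
  · simp; omega

variable (D) in
/-- A record that is considered for the interval that ends in `dn / dd`. -/
def Eligible (S : ℕ) (σ : St Var) (dn dd : ℤ) (z : ℕ) (s : Finset ℕ) : Prop :=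
  ∃ num den kd, D.IsRec S σ z num den kd s ∧
    (kd = 1 ∧ num * dd < dn * den ∨ kd = -1 ∧ dn * den ≤ num * dd)

/-- As no end of a half-line lies strictly inside the interval, comparing the ends of the half-lines
with the right end of the interval decides which records are valid on it. -/
theorem findBest_spec (hP : D.Params E S u) {σ : St Var} {Z : ℕ} {dn dd : ℤ}
    (ht : D.Table S Z σ) (hZ : Z ≤ u) (hdn : σ.reg .dn = dn) (hdd : σ.reg .dd = dd) :
    Tr u Prog.findBest (Z * 150 + 40) σ fun σ' => ∃ (s : Finset ℕ) (best : ℕ), 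
      σ'.reg .best = best ∧ σ'.reg .bp = ((∑ k ∈ s, D.p k : ℕ) : ℤ) ∧ 
      (∀ i : ℕ, i < D.n → σ.arr 2 best i = if i ∈ s then 1 else 0) ∧
      (s = ∅ ∨ ∃ z < Z, D.Eligible S σ dn dd z s) ∧
      ∀ z < Z, ∀ s', D.Eligible S σ dn dd z s' → ∑ k ∈ s', D.p k ≤ ∑ k ∈ s, D.p k := by
  have hn := hP.n_le
  refine Tr.of_wp (Wp.seq (Wp.set (by simp) ?_ <| Wp.seq <|
    Wp.set (by simp) (by simp) <| Wp.of_tr (Tr.loop (N := Z) (T := 136) (fun k σ₁ =>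
      ∃ (s : Finset ℕ) (best : ℕ), 
      σ₁.reg .best = best ∧ σ₁.reg .bp = ((∑ k ∈ s, D.p k : ℕ) : ℤ) ∧ 
      (∀ i : ℕ, i < D.n → σ.arr 2 best i = if i ∈ s then 1 else 0) ∧
      (s = ∅ ∨ ∃ z < Z, D.Eligible S σ dn dd z s) ∧
      ∀ z < k, ∀ s', D.Eligible S σ dn dd z s' → ∑ k ∈ s', D.p k ≤ ∑ k ∈ s, D.p k)
      (by decide) rfl rfl ?_ hZ ?_ ?_ (fun σ₁ h _ => h)) fun t ht σ' hF h => ⟨?_, h⟩))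
  · simp [ht.reg_Z]; omega
  · simp [ht.reg_Z]
  · exact ⟨∅, Z, by simp [ht.reg_Z], by simp, fun i hi => by simp [ht.empty Z le_rfl i],
      Or.inl rfl, by simp⟩
  · rintro k hk σ₁ ⟨s, best, rbest, rbp, hbits, hel, hmax⟩ hkv hF
    obtain ⟨b1, b2, b3, b4, b5, b6, b7⟩ := ht.bounds hP hk
    have a1 : σ₁.arr 1 = σ.arr 1 := hF.arr 1 rfl
    have d1 : σ₁.reg .dn = dn := by rw [hF.reg _ rfl]; simp [hdn]
    have d2 : σ₁.reg .dd = dd := by rw [hF.reg _ rfl]; simp [hdd]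
    have b1' := abs_le.1 b1
    have b7' := abs_le.1 b7
    have keep : ∀ σ' : St Var, σ'.reg .best = σ₁.reg .best → σ'.reg .bp = σ₁.reg .bp →
        (∀ s', D.Eligible S σ dn dd k s' → ∑ k ∈ s', D.p k ≤ ∑ k ∈ s, D.p k) →
        ∃ (s : Finset ℕ) (best : ℕ), σ'.reg .best = best ∧
        σ'.reg .bp = ((∑ k ∈ s, D.p k : ℕ) : ℤ) ∧ 
        (∀ i : ℕ, i < D.n → σ.arr 2 best i = if i ∈ s then 1 else 0) ∧
        (s = ∅ ∨ ∃ z < Z, D.Eligible S σ dn dd z s) ∧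
        ∀ z < k + 1, ∀ s', D.Eligible S σ dn dd z s' → ∑ k ∈ s', D.p k ≤ ∑ k ∈ s, D.p k := by
      intro σ' e1 e2 h
      refine ⟨s, best, by rw [e1, rbest], by rw [e2, rbp], hbits, hel, fun z hz => ?_⟩
      rcases Nat.lt_succ_iff_lt_or_eq.1 hz with h' | rfl
      exacts [hmax z h', h]
    have bett : ∀ σ₂ : St Var, σ₂.reg .best = σ₁.reg .best → σ₂.reg .bp = σ₁.reg .bp →
        σ₂.reg .z = k → σ₂.arr 1 = σ.arr 1 → (∃ s', D.Eligible S σ dn dd k s') →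
        Wp u Prog.better σ₂ fun t σ' => t ≤ 50 ∧ ∃ (s : Finset ℕ) (best : ℕ),
        (σ'.set .z ((k + 1 : ℕ) : ℤ)).reg .best = best ∧
        (σ'.set .z ((k + 1 : ℕ) : ℤ)).reg .bp = ((∑ k ∈ s, D.p k : ℕ) : ℤ) ∧ 
        (∀ i : ℕ, i < D.n → σ.arr 2 best i = if i ∈ s then 1 else 0) ∧
        (s = ∅ ∨ ∃ z < Z, D.Eligible S σ dn dd z s) ∧
        ∀ z < k + 1, ∀ s', D.Eligible S σ dn dd z s' → ∑ k ∈ s', D.p k ≤ ∑ k ∈ s, D.p k := by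
      rintro σ₂ e1 e2 e3 e4 ⟨s', hs'⟩
      obtain ⟨num, den, kd, hrec, -⟩ := id hs'
      have hprof : ∀ s'', D.Eligible S σ dn dd k s'' → ∑ k ∈ s'', D.p k = ∑ k ∈ s', D.p k := by
        rintro s'' ⟨num', den', kd', hrec', -⟩
        have := hrec'.profit.symm.trans hrec.profit
        exact_mod_cast this
      refine Wp.ite (by simp [e3]) (fun h => Wp.seq (Wp.set (by simp [e3]) ?_ <|
        Wp.set (by simp) ?_ ⟨?_, ?_⟩)) (fun h => Wp.skip ⟨?_, keep _ ?_ ?_ ?_⟩)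
      all_goals simp [e1, e2, e3, e4, rbp, hrec.profit] at h
      case refine_4 =>
        refine ⟨s', k, by simp [e3], by simp [e3, e4, hrec.profit], hrec.bits,
          Or.inr ⟨k, hk, hs'⟩, fun z hz s'' hs'' => ?_⟩
        have hlt : ∑ k ∈ s, D.p k < ∑ k ∈ s', D.p k := by exact_mod_cast h
        rcases Nat.lt_succ_iff_lt_or_eq.1 hz with h' | rfl
        · exact (hmax z h' s'' hs'').trans hlt.le
        · exact (hprof s'' hs'').le
      case refine_8 =>
        intro s'' hs''
        rw [hprof s'' hs'']
        exact_mod_cast h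
      all_goals simp [e1, e2, e3, e4]
      all_goals omega
    have notel : ∀ s', D.Eligible S σ dn dd k s' → σ.arr 1 k 3 = 1 ∧
        σ.arr 1 k 0 * dd < dn * σ.arr 1 k 1 ∨ σ.arr 1 k 3 = -1 ∧
        dn * σ.arr 1 k 1 ≤ σ.arr 1 k 0 * dd := by
      rintro s' ⟨num, den, kd, hrec, h⟩
      rw [hrec.kind, hrec.num_eq, hrec.den_eq]; exact h
    have iseli : (σ.arr 1 k 3 = 1 ∧ σ.arr 1 k 0 * dd < dn * σ.arr 1 k 1 ∨ σ.arr 1 k 3 = -1 ∧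
        dn * σ.arr 1 k 1 ≤ σ.arr 1 k 0 * dd) → ∃ s', D.Eligible S σ dn dd k s' := by
      intro h
      rcases ht.ok k hk with h' | ⟨num, den, kd, s', h'⟩
      · rw [h' 3] at h; simp at h
      · refine ⟨s', num, den, kd, h', ?_⟩
        rw [h'.kind, h'.num_eq, h'.den_eq] at h; exact h
    refine Tr.of_wp (Wp.seq (Wp.set ?_ ?_ <| Wp.seq <| Wp.set ?_ ?_ <| Wp.seq <| Wp.set ?_ ?_ <|
      Wp.ite ?_ (fun h1 => Wp.ite ?_
          (fun h2 => Wp.of_tr (Tr.of_wp (bett _ ?_ ?_ ?_ ?_ (iseli ?_)))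
            fun t ht σ' _ hh => ⟨?_, hh⟩)
          (fun h2 => Wp.skip ⟨?_, keep _ ?_ ?_ ?_⟩))
        (fun h1 => Wp.ite ?_ (fun h2 => Wp.ite ?_ (fun h3 => Wp.skip ⟨?_, keep _ ?_ ?_ ?_⟩)
          (fun h3 => Wp.of_tr (Tr.of_wp (bett _ ?_ ?_ ?_ ?_ (iseli ?_)))
            fun t ht σ' _ hh => ⟨?_, hh⟩))
          (fun h2 => Wp.skip ⟨?_, keep _ ?_ ?_ ?_⟩))))
    all_goals try simp [hkv, a1, d1, d2] at h1
    all_goals try simp [hkv, a1, d1, d2] at h2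
    all_goals try simp [hkv, a1, d1, d2] at h3
    all_goals try simp [hkv, a1]
    all_goals first
      | omega
      | (intro s' hs'
         exfalso
         have := notel s' hs'
         omega)
  · simp; omega

end Items

/-! ### Writing the intervals and their sets. -/

namespace Items
variable {D : Items} {E S u T IT : ℕ} {num den sg : ℤ}

variable (D) in
/-- The set `s` is feasible between `x / y` and `x' / y'`, and at least as profitable as the
records there. -/
structure Segment (S : ℕ) (σ : St Var) (Z : ℕ) (x y x' y' : ℤ) (s : Finset ℕ) : Prop where
  sub : s ⊆ Finset.range D.n
  feas : ∀ lam : ℝ, (x : ℝ) ≤ lam * y → lam * y' ≤ x' → D.Feas lam s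
  opt : ∀ z < Z, ∀ s' num den kd, D.IsRec S σ z num den kd s' → ∀ lam : ℝ,
    (kd : ℝ) * num ≤ kd * (lam * den) → (kd = 1 → lam * y' < x') → (kd = -1 → x < lam * y) →
    ∑ k ∈ s', D.p k ≤ ∑ k ∈ s, D.p k

/-- By `hmin`, no record has its end strictly between `x / y` and `x' / y'`. So a half-line that
starts before the right end starts at the left end or earlier, and one that ends after the left end
reaches the right end. -/
theorem Segment.mk' {σ : St Var} {Z : ℕ} {x y x' y' : ℤ} {s : Finset ℕ} (hy : 0 ≤ y)
    (hy0 : y = 0 → x = -1) (hy' : 0 ≤ y') (hy0' : y' = 0 → x' = 1)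
    (hmin : ∀ z < Z, 0 < σ.arr 1 z 1 → x * σ.arr 1 z 1 < σ.arr 1 z 0 * y →
        x' * σ.arr 1 z 1 ≤ σ.arr 1 z 0 * y')
    (hs : s = ∅ ∨ ∃ z < Z, D.Eligible S σ x' y' z s)
    (hmax : ∀ z < Z, ∀ s', D.Eligible S σ x' y' z s' → ∑ k ∈ s', D.p k ≤ ∑ k ∈ s, D.p k) :
    D.Segment S σ Z x y x' y' s := by
  have hyR : (0 : ℝ) ≤ y := by exact_mod_cast hy
  have hyR' : (0 : ℝ) ≤ y' := by exact_mod_cast hy'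
  refine ⟨?_, fun lam h1 h2 => ?_, fun z hz s' num den kd hrec lam hl h1 h2 => ?_⟩
  · rcases hs with rfl | ⟨z, -, num, den, kd, hrec, -⟩
    exacts [Finset.empty_subset _, hrec.sub]
  · rcases hs with rfl | ⟨z, hz, num, den, kd, hrec, h⟩
    · simp [Feas]
    have hd : (0 : ℝ) < den := by exact_mod_cast hrec.den_pos
    refine hrec.feas lam ?_
    rcases h with ⟨rfl, h⟩ | ⟨rfl, h⟩
    -- Otherwise `num / den` would be a value beyond `x / y` and smaller than the next one.
    · have h3 : num * y ≤ x * den := by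
        by_contra! hcon
        have := hmin z hz (by rw [hrec.den_eq]; exact hrec.den_pos)
          (by rw [hrec.den_eq, hrec.num_eq]; exact hcon)
        rw [hrec.den_eq, hrec.num_eq] at this
        omega
      rcases hy.eq_or_lt with h0 | h0
      · rw [← h0, hy0 h0.symm] at h3
        have := hrec.den_pos
        omega
      · have h0R : (0 : ℝ) < y := by exact_mod_cast h0
        have h3R : (num : ℝ) * y ≤ x * den := by exact_mod_cast h3
        have h4 := mul_le_mul_of_nonneg_right h1 hd.le
        simp only [Int.cast_one, one_mul]
        refine le_of_mul_le_mul_right ?_ h0R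
        linarith
    · rcases hy'.eq_or_lt with h0 | h0
      · rw [← h0, hy0' h0.symm] at h
        have := hrec.den_pos
        omega
      · have h0R : (0 : ℝ) < y' := by exact_mod_cast h0
        have h3R : (x' : ℝ) * den ≤ num * y' := by exact_mod_cast h
        have h4 := mul_le_mul_of_nonneg_right h2 hd.le
        have : lam * den ≤ num := by
          refine le_of_mul_le_mul_right ?_ h0R
          linarith
        push_cast
        linarith
  · have hd : (0 : ℝ) < den := by exact_mod_cast hrec.den_pos
    refine hmax z hz s' ⟨num, den, kd, hrec, ?_⟩
    rcases (abs_eq zero_le_one).1 hrec.kd_abs with rfl | rfl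
    · left
      refine ⟨rfl, ?_⟩
      have h3 := mul_lt_mul_of_pos_right (h1 rfl) hd
      simp only [Int.cast_one, one_mul] at hl
      have h4 := mul_le_mul_of_nonneg_right hl hyR'
      have : (num : ℝ) * y' < x' * den := by linarith
      exact_mod_cast this
    · right
      refine ⟨rfl, ?_⟩
      have h3 := mul_lt_mul_of_pos_right (h2 rfl) hd
      have hl' : lam * den ≤ num := by push_cast at hl; linarith
      have h4 := mul_le_mul_of_nonneg_right hl' hyR
      have h5 : (x : ℝ) * den < num * y := by linarith
      have := hmin z hz (by rw [hrec.den_eq]; exact hrec.den_pos)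
        (by rw [hrec.den_eq, hrec.num_eq]; exact_mod_cast h5)
      rwa [hrec.den_eq, hrec.num_eq] at this

theorem Segment.congr {σ σ' : St Var} {Z : ℕ} {x y x' y' : ℤ} {s : Finset ℕ}
    (h : D.Segment S σ Z x y x' y' s) (h1 : σ'.arr 1 = σ.arr 1) (h2 : σ'.arr 2 = σ.arr 2) :
    D.Segment S σ' Z x y x' y' s :=
  ⟨h.sub, h.feas, fun z hz s' num den kd hrec => h.opt z hz s' num den kd
    (hrec.congr (by rw [h1]) (by rw [h2]))⟩

variable (D) in
/-- The part of the output that consists of the breakpoints `x i / y i`, `1 ≤ i ≤ k`, and of the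
first `r` sets. -/
structure Out (S : ℕ) (Z k r : ℕ) (x y : ℕ → ℤ) (s : ℕ → Finset ℕ) (σ : St Var) : Prop where
  reg_b2 : σ.reg .b2 = 3 * ((Z : ℤ) + 1)
  x_zero : x 0 = -1
  y_zero : y 0 = 0
  y_pos : ∀ i, 1 ≤ i → i ≤ k → 0 < y i
  lt : ∀ i < k, x i * y (i + 1) < x (i + 1) * y i
  raw_x : ∀ i : ℕ, i < k → σ.raw (3 * i) = x (i + 1)
  raw_y : ∀ i : ℕ, i < k → σ.raw (3 * i + 1) = y (i + 1)
  raw_left : ∀ i : ℕ, i < k → i + 1 < r → σ.raw (3 * i + 2) =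
    if ∑ j ∈ s (i + 1), D.p j ≤ ∑ j ∈ s i, D.p j then 1 else 0
  rows : ∀ j : ℕ, j < r → ∀ m : ℕ, m < D.n →
    σ.raw (3 * ((Z : ℤ) + 1) + j * D.n + m) = if m ∈ s j then 1 else 0
  seg : ∀ j < r, D.Segment S σ Z (x j) (y j) (x (j + 1)) (y (j + 1)) (s j)

/-- The number of records with a parameter value larger than `x / y`. -/
def larger (σ : St Var) (Z : ℕ) (x y : ℤ) : ℕ :=
  ((Finset.range Z).filter fun z : ℕ => 0 < σ.arr 1 z 1 ∧ x * σ.arr 1 z 1 < σ.arr 1 z 0 * y).card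

/-- `larger` is the potential that bounds the number of breakpoints by `Z`: passing to the next
value removes the record with that value from the count. -/
theorem larger_lt {σ : St Var} {Z : ℕ} {x y x' y' : ℤ} (hy : 0 ≤ y) (hy' : 0 < y') {z : ℕ}
    (hz : z < Z) (h0 : σ.arr 1 z 0 = x') (h1 : σ.arr 1 z 1 = y') (h : x * y' < x' * y) :
    larger σ Z x' y' < larger σ Z x y := by
  refine Finset.card_lt_card (Finset.ssubset_iff_of_subset (fun w hw => ?_) |>.2 ⟨z, ?_, ?_⟩)
  · simp only [Finset.mem_filter] at hw ⊢
    refine ⟨hw.1, hw.2.1, ?_⟩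
    refine lt_of_mul_lt_mul_right ?_ hy'.le
    have h2 := mul_lt_mul_of_pos_right h hw.2.1
    have h3 := mul_le_mul_of_nonneg_right hw.2.2.le hy
    linarith
  · simp only [Finset.mem_filter, Finset.mem_range]
    exact ⟨hz, by rw [h1]; exact hy', by rw [h0, h1]; exact h⟩
  · simp [h0, h1]

variable (D) in
/-- The situation after the output of `k` intervals. -/
structure OutInv (E S Z k : ℕ) (x y : ℕ → ℤ) (s : ℕ → Finset ℕ) (σ : St Var) : Prop where
  reg_n : σ.reg .n = D.n
  table : D.Table S Z σ
  reg_kk : σ.reg .kk = k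
  reg_cn : σ.reg .cn = x k
  reg_cd : σ.reg .cd = y k
  reg_pp : ∀ j, k = j + 1 → σ.reg .pp = ((∑ i ∈ s j, D.p i : ℕ) : ℤ)
  out : D.Out S Z k k x y s σ
  count : k + larger σ Z (x k) (y k) ≤ Z

/-- The table of breakpoints is written over the input, which is no longer needed. The counting
invariant gives `k ≤ Z`, so this table stays below the address `3 * (Z + 1)` where the rows of the
item sets begin. -/
theorem outputStep_spec (hP : D.Params E S u) {σ : St Var} {Z k : ℕ} {x y : ℕ → ℤ}
    {s : ℕ → Finset ℕ} (hZ : Z + 1 ≤ u) (h : D.OutInv E S Z k x y s σ) :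
    Tr u Prog.outputStep (Z * 260 + D.n * 60 + 250) σ fun σ' =>
      (σ'.reg .go = 0 ∧ σ'.reg .kk = k ∧ ∃ x y s, D.Out S Z k (k + 1) x y s σ' ∧ x (k + 1) = 1 ∧
        y (k + 1) = 0) ∨
      (σ'.reg .go = σ.reg .go ∧ ∃ x y s, D.OutInv E S Z (k + 1) x y s σ') := by
  have hn := hP.n_le
  have hkZ : k ≤ Z := (Nat.le_add_right _ _).trans h.count
  have hyk : 0 ≤ y k := by
    rcases Nat.eq_zero_or_pos k with rfl | hk
    exacts [h.out.y_zero.ge, (h.out.y_pos k hk le_rfl).le]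
  have hyk0 : y k = 0 → x k = -1 := fun h0 => by
    rcases Nat.eq_zero_or_pos k with rfl | hk
    exacts [h.out.x_zero, absurd h0 (h.out.y_pos k hk le_rfl).ne']
  refine Tr.of_wp (Wp.seq (Wp.of_tr (nextValue_spec hP h.table (by omega) h.reg_cn h.reg_cd)
    fun t1 ht1 σ1 hF1 hN => ?_))
  obtain ⟨dn, dd, rdn, rdd, hdd, hdn, hex, hmin⟩ := hN
  have a11 : σ1.arr 1 = σ.arr 1 := hF1.arr 1 rfl
  have a21 : σ1.arr 2 = σ.arr 2 := hF1.arr 2 rfl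
  have ht1' := h.table.of_eq a11 a21 (hF1.reg .Z rfl)
  refine Wp.seq (Wp.of_tr (findBest_spec hP ht1' (by omega) rdn rdd) fun t2 ht2 σ2 hF2 hN => ?_)
  obtain ⟨b, best, rbest, rbp, hbits, hel, hmax⟩ := hN
  have hseg : D.Segment S σ1 Z (x k) (y k) dn dd b :=
    Segment.mk' hyk hyk0 hdd hdn (by rw [a11]; exact hmin) hel hmax
  have a12 : σ2.arr 1 = σ.arr 1 := (hF2.arr 1 rfl).trans a11
  have a22 : σ2.arr 2 = σ.arr 2 := (hF2.arr 2 rfl).trans a21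
  have raw2 : σ2.raw = σ.raw := (hF2.raw rfl).trans (hF1.raw rfl)
  have rdn2 : σ2.reg .dn = dn := by rw [hF2.reg _ rfl, rdn]
  have rdd2 : σ2.reg .dd = dd := by rw [hF2.reg _ rfl, rdd]
  have rkk2 : σ2.reg .kk = k := by rw [hF2.reg _ rfl, hF1.reg _ rfl, h.reg_kk]
  have rpp2 : σ2.reg .pp = σ.reg .pp := by rw [hF2.reg _ rfl, hF1.reg _ rfl]
  have rn2 : σ2.reg .n = D.n := by rw [hF2.reg _ rfl, hF1.reg _ rfl, h.reg_n]
  have rb2 : σ2.reg .b2 = 3 * ((Z : ℤ) + 1) := by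
    rw [hF2.reg _ rfl, hF1.reg _ rfl, h.out.reg_b2]
  have rgo2 : σ2.reg .go = σ.reg .go := by rw [hF2.reg _ rfl, hF1.reg _ rfl]
  have rZ2 : σ2.reg .Z = Z := by rw [hF2.reg _ rfl, hF1.reg _ rfl, h.table.reg_Z]
  have hseg2 : D.Segment S σ Z (x k) (y k) dn dd b := hseg.congr a11.symm a21.symm
  rw [a21] at hbits
  -- The bit of a breakpoint compares the sets on its two sides, so it is written one round later
  -- than the breakpoint, at `3 * kk - 1 = 3 * (kk - 1) + 2`.
  refine Wp.seq (Wp.of_tr (T := 40) (R := fun σ3 => (∀ j, k = j + 1 → σ3.raw (3 * j + 2) =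
      if ∑ i ∈ b, D.p i ≤ ∑ i ∈ s j, D.p i then 1 else 0) ∧
      ∀ i : ℤ, i ≠ 3 * k - 1 → σ3.raw i = σ.raw i) (Tr.of_wp (Wp.ite (by simp) (fun h1 =>
        Wp.ite (by simp) (fun h2 => Wp.rput (by simp) ?_ (by simp) ⟨?_, ?_, ?_⟩)
          (fun h2 => Wp.rput (by simp) ?_ (by simp; omega) ⟨?_, ?_, ?_⟩))
        (fun h1 => Wp.skip ⟨?_, ?_, ?_⟩))) fun t3 ht3 σ3 hF3 hN => ?_)
  · simp [rkk2] at h1 ⊢; omega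
  · simp
  · rintro j rfl
    have := h.reg_pp j rfl
    simp [rkk2, rbp, rpp2, this] at h2 ⊢
    rw [if_pos (by ring), if_neg (by rw [not_le]; exact_mod_cast h2)]
  · intro i hi
    simp [rkk2, hi, raw2]
  · simp [rkk2] at h1 ⊢; omega
  · simp
  · rintro j rfl
    have := h.reg_pp j rfl
    simp [rkk2, rbp, rpp2, this] at h2 ⊢
    rw [if_pos (by ring), if_pos (by exact_mod_cast h2)]
  · intro i hi
    simp [rkk2, hi, raw2]
  · simp
  · rintro j rfl
    simp [rkk2] at h1; omega
  · intro i hi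
    rw [raw2]
  obtain ⟨hleft, hraw3⟩ := hN
  have a13 : σ3.arr 1 = σ.arr 1 := (hF3.arr 1 rfl).trans a12
  have a23 : σ3.arr 2 = σ.arr 2 := (hF3.arr 2 rfl).trans a22
  have rbp3 : σ3.reg .bp = ((∑ i ∈ b, D.p i : ℕ) : ℤ) := by rw [hF3.reg _ rfl, rbp]
  have hbu : ∑ i ∈ b, D.p i ≤ u := hP.sum_p_le hseg.sub
  refine Wp.seq (Wp.set (by simp) ?_ ?_)
  · simp only [Ex.eval_var, rbp3]; omega
  simp only [Ex.eval_var, rbp3, Ex.size_var]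
  refine Wp.seq (Wp.of_tr (Tr.loop (N := D.n) (T := 40) (fun m σ₁ =>
      (∀ i : ℕ, i < m → σ₁.raw (3 * ((Z : ℤ) + 1) + k * D.n + i) = if i ∈ b then 1 else 0) ∧
      ∀ i : ℤ, i < 3 * ((Z : ℤ) + 1) + k * D.n → σ₁.raw i = σ3.raw i)
      (by decide) rfl rfl ?_ (by omega) ?_ ?_ (fun σ₁ h _ => h)) fun t5 ht5 σ5 hF5 hN => ?_)
  · simp [hF3.reg .n rfl, rn2]
  · exact ⟨fun i hi => absurd hi (Nat.not_lt_zero _), fun _ _ => rfl⟩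
  · rintro m hm σ₁ ⟨h1, h2⟩ hmv hF
    have e1 : σ₁.reg .kk = k := by rw [hF.reg _ rfl]; simp [hF3.reg .kk rfl, rkk2]
    have e2 : σ₁.reg .b2 = 3 * ((Z : ℤ) + 1) := by
      rw [hF.reg _ rfl]; simp [hF3.reg .b2 rfl, rb2]
    have e3 : σ₁.reg .n = D.n := by rw [hF.reg _ rfl]; simp [hF3.reg .n rfl, rn2]
    have e4 : σ₁.reg .best = best := by rw [hF.reg _ rfl]; simp [hF3.reg .best rfl, rbest]
    have e5 : σ₁.arr 2 = σ.arr 2 := by rw [hF.arr 2 rfl]; exact a23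
    have e6 := hbits m hm
    have hpos : 0 ≤ 3 * ((Z : ℤ) + 1) + k * D.n + m := by positivity
    refine Tr.of_wp (Wp.rput ?_ ?_ ?_ ⟨?_, fun i hi => ?_, fun i hi => ?_⟩)
    · simp [hmv, e4]
    · simp [e1, e2, e3, hmv, hpos]
    · simp [e4, e5, hmv, e6]; split_ifs <;> omega
    · simp
    · simp only [St.set_raw, St.rput_raw, Ex.eval_add, Ex.eval_mul, Ex.eval_var, Ex.eval_get, e1,
        e2, e3, e4, e5, hmv, e6]
      rcases Nat.lt_succ_iff_lt_or_eq.1 hi with h' | rfl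
      · rw [if_neg (by omega), h1 i h']
      · rw [if_pos rfl]
    · simp only [St.set_raw, St.rput_raw, Ex.eval_add, Ex.eval_mul, Ex.eval_var, e1, e2, e3, hmv]
      rw [if_neg (by omega), h2 i hi]
  obtain ⟨hrow, hraw5⟩ := hN
  have a15 : σ5.arr 1 = σ.arr 1 := by rw [hF5.arr 1 rfl]; exact a13
  have a25 : σ5.arr 2 = σ.arr 2 := by rw [hF5.arr 2 rfl]; exact a23
  have rkk5 : σ5.reg .kk = k := by rw [hF5.reg _ rfl]; simp [hF3.reg .kk rfl, rkk2]
  have rb5 : σ5.reg .b2 = 3 * ((Z : ℤ) + 1) := by rw [hF5.reg _ rfl]; simp [hF3.reg .b2 rfl, rb2]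
  have rdn5 : σ5.reg .dn = dn := by rw [hF5.reg _ rfl]; simp [hF3.reg .dn rfl, rdn2]
  have rdd5 : σ5.reg .dd = dd := by rw [hF5.reg _ rfl]; simp [hF3.reg .dd rfl, rdd2]
  have rgo5 : σ5.reg .go = σ.reg .go := by rw [hF5.reg _ rfl]; simp [hF3.reg .go rfl, rgo2]
  have rpp5 : σ5.reg .pp = ((∑ i ∈ b, D.p i : ℕ) : ℤ) := by rw [hF5.reg _ rfl]; simp
  have rn5 : σ5.reg .n = D.n := by rw [hF5.reg _ rfl]; simp [hF3.reg .n rfl, rn2]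
  have rZ5 : σ5.reg .Z = Z := by rw [hF5.reg _ rfl]; simp [hF3.reg .Z rfl, rZ2]
  have hkn : ∀ j : ℕ, j < k → (j : ℤ) * D.n + D.n ≤ k * D.n := fun j hj => by
    have : (j + 1) * D.n ≤ k * D.n := by gcongr; omega
    zify at this; linarith
  have hkn0 : (0 : ℤ) ≤ k * D.n := by positivity
  have hout : D.Out S Z k (k + 1) (Function.update x (k + 1) dn) (Function.update y (k + 1) dd)
      (Function.update s k b) σ5 := by
    have ux : ∀ i ≤ k, Function.update x (k + 1) dn i = x i := fun i hi =>
      Function.update_of_ne (by omega) _ _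
    have uy : ∀ i ≤ k, Function.update y (k + 1) dd i = y i := fun i hi =>
      Function.update_of_ne (by omega) _ _
    have us : ∀ i < k, Function.update s k b i = s i := fun i hi =>
      Function.update_of_ne (by omega) _ _
    refine ⟨rb5, by rw [ux 0 (by omega), h.out.x_zero], by rw [uy 0 (by omega), h.out.y_zero],
      fun i h1 h2 => by rw [uy i h2]; exact h.out.y_pos i h1 h2, fun i hi => ?_, fun i hi => ?_,
      fun i hi => ?_, fun i hi hi' => ?_, fun j hj m hm => ?_, fun j hj => ?_⟩
    · rw [ux i hi.le, uy i hi.le, ux (i + 1) hi, uy (i + 1) hi]; exact h.out.lt i hi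
    · rw [ux (i + 1) hi, hraw5 _ (by omega), hraw3 _ (by omega), h.out.raw_x i hi]
    · rw [uy (i + 1) hi, hraw5 _ (by omega), hraw3 _ (by omega), h.out.raw_y i hi]
    · rw [hraw5 _ (by omega), us i hi]
      rcases Nat.lt_succ_iff_lt_or_eq.1 hi' with h' | h'
      · rw [us _ h', hraw3 _ (by omega), h.out.raw_left i hi h']
      · rw [hleft i h'.symm, h', Function.update_self]
    · rcases Nat.lt_succ_iff_lt_or_eq.1 hj with h' | rfl
      · rw [us _ h', hraw5 _ (by have := hkn j h'; omega), hraw3 _ (by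
          have : (0 : ℤ) ≤ j * D.n := by positivity
          omega), h.out.rows j h' m hm]
      · rw [Function.update_self, hrow m hm]
    · rcases Nat.lt_succ_iff_lt_or_eq.1 hj with h' | rfl
      · rw [us _ h', ux _ h'.le, uy _ h'.le, ux _ h', uy _ h']
        exact (h.out.seg j h').congr a15 a25
      · rw [Function.update_self, Function.update_self, Function.update_self, ux _ le_rfl,
          uy _ le_rfl]
        exact hseg2.congr a15 a25
  refine Wp.ite (by simp) (fun h1 => ?_) (fun h1 => ?_)
  · replace h1 : 0 < dd := by simpa [rdd5] using h1
    obtain ⟨z, hz, hz0, hz1, hlt⟩ := hex h1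
    obtain ⟨b1, b2, b3, -⟩ := h.table.bounds hP hz
    rw [hz0] at b1
    rw [hz1] at b2 b3
    have b1' := abs_le.1 b1
    have hlar := larger_lt hyk h1 hz hz0 hz1 hlt
    have hk1 : k + 1 ≤ Z := by have := h.count; omega
    refine Wp.seq (Wp.rput (by simp) ?_ ?_ <| Wp.seq <| Wp.rput (by simp) ?_ ?_ <| Wp.seq <|
      Wp.set (by simp) ?_ <| Wp.seq <| Wp.set (by simp) ?_ <| Wp.set (by simp) ?_
      ⟨?_, Or.inr ⟨?_, Function.update x (k + 1) dn, Function.update y (k + 1) dd,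
        Function.update s k b, ?_⟩⟩)
    · simp [rkk5]
    · simp [rdn5]; exact b1'
    · simp [rkk5]; omega
    · simp [rdd5]; omega
    · simp [rdn5]; exact b1'
    · simp [rdd5]; omega
    · simp [rkk5]; omega
    · simp; omega
    · simp [rgo5]
    · refine ⟨by simp [rn5], ?_, by simp [rkk5], by simp [rdn5], by simp [rdd5], ?_, ?_, ?_⟩
      · exact h.table.of_eq a15 a25 (by simp [rZ5, h.table.reg_Z])
      · rintro j hj
        obtain rfl : k = j := by omega
        simp [rpp5]
      · have e : ∀ i : ℤ, i ≠ 3 * k → i ≠ 3 * k + 1 → (((((σ5.rput (Ex.eval σ5 (3 * Ex.var .kk))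
          (Ex.eval σ5 (Ex.var .dn))).rput (Ex.eval (σ5.rput (Ex.eval σ5 (3 * Ex.var .kk))
          (Ex.eval σ5 (Ex.var .dn))) (3 * Ex.var .kk + 1)) (Ex.eval (σ5.rput (Ex.eval σ5
          (3 * Ex.var .kk)) (Ex.eval σ5 (Ex.var .dn))) (Ex.var .dd)))))).raw i = σ5.raw i := by
          intro i h1 h2
          simp [rkk5, h1, h2]
        refine ⟨by simp [rb5], hout.x_zero, hout.y_zero, fun i h2 h3 => ?_, fun i hi => ?_,
          fun i hi => ?_, fun i hi => ?_, fun i hi hi' => ?_, fun j hj m hm => ?_, fun j hj => ?_⟩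
        · rcases Nat.le_succ_iff.1 h3 with h4 | rfl
          · exact hout.y_pos i h2 h4
          · rw [Function.update_self]; exact h1
        · rcases Nat.lt_succ_iff_lt_or_eq.1 hi with h4 | rfl
          · exact hout.lt i h4
          · rw [Function.update_self, Function.update_self, Function.update_of_ne (by omega),
              Function.update_of_ne (by omega)]
            exact hlt
        · rcases Nat.lt_succ_iff_lt_or_eq.1 hi with h4 | rfl
          · exact (e _ (by omega) (by omega)).trans (hout.raw_x i h4)
          · simp [rkk5, rdn5]
        · rcases Nat.lt_succ_iff_lt_or_eq.1 hi with h4 | rfl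
          · exact (e _ (by omega) (by omega)).trans (hout.raw_y i h4)
          · simp [rkk5, rdd5]
        · exact (e _ (by omega) (by omega)).trans (hout.raw_left i (by omega) hi')
        · refine (e _ ?_ ?_).trans (hout.rows j hj m hm)
          · have : (0 : ℤ) ≤ j * D.n := by positivity
            omega
          · have : (0 : ℤ) ≤ j * D.n := by positivity
            omega
        · exact (hout.seg j hj).congr rfl rfl
      · rw [Function.update_self, Function.update_self]
        have : larger σ Z dn dd = _ := rfl
        have hc := h.count
        have e : larger σ5 Z dn dd = larger σ Z dn dd := by simp only [larger, a15]
        refine le_trans ?_ hc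
        change k + 1 + larger σ5 Z dn dd ≤ _
        omega
  · obtain rfl : dd = 0 := by simp [rdd5] at h1; omega
    refine Wp.set (by simp) (by simp) ⟨?_, Or.inl ⟨by simp, by simp [rkk5],
      Function.update x (k + 1) dn, Function.update y (k + 1) 0,
        Function.update s k b, ?_, by rw [Function.update_self, hdn rfl],
        by rw [Function.update_self]⟩⟩
    · simp; omega
    · exact ⟨by simp [rb5], hout.x_zero, hout.y_zero, hout.y_pos, hout.lt, hout.raw_x, hout.raw_y,
        hout.raw_left, hout.rows, fun j hj => (hout.seg j hj).congr rfl rfl⟩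

theorem output_spec (hP : D.Params E S u) {σ : St Var} {Z : ℕ} (hZ : 3 * (Z + 1) ≤ u)
    (hn : σ.reg .n = D.n) (hkk : σ.reg .kk = 0) (ht : D.Table S Z σ) :
    Tr u Prog.output ((Z + 1) * (Z * 260 + D.n * 60 + 260) + 50) σ fun σ' =>
      ∃ (k : ℕ) (x y : ℕ → ℤ) (s : ℕ → Finset ℕ), σ'.reg .kk = k ∧ D.Out S Z k (k + 1) x y s σ' ∧
        x (k + 1) = 1 ∧ y (k + 1) = 0 ∧ σ'.arr 1 = σ.arr 1 ∧ σ'.arr 2 = σ.arr 2 := by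
  refine Tr.of_wp (Wp.seq (Wp.set (by simp) ?_ <| Wp.seq <| Wp.set (by simp) (by simp) <| Wp.seq <|
    Wp.set (by simp) ?_ <| Wp.seq <| Wp.set (by simp) ?_ <|
    Wp.of_tr (Tr.loopWhile (e := .var .go) (T := Z * 260 + D.n * 60 + 250)
      (fun m σ' => (σ'.reg .go = 1 ∧ ∃ k x y s, k + m = Z + 1 ∧ D.OutInv E S Z k x y s σ') ∨
        (σ'.reg .go = 0 ∧ ∃ (k : ℕ) (x y : ℕ → ℤ) (s : ℕ → Finset ℕ), σ'.reg .kk = k ∧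
          D.Out S Z k (k + 1) x y s σ' ∧ x (k + 1) = 1 ∧ y (k + 1) = 0)) (Z + 1) ?_
        (fun _ _ _ => trivial) ?_ (fun m σ' h he => (?_ : ∃ (k : ℕ) (x y : ℕ → ℤ)
          (s : ℕ → Finset ℕ), σ'.reg .kk = k ∧
          D.Out S Z k (k + 1) x y s σ' ∧ x (k + 1) = 1 ∧ y (k + 1) = 0)))
        fun t ht σ' hF h => ⟨?_, ?_⟩))
  · simp; omega
  · simp [ht.reg_Z]; omega
  · simp; omega
  · refine Or.inl ⟨by simp, 0, fun _ => -1, fun _ => 0, fun _ => ∅, by simp, by simp [hn],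
      ht.of_eq rfl rfl (by simp), by simp [hkk], by simp, by simp, by simp, ?_, ?_⟩
    · exact ⟨by simp [ht.reg_Z], rfl, rfl, by omega, by omega, by omega, by omega, by omega,
        by omega, by omega⟩
    · rw [zero_add]
      exact (Finset.card_filter_le _ _).trans (by simp)
  · rintro m σ' (⟨hgo, k, x, y, s, hm, hI⟩ | ⟨hgo, -⟩) he
    · have hk : k ≤ Z := (Nat.le_add_right _ _).trans hI.count
      refine (outputStep_spec hP (by omega) hI).mono le_rfl ?_
      rintro σ₂ - (⟨h1, h2, x, y, s, h3⟩ | ⟨h1, x, y, s, h3⟩)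
      · exact ⟨0, by omega, Or.inr ⟨h1, k, x, y, s, h2, h3⟩⟩
      · exact ⟨m - 1, by omega, Or.inl ⟨by rw [h1, hgo], k + 1, x, y, s, by omega, h3⟩⟩
    · simp [hgo] at he
  · rcases h with ⟨hgo, -⟩ | ⟨-, h⟩
    · simp [hgo] at he
    · exact h
  · have e : (Z + 1) * (Z * 260 + D.n * 60 + 260) =
      (Z + 1) * (Z * 260 + D.n * 60 + 250 + 5) + 5 * (Z + 1) := by ring
    simp at ht ⊢
    omega
  · obtain ⟨k, x, y, s, h1, h2, h3, h4⟩ := h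
    exact ⟨k, x, y, s, h1, h2, h3, h4, hF.arr 1 rfl, hF.arr 2 rfl⟩

end Items

/-! ### The whole program and the bound on Newton iterations. -/

namespace Items
variable {D : Items} {E S u T IT : ℕ} {num den sg : ℤ}

/-- A bound for the number of records. -/
def recBound (n E : ℕ) : ℕ := n * (4 * E * (Nat.log 2 n + 1))

/-- A bound for the running time. -/
def totalTime (n E IT : ℕ) : ℕ :=
  n * ((Nat.log 2 n + 1) * scaleTime n E IT + 154) + 170 +
    ((recBound n E + 1) * (recBound n E * 260 + n * 60 + 260) + 50)

theorem main_spec (hP : D.Params E S u) (hIT : D.IterBound E S IT) {eN eD : ℤ} {σ : St Var}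
    (hI : D.Input eN eD σ) (hE : 2 * eD / eN + 1 = E) (hr : ∀ v, σ.reg v = 0)
    (ha : ∀ r i j, σ.arr r i j = 0) :
    Tr u Prog.main (totalTime D.n E IT) σ fun σ' => ∃ (Z k : ℕ) (x y : ℕ → ℤ)
      (s : ℕ → Finset ℕ), σ'.reg .kk = k ∧ D.Out S Z k (k + 1) x y s σ' ∧
        x (k + 1) = 1 ∧ y (k + 1) = 0 ∧
        ∀ k i l : ℕ, k < D.n → 2 ^ i ≤ D.n → l < E →
          D.Done E S σ' Z (2 ^ i * D.p k * (E + l)) := by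
  have hn := hP.n_pos
  have hE3 := hP.E_ge
  have hlog : Nat.log 2 D.n + 1 ≤ D.n := Nat.log_lt_self 2 hn.ne'
  have hZu : 3 * (recBound D.n E + 1) ≤ u := by
    refine le_trans ?_ hP.nE_le
    have h1 : recBound D.n E ≤ D.n * (4 * E * D.n) := by unfold recBound; gcongr
    have h2 : D.n * (4 * E * D.n) = 4 * (D.n ^ 2 * E) := by ring
    have h3 : 1 ≤ D.n ^ 2 := Nat.one_le_pow _ _ hn
    have h4 : D.n ^ 2 * E * 3 ≤ D.n ^ 2 * E ^ 2 := by rw [pow_two E, ← mul_assoc]; gcongr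
    have h5 : 1 * 3 ≤ D.n ^ 2 * E := Nat.mul_le_mul h3 hE3
    have h6 : 40 * D.n ^ 2 * E ^ 2 = 40 * (D.n ^ 2 * E ^ 2) := by ring
    omega
  refine Tr.of_wp (Wp.seq (Wp.of_tr (records_spec hP hIT hI hE (hr _) (ha 1) (ha 2) (by
    change recBound D.n E ≤ u; omega)) fun t ht σ₁ hF h => ?_))
  obtain ⟨hB, Z, hZ, htab, hd⟩ := h
  change Z ≤ recBound D.n E at hZ
  refine Wp.of_tr (output_spec hP (by omega) hB.reg_n ((hF.reg _ rfl).trans (hr _)) htab)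
    fun t' ht' σ₂ hF₂ h => ⟨?_, ?_⟩
  · have : (Z + 1) * (Z * 260 + D.n * 60 + 260) ≤
        (recBound D.n E + 1) * (recBound D.n E * 260 + D.n * 60 + 260) := by gcongr
    unfold totalTime
    omega
  · obtain ⟨k, x, y, s, h1, h2, h3, h4, h5, h6⟩ := h
    exact ⟨Z, k, x, y, s, h1, h2, h3, h4, fun k i l hk hi hl =>
      (hd k i l hk hi hl).mono le_rfl fun z _ => ⟨by rw [h5], by rw [h6]⟩⟩

/-- Inside an interval the claim is `Segment.opt`. At a breakpoint, half-lines that start there were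
considered on the right and half-lines that end there on the left. The breakpoint belongs to the
side with the larger profit, so both kinds are dominated. -/
theorem Out.approx {σ : St Var} {Z k : ℕ} {x y : ℕ → ℤ} {s : ℕ → Finset ℕ}
    (h : D.Out S Z k (k + 1) x y s σ) (hx : x (k + 1) = 1) (hy : y (k + 1) = 0) {j : ℕ} (hj : j ≤ k)
    {lam : ℝ} (hlo : (x j : ℝ) < lam * y j ∨ ∃ i, j = i + 1 ∧ (x j : ℝ) = lam * y j ∧
      ∑ i ∈ s i, D.p i ≤ ∑ i ∈ s j, D.p i)
    (hhi : lam * y (j + 1) < x (j + 1) ∨ (j < k ∧ lam * y (j + 1) = x (j + 1) ∧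
      ∑ i ∈ s (j + 1), D.p i ≤ ∑ i ∈ s j, D.p i)) :
    D.Feas lam (s j) ∧ ∀ z < Z, ∀ s', D.Covers S σ z lam s' →
      ∑ i ∈ s', D.p i ≤ ∑ i ∈ s j, D.p i := by
  have hseg := h.seg j (by omega)
  -- Consecutive ends are strictly ordered, also towards `1 / 0`; the exception is the case without
  -- breakpoints.
  have step : ∀ i ≤ k, (x i : ℝ) * y (i + 1) < x (i + 1) * y i ∨ i = k ∧ y i = 0 := by
    intro i hi
    rcases hi.lt_or_eq with hi | rfl
    · left; exact_mod_cast h.lt i hi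
    · rcases Nat.eq_zero_or_pos i with rfl | hi0
      · exact Or.inr ⟨rfl, h.y_zero⟩
      · left
        rw [hx, hy]
        have := h.y_pos i hi0 le_rfl
        simpa using this
  refine ⟨hseg.feas lam ?_ ?_, ?_⟩
  · rcases hlo with h1 | ⟨i, -, h1, -⟩
    exacts [h1.le, h1.le]
  · rcases hhi with h1 | ⟨-, h1, -⟩
    exacts [h1.le, h1.le]
  rintro z hz s' ⟨num, den, kd, hrec, hl⟩
  rcases (abs_eq zero_le_one).1 hrec.kd_abs with rfl | rfl
  · rcases hhi with h1 | ⟨hjk, h1, h2⟩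
    · exact hseg.opt z hz s' num den _ hrec lam hl (fun _ => h1) (fun h => by norm_num at h)
    · refine le_trans ?_ h2
      refine (h.seg (j + 1) (by omega)).opt z hz s' num den _ hrec lam hl (fun _ => ?_)
        (fun h => by norm_num at h)
      have hyp : (0 : ℝ) < y (j + 1) := by exact_mod_cast h.y_pos (j + 1) (by omega) hjk
      have hyp' := h.y_pos (j + 1) (by omega) hjk
      rcases step (j + 1) hjk with h3 | ⟨-, h3⟩
      · rw [← h1] at h3
        refine lt_of_mul_lt_mul_right ?_ hyp.le
        linarith
      · omega
  · rcases hlo with h1 | ⟨i, rfl, h1, h2⟩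
    · exact hseg.opt z hz s' num den _ hrec lam hl (fun h => by norm_num at h) (fun _ => h1)
    · refine le_trans ?_ h2
      refine (h.seg i (by omega)).opt z hz s' num den _ hrec lam hl (fun h => by norm_num at h)
        (fun _ => ?_)
      have hyp : (0 : ℝ) < y (i + 1) := by exact_mod_cast h.y_pos (i + 1) (by omega) hj
      rcases step i (by omega) with h3 | ⟨h3, -⟩
      · rw [h1] at h3
        refine lt_of_mul_lt_mul_right ?_ hyp.le
        linarith
      · omega

/-- The iteration bounds for Newton's method. -/
def iterations (n S : ℕ) : ℕ :=
  min (2 * (Nat.log 2 S + 1) + 1)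
    (3 * (4 * (n + 1) * (Nat.log 2 (n + 1) + 1)) * (4 * (n + 1) * (Nat.log 2 (n + 1) + 1)))

theorem iterBound (hP : D.Params E S u) : D.IterBound E S (iterations D.n S) := by
  intro T sg N lam s hsg hc h0
  have hS1 := hP.S_pos
  have hfam : ∀ i < N, s i ⊆ Finset.range D.n := fun i hi => (hc.mem i hi).1
  refine le_min ?_ (hc.length_le (fun t ht => ht.1) (pow_lt_two_pow D.n))
  have h4 := hc.four_pow_le (S := S) (by exact_mod_cast hS1) h0.le
    (by have := hP.W_le; exact_mod_cast (by omega : (D.W : ℤ) ≤ S)) (fun i hi => ?_)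
    (fun i hi => ?_)
  · have h5 : 4 ^ N ≤ 12 * S ^ 4 := by exact_mod_cast h4
    have h6 : S < 2 ^ (Nat.log 2 S + 1) := Nat.lt_pow_succ_log_self (by norm_num) _
    set L := Nat.log 2 S + 1
    have h7 : S ^ 4 < (2 ^ L) ^ 4 := Nat.pow_lt_pow_left h6 (by norm_num)
    -- From `12 < 2 ^ 4` and `S < 2 ^ L`; hence `N ≤ 2 * L + 1`.
    have h8 : 2 ^ (2 * N) < 2 ^ (4 * L + 4) := by
      calc 2 ^ (2 * N) = 4 ^ N := by rw [pow_mul]; norm_num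
        _ < 2 ^ 4 * (2 ^ L) ^ 4 := by omega
        _ = _ := by rw [← pow_mul, ← pow_add]; congr 1; ring
    have := (Nat.pow_lt_pow_iff_right (by norm_num)).1 h8
    omega
  · have h5 := hP.abs_sum_a_le (hfam i hi)
    have h6 := neg_abs_le (∑ k ∈ s i, D.a k)
    exact_mod_cast (by omega : -(S : ℤ) ≤ ∑ k ∈ s i, D.a k)
  · have h5 := hP.abs_sum_b_le (hfam i hi)
    have h6 : |sg * ∑ k ∈ s i, D.b k| ≤ S := by rw [abs_mul, hsg]; omega
    have h7 := neg_abs_le (sg * ∑ k ∈ s i, D.b k)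
    unfold NewtonChain.slope
    rw [← Finset.mul_sum]
    exact_mod_cast (by omega : -(sg * ∑ k ∈ s i, D.b k) ≤ (S : ℤ))

end Items

/-! ### Transfer to the original instances and the approximation guarantee. -/

namespace ParamKnapsack
open Items

/-- The instance with items indexed by natural numbers. -/
def items (I : ParamKnapsack) : Items where
  n := I.n
  W := I.W
  p := fun i => if h : i < I.n then I.p ⟨i, h⟩ else 0
  a := fun i => if h : i < I.n then I.a ⟨i, h⟩ else 0
  b := fun i => if h : i < I.n then I.b ⟨i, h⟩ else 0

/-- The items of the given finite set of natural numbers. -/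
def ofNats (I : ParamKnapsack) (s : Finset ℕ) : Finset (Fin I.n) :=
  Finset.univ.filter fun i => i.val ∈ s

variable (I : ParamKnapsack)

theorem map_ofNats {s : Finset ℕ} (hs : s ⊆ Finset.range I.n) :
    (I.ofNats s).map Fin.valEmbedding = s := by
  ext i
  simp only [ofNats, Finset.mem_map, Finset.mem_filter, Finset.mem_univ, true_and,
    Fin.valEmbedding_apply]
  constructor
  · rintro ⟨j, hj, rfl⟩; exact hj
  · intro hi; exact ⟨⟨i, Finset.mem_range.1 (hs hi)⟩, hi, rfl⟩

theorem map_val_subset (t : Finset (Fin I.n)) : t.map Fin.valEmbedding ⊆ Finset.range I.n := by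
  intro i hi
  simp only [Finset.mem_map, Fin.valEmbedding_apply] at hi
  obtain ⟨j, -, rfl⟩ := hi
  simp

theorem sum_p (t : Finset (Fin I.n)) :
    ∑ i ∈ t.map Fin.valEmbedding, I.items.p i = I.profit t := by
  simp [items, profit]

theorem feas_iff (t : Finset (Fin I.n)) (lam : ℝ) :
    I.items.Feas lam (t.map Fin.valEmbedding) ↔ I.Feasible lam t := by
  simp [items, Feas, Feasible, Finset.sum_add_distrib, Finset.mul_sum]

/-- The supremum is attained at a feasible set, because the empty set is feasible. -/
theorem mul_optProfit_le {lam : ℝ} {c r : ℝ}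
    (h : ∀ t, I.Feasible lam t → c * (I.profit t : ℝ) ≤ r) : c * (I.optProfit lam : ℝ) ≤ r := by
  classical
  have hne : (Finset.univ.filter fun s : Finset (Fin I.n) => I.Feasible lam s).Nonempty :=
    ⟨∅, Finset.mem_filter.2 ⟨Finset.mem_univ _, by simp [Feasible]⟩⟩
  obtain ⟨t, ht, he⟩ := Finset.exists_mem_eq_sup _ hne I.profit
  have : I.optProfit lam = I.profit t := by rw [← he, optProfit]
  rw [this]
  exact h t (Finset.mem_filter.1 ht).2

theorem exists_solution {E S u : ℕ} {ε : ℚ} (hε : 2 ≤ (E + 1) * ε) (hP : I.items.Params E S u)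
    {σ : St Var} {Z k : ℕ} {x y : ℕ → ℤ} {s : ℕ → Finset ℕ} (h : I.items.Out S Z k (k + 1) x y s σ)
    (hx : x (k + 1) = 1) (hy : y (k + 1) = 0)
    (hd : ∀ k i l : ℕ, k < I.items.n → 2 ^ i ≤ I.items.n → l < E →
      I.items.Done E S σ Z (2 ^ i * I.items.p k * (E + l))) :
    ∃ sol : ParamSolution I.n, I.IsApprox ε sol ∧ sol.k = k ∧
      (∀ i : Fin sol.k, sol.breakpoint i = (x (i + 1) : ℚ) / y (i + 1) ∧
        (sol.left i = true ↔ ∑ j ∈ s (i + 1), I.items.p j ≤ ∑ j ∈ s i, I.items.p j)) ∧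
      ∀ j : Fin (sol.k + 1), ∀ i, i ∈ sol.sol j ↔ i.val ∈ s j := by
  have hyQ : ∀ i < k, (0 : ℚ) < y (i + 1) := fun i hi => by
    exact_mod_cast h.y_pos (i + 1) (by omega) hi
  have hmono : StrictMono fun i : Fin k => (x (i + 1) : ℚ) / y (i + 1) := by
    have key : ∀ j < k, ∀ i < j, (x (i + 1) : ℚ) / y (i + 1) < (x (j + 1) : ℚ) / y (j + 1) := by
      intro j
      induction j with
      | zero => intro _ i hi; omega
      | succ j ih =>
        intro hj i hi
        have h1 : (x (j + 1) : ℚ) / y (j + 1) < (x (j + 1 + 1) : ℚ) / y (j + 1 + 1) := by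
          rw [div_lt_div_iff₀ (hyQ j (by omega)) (hyQ (j + 1) hj)]
          exact_mod_cast h.lt (j + 1) hj
        rcases Nat.lt_succ_iff_lt_or_eq.1 hi with h2 | rfl
        · exact (ih (by omega) i h2).trans h1
        · exact h1
    exact fun i j hij => key j j.2 i hij
  refine ⟨⟨k, fun i => (x (i + 1) : ℚ) / y (i + 1), hmono,
    fun i => decide (∑ j ∈ s (i + 1), I.items.p j ≤ ∑ j ∈ s i, I.items.p j),
    fun j => I.ofNats (s j)⟩, ?_, rfl, fun i => ⟨rfl, by simp⟩, fun j i => by simp [ofNats]⟩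
  intro j lam hlam
  simp only [ParamSolution.interval, Set.mem_ofPred_eq] at hlam
  have hcast : ∀ i : ℕ, (((x i : ℚ) / y i : ℚ) : ℝ) = (x i : ℝ) / y i := fun i => by push_cast; rfl
  have hyR : ∀ i < k, (0 : ℝ) < y (i + 1) := fun i hi => by exact_mod_cast hyQ i hi
  have happ := h.approx hx hy (j := j) (Nat.le_of_lt_succ j.2) (lam := lam) ?_ ?_
  rotate_left
  · obtain ⟨j, hj⟩ := j
    rcases j with _ | j
    -- The left end is `-1 / 0`, and the condition reads `-1 < lam * 0`.
    · left; simp [h.x_zero, h.y_zero]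
    · have hjk : j < k := by simpa using hj
      rcases (hlam ⟨j, hjk⟩).1 (by simp) with h1 | ⟨h1, h2⟩
      · left
        simp only [hcast] at h1
        rwa [div_lt_iff₀ (hyR j hjk)] at h1
      · right
        simp only [hcast, decide_eq_false_iff_not, not_le] at h1 h2
        rw [div_eq_iff (hyR j hjk).ne'] at h1
        exact ⟨j, rfl, h1, h2.le⟩
  · obtain ⟨j, hj⟩ := j
    rcases Nat.lt_succ_iff_lt_or_eq.1 hj with hjk | rfl
    · rcases (hlam ⟨j, hjk⟩).2 (by simp) with h1 | ⟨h1, h2⟩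
      · left
        simp only [hcast] at h1
        rwa [lt_div_iff₀ (hyR j hjk)] at h1
      · right
        simp only [hcast, decide_eq_true_eq] at h1 h2
        rw [eq_div_iff (hyR j hjk).ne'] at h1
        exact ⟨hjk, h1, h2⟩
    · left; simp [hx, hy]
  have hsub : s j ⊆ Finset.range I.n := (h.seg j j.2).sub
  obtain ⟨hf, hbest⟩ := happ
  have e := I.map_ofNats hsub
  refine ⟨(I.feas_iff _ _).1 (by simpa only [e] using hf), ?_⟩
  refine I.mul_optProfit_le fun t ht => ?_
  have hprof : I.profit (I.ofNats (s j)) = ∑ i ∈ s j, I.items.p i := by rw [← sum_p, e]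
  simp only [hprof]
  rcases t.eq_empty_or_nonempty with rfl | hne
  · simpa [profit] using Finset.sum_nonneg fun _ _ => by positivity
  obtain ⟨z, hz, s', hc, hle⟩ := exists_covers hP hd (I.map_val_subset t) (by simpa using hne)
    ((I.feas_iff t lam).2 ht)
  have h1 := hbest z hz s' hc
  rw [sum_p] at hle
  have hE := hP.E_ge
  have h2 : (I.profit t : ℝ) * (E - 1) ≤ (∑ i ∈ s j, I.items.p i : ℕ) * (E + 1) := by
    have h3 : I.profit t * (E - 1) ≤ (∑ i ∈ s j, I.items.p i) * (E + 1) :=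
      hle.trans (Nat.mul_le_mul_right _ h1)
    have h4 : ((I.profit t * (E - 1) : ℕ) : ℝ) ≤ (((∑ i ∈ s j, I.items.p i) * (E + 1) : ℕ) : ℝ) := by
      exact_mod_cast h3
    rw [Nat.cast_mul, Nat.cast_sub (by omega), Nat.cast_mul] at h4
    simpa using h4
  have h3 : (2 : ℝ) ≤ (E + 1) * ε := by exact_mod_cast hε
  have hEpos : (0 : ℝ) < E + 1 := by positivity
  -- The inequality `(1 - ε) * (E + 1) ≤ E - 1` is `2 ≤ (E + 1) * ε`.
  refine le_of_mul_le_mul_right (le_trans ?_ h2) hEpos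
  have hp : (0 : ℝ) ≤ I.profit t := by positivity
  nlinarith

end ParamKnapsack

open Items

namespace RAMLang.Var

/-- Variables are numbered in the order of the constructors, so `kk` and `b2` occupy the machine
registers 0 and 2, where the output convention expects the number of breakpoints and the table of
item sets. -/
theorem ctorIdx_injective : Function.Injective Var.ctorIdx := by
  intro v v' h
  cases v <;> cases v' <;> first | rfl | exact absurd h (by decide)

end RAMLang.Var

/-! ### The machine program on the encoded input. -/

namespace ParamKnapsack

/-- The machine program. -/
def program : RAMProgram := Prog.main.code Var.ctorIdx 0 ++ [RAMInstr.const 1 0]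

/-- The number of profit levels per scale. -/
def levels (ε : ℚ) : ℕ := (2 * (ε.den : ℤ) / ε.num + 1).toNat

variable (I : ParamKnapsack)

/-- A bound for the parameter values. -/
def slopeBound : ℕ := I.W + 1 + ∑ i, ((I.a i).natAbs ^ 2 + (I.b i).natAbs ^ 2)

/-- A bound for the stored numbers. -/
def valueBound (ε : ℚ) : ℕ :=
  40 * I.slopeBound ^ 3 + 40 * I.n ^ 2 * levels ε ^ 2 * (∑ i, I.p i + 1) + ε.den

/-- The initial state of the structured program. -/
def initState (ε : ℚ) : St Var where
  reg := fun _ => 0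
  arr := fun _ _ _ => 0
  raw := (I.initConfig ε).mem

variable {ε : ℚ}

theorem levels_eq (h0 : 0 < ε) : 2 * (ε.den : ℤ) / ε.num + 1 = levels ε := by
  have hn : 0 < ε.num := Rat.num_pos.2 h0
  have : 0 ≤ 2 * (ε.den : ℤ) / ε.num := Int.ediv_nonneg (by positivity) hn.le
  unfold levels; omega

theorem num_lt_den (h1 : ε < 1) : ε.num < ε.den := by
  have hd : (0 : ℚ) < ε.den := by exact_mod_cast ε.den_pos
  rw [← Rat.num_div_den ε, div_lt_one hd] at h1
  exact_mod_cast h1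

theorem levels_ge (h0 : 0 < ε) (h1 : ε < 1) : 3 ≤ levels ε := by
  have hn : 0 < ε.num := Rat.num_pos.2 h0
  have h : 2 ≤ 2 * (ε.den : ℤ) / ε.num := by
    rw [Int.le_ediv_iff_mul_le hn]
    have := num_lt_den h1
    omega
  have := levels_eq h0
  omega

/-- Both sides of the rounding in `E = ⌊2 / ε⌋ + 1`: the first inequality gives the approximation
ratio, the second one the running time. -/
theorem levels_mul (h0 : 0 < ε) : 2 ≤ (levels ε + 1) * ε ∧ (levels ε - 1) * ε ≤ 2 := by
  have hn : 0 < ε.num := Rat.num_pos.2 h0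
  have hd : (0 : ℚ) < ε.den := by exact_mod_cast ε.den_pos
  have h := levels_eq h0
  have e1 := Int.mul_ediv_add_emod (2 * (ε.den : ℤ)) ε.num
  have e2 := Int.emod_lt_of_pos (2 * (ε.den : ℤ)) hn
  have e3 := Int.emod_nonneg (2 * (ε.den : ℤ)) hn.ne'
  have hq : 2 * (ε.den : ℤ) / ε.num = levels ε - 1 := by omega
  rw [hq] at e1
  have h5 : (2 : ℤ) * ε.den ≤ (levels ε + 1) * ε.num := by nlinarith
  have h6 : ((levels ε : ℤ) - 1) * ε.num ≤ 2 * ε.den := by linarith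
  have h5' : (2 : ℚ) * ε.den ≤ (levels ε + 1) * ε.num := by exact_mod_cast h5
  have h6' : ((levels ε : ℚ) - 1) * ε.num ≤ 2 * ε.den := by exact_mod_cast h6
  have h7 : (ε.num : ℚ) = ε * ε.den := by
    rw [Rat.mul_den_eq_num]
  rw [h7] at h5' h6'
  constructor
  · refine le_of_mul_le_mul_right ?_ hd; linarith
  · refine le_of_mul_le_mul_right ?_ hd; linarith

theorem sum_range_items {M : Type*} [AddCommMonoid M] (f : ℤ → ℤ → ℕ → M) :
    ∑ i ∈ Finset.range I.n, f (I.items.a i) (I.items.b i) (I.items.p i) =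
      ∑ i, f (I.a i) (I.b i) (I.p i) := by
  rw [Finset.sum_range]
  simp [items]

theorem params (h0 : 0 < ε) (h1 : ε < 1) :
    I.items.Params (levels ε) I.slopeBound (I.valueBound ε) where
  n_pos := I.n_pos
  p_pos := fun i hi => by
    change i < I.n at hi
    simpa [items, hi] using I.p_pos ⟨i, hi⟩
  E_ge := levels_ge h0 h1
  S_eq := by
    have := I.sum_range_items fun a b _ => a * a + b * b
    change _ = (I.W : ℤ) + 1 + ∑ i ∈ Finset.range I.n, _
    rw [this, slopeBound]
    push_cast
    simp only [pow_two, abs_mul_abs_self]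
  u_ge := by unfold valueBound; omega
  u_ge' := by
    have := I.sum_range_items fun _ _ p => p
    change 40 * I.n ^ 2 * _ * (∑ i ∈ Finset.range I.n, _ + 1) ≤ _
    rw [this]; unfold valueBound; omega

theorem mem_initConfig (z : ℕ) : (I.initConfig ε).mem z = (I.inputList ε).getD z 0 := by
  simp [initConfig]

theorem input : I.items.Input ε.num ε.den (I.initState ε) where
  raw_n := (I.mem_initConfig (ε := ε) 0).trans rfl
  raw_W := (I.mem_initConfig (ε := ε) 1).trans rfl
  raw_num := (I.mem_initConfig (ε := ε) 2).trans rfl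
  raw_den := (I.mem_initConfig (ε := ε) 3).trans rfl
  raw_p := fun i hi => by
    change i < I.n at hi
    have := I.mem_initConfig (ε := ε) (4 + i)
    push_cast at this
    refine this.trans ?_
    have e : (4 + i) = i + 1 + 1 + 1 + 1 := by ring
    simp [inputList, items, e, List.getElem?_append, hi]
  raw_a := fun i hi => by
    change i < I.n at hi
    have := I.mem_initConfig (ε := ε) (4 + I.n + i)
    push_cast at this
    refine this.trans ?_
    have e : (4 + I.n + i) = I.n + i + 1 + 1 + 1 + 1 := by ring
    simp [inputList, items, e, List.getElem?_append, hi]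
  raw_b := fun i hi => by
    change i < I.n at hi
    have := I.mem_initConfig (ε := ε) (4 + 2 * I.n + i)
    push_cast at this
    refine this.trans ?_
    have e : (4 + 2 * I.n + i) = I.n + (I.n + i) + 1 + 1 + 1 + 1 := by ring
    simp [inputList, items, e, hi]

theorem W_le_slopeBound : I.W ≤ I.slopeBound := by unfold slopeBound; omega

theorem natAbs_le_slopeBound (i : Fin I.n) :
    (I.a i).natAbs ≤ I.slopeBound ∧ (I.b i).natAbs ≤ I.slopeBound := by
  have h1 := Finset.single_le_sum (f := fun i => (I.a i).natAbs ^ 2 + (I.b i).natAbs ^ 2)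
    (fun _ _ => Nat.zero_le _) (Finset.mem_univ i)
  have h2 := Nat.le_self_pow (n := 2) (by norm_num) (I.a i).natAbs
  have h3 := Nat.le_self_pow (n := 2) (by norm_num) (I.b i).natAbs
  unfold slopeBound
  constructor <;> omega

theorem natAbs_getD_le {l : List ℤ} {u : ℕ} (h : ∀ x ∈ l, x.natAbs ≤ u) (z : ℕ) :
    (l.getD z 0).natAbs ≤ u := by
  rw [List.getD_eq_getElem?_getD]
  rcases hz : l[z]? with _ | x
  · simp
  · simpa using h x (List.mem_of_getElem? hz)

theorem natAbs_initConfig_le (h0 : 0 < ε) (h1 : ε < 1) (z : ℤ) :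
    ((I.initConfig ε).mem z).natAbs ≤ I.valueBound ε := by
  have hP := I.params h0 h1
  have hn : I.n ≤ I.valueBound ε := by have := hP.n_le; change I.n + 3 ≤ _ at this; omega
  have hS : I.slopeBound ≤ I.valueBound ε := by have := hP.S_le; omega
  have hd : ε.den ≤ I.valueBound ε := by unfold valueBound; omega
  have hp : ∀ i, I.p i ≤ I.valueBound ε := fun i => by
    have h2 := Finset.single_le_sum (f := I.p) (fun _ _ => Nat.zero_le _) (Finset.mem_univ i)
    have h3 : 0 < 40 * I.n ^ 2 * levels ε ^ 2 := by
      have := I.n_pos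
      have := levels_ge h0 h1
      positivity
    have h4 := Nat.le_mul_of_pos_left (∑ i, I.p i + 1) h3
    unfold valueBound; omega
  have key : ∀ x ∈ I.inputList ε, x.natAbs ≤ I.valueBound ε := by
    have hnum := num_lt_den h1
    have hpos := Rat.num_pos.2 h0
    simp only [inputList, List.mem_append, List.mem_cons, List.mem_ofFn, List.not_mem_nil, or_false]
    rintro x ((((rfl | rfl | rfl | rfl) | ⟨i, rfl⟩) | ⟨i, rfl⟩) | ⟨i, rfl⟩)
    · simpa using hn
    · simpa using I.W_le_slopeBound.trans hS
    · omega
    · simpa using hd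
    · simpa using hp i
    · exact (I.natAbs_le_slopeBound i).1.trans hS
    · exact (I.natAbs_le_slopeBound i).2.trans hS
  unfold initConfig
  dsimp only
  split_ifs
  exacts [natAbs_getD_le key _, by simp]

/-- The program halts in time with a correct output, and handles small numbers only. -/
theorem program_spec : ∃ d : ℕ, ∀ (I : ParamKnapsack) (ε : ℚ), 0 < ε → ε < 1 →
    ∃ t ≤ totalTime I.n (levels ε) (iterations I.n I.slopeBound) + 1,
      HaltsWithin program I ε t ∧
      (∀ s ≤ t, (program.run (I.initConfig ε) s).BoundedBy (I.valueBound ε ^ d)) ∧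
      ∃ S : ParamSolution I.n, Outputs (program.run (I.initConfig ε) t) S ∧ I.IsApprox ε S := by
  obtain ⟨d, hd⟩ := Cmd.exists_mag_le Prog.main
  -- The exponent is made positive so that the power also bounds the input and the stored values
  -- themselves.
  refine ⟨d + 1, fun I ε h0 h1 => ?_⟩
  have hP := I.params h0 h1
  have hu : 3 ≤ I.valueBound ε := by have := hP.n_le; omega
  have hB : Prog.main.mag (I.valueBound ε) ≤ I.valueBound ε ^ (d + 1) :=
    (hd _ (by omega)).trans (Nat.pow_le_pow_right (by omega) (by omega))
  have hbd : I.valueBound ε ≤ I.valueBound ε ^ (d + 1) := Nat.le_self_pow (by omega) _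
  obtain ⟨t, ht, k', σ', hr, hpc, hs, hr1, Z, k, x, y, s, hk, hout, hx, hy, hdone⟩ :=
    (main_spec hP (iterBound hP) I.input (levels_eq h0) (fun _ => rfl) fun _ _ _ => rfl).compile
      Var.ctorIdx_injective
      ⟨fun _ => by simp [initState], fun _ _ _ => by simp [initState],
        I.natAbs_initConfig_le h0 h1⟩ hB
      (k := I.initConfig ε) ⟨fun _ => by simp [initConfig],
        fun z => (I.natAbs_initConfig_le h0 h1 z).trans hbd⟩
      ⟨fun _ => rfl, fun _ _ => rfl, fun r i j hi hj => by
        have := addr_neg (r := r) hi hj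
        simp [initConfig, initState, not_le.2 this]⟩ rfl
  change Reach program _ _ _ _ at hr
  refine ⟨t, ht, ?_, hr.2, ?_⟩
  · change program.length ≤ _
    rw [hr.1]; exact hpc.ge
  obtain ⟨sol, happ, hsk, hbr, hsol⟩ := I.exists_solution (levels_mul h0).1 hP hout hx hy hdone
  refine ⟨sol, ?_, happ⟩
  rw [hr.1]
  have hraw : ∀ z : ℤ, 0 ≤ z → k'.mem z = σ'.raw z := hs.raw
  refine ⟨by rw [hsk, ← hk]; exact hs.reg .kk, fun i => ?_, fun j i => ?_⟩
  · have hi : (i : ℕ) < k := hsk ▸ i.2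
    rw [hr1, hraw _ (by positivity), hraw _ (by positivity), hraw _ (by positivity), zero_add,
      hout.raw_x i hi, hout.raw_y i hi, hout.raw_left i hi (by omega), (hbr i).1]
    refine ⟨hout.y_pos _ (by omega) hi, rfl, ?_⟩
    simp only [(hbr i).2]
  · have hj : (j : ℕ) < k + 1 := hsk ▸ j.2
    have h2 : k'.reg 2 = 3 * ((Z : ℤ) + 1) := (hs.reg .b2).trans hout.reg_b2
    rw [h2, hraw _ (by positivity)]
    refine (hout.rows j hj i i.2).trans ?_
    simp only [hsol]

end ParamKnapsack

/-! ### Estimates for the running time and the size of the numbers. -/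

/-- The main term counts `n` items, `log n + 1` scales, `E` levels, two directions, `IT + 1`
iterations and `O(n ^ 2 * E)` per iteration. The output is quadratic in the number `O(n * E * log
n)` of records, which is dominated because `log n + 1 ≤ n`. -/
theorem Items.totalTime_le {n E IT : ℕ} (hn : 0 < n) (hE : 0 < E) :
    totalTime n E IT + 1 ≤ 10000 * (n ^ 3 * (Nat.log 2 n + 1) * E ^ 2 * (IT + 1)) := by
  set l := Nat.log 2 n + 1 with hl
  have hl0 : 1 ≤ l := by omega
  have hln : l ≤ n := Nat.log_lt_self 2 hn.ne'
  obtain ⟨J, hJ⟩ : ∃ J, J = IT + 1 := ⟨_, rfl⟩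
  have hJ0 : 1 ≤ J := by omega
  have hq : n * (E - 1) + 1 ≤ n * E := by
    obtain ⟨F, rfl⟩ := Nat.exists_eq_add_of_le' hE
    simp only [Nat.add_sub_cancel, Nat.mul_add]; omega
  have h1 : n * E ≤ n ^ 2 * E := Nat.mul_le_mul_right _ (Nat.le_self_pow (by norm_num) n)
  have h2 : n ≤ n ^ 2 * E := (Nat.le_mul_of_pos_right n hE).trans h1
  have hstep : stepTime n E + 5 ≤ 1137 * (n ^ 2 * E) := by
    unfold stepTime
    have h3 : n * ((n * (E - 1) + 1) * 114 + 378) ≤ n * (n * E * 114 + 378) := by gcongr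
    have h4 : n * (n * E * 114 + 378) = 114 * (n ^ 2 * E) + 378 * n := by ring
    linarith
  have hscale : scaleTime n E IT ≤ 2484 * (n ^ 2 * E ^ 2 * J) := by
    unfold scaleTime
    rw [← hJ]
    have h3 : E * (2 * (J * (stepTime n E + 5) + 60) + 50) ≤
        E * (2 * (J * (1137 * (n ^ 2 * E)) + 60) + 50) := by gcongr
    have h4 : E * (2 * (J * (1137 * (n ^ 2 * E)) + 60) + 50) =
      2274 * (n ^ 2 * E ^ 2 * J) + 170 * E := by ring
    have h5 : E * 1 ≤ E * (n ^ 2 * E * J) := Nat.mul_le_mul_left _ (Nat.mul_pos (by omega) hJ0)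
    have h6 : E * (n ^ 2 * E * J) = n ^ 2 * E ^ 2 * J := by ring
    omega
  have hmain : n * (l * scaleTime n E IT + 154) ≤ 2638 * (n ^ 3 * l * E ^ 2 * J) := by
    have h3 : n * (l * scaleTime n E IT + 154) ≤ n * (l * (2484 * (n ^ 2 * E ^ 2 * J)) + 154) := by
      gcongr
    have h4 : n * (l * (2484 * (n ^ 2 * E ^ 2 * J)) + 154) =
      2484 * (n ^ 3 * l * E ^ 2 * J) + 154 * n := by ring
    have h5 : n * 1 ≤ n * (n ^ 2 * l * E ^ 2 * J) := Nat.mul_le_mul_left _ (by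
      have : 0 < n ^ 2 * l * E ^ 2 * J := by positivity
      omega)
    have h6 : n * (n ^ 2 * l * E ^ 2 * J) = n ^ 3 * l * E ^ 2 * J := by ring
    omega
  have hrec : (recBound n E + 1) * (recBound n E * 260 + n * 60 + 260) ≤
      6800 * (n ^ 3 * l * E ^ 2 * J) := by
    obtain ⟨X, hX⟩ : ∃ X, X = n * E * l := ⟨_, rfl⟩
    have hX1 : n * 1 ≤ X := by
      rw [hX, mul_assoc]; exact Nat.mul_le_mul_left _ (Nat.mul_pos hE hl0)
    have hR : recBound n E = 4 * X := by unfold recBound; rw [hX, ← hl]; ring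
    rw [hR]
    have h3 : (4 * X + 1) * (4 * X * 260 + n * 60 + 260) ≤ (5 * X) * (1360 * X) :=
      Nat.mul_le_mul (by omega) (by omega)
    have h4 : 5 * X * (1360 * X) = 6800 * (n ^ 2 * l * E ^ 2 * l) := by rw [hX]; ring
    have h5 : n ^ 2 * l * E ^ 2 * l ≤ n ^ 2 * l * E ^ 2 * n * J := by
      calc n ^ 2 * l * E ^ 2 * l ≤ n ^ 2 * l * E ^ 2 * n := by gcongr
        _ ≤ _ := Nat.le_mul_of_pos_right _ hJ0
    have h6 : n ^ 2 * l * E ^ 2 * n * J = n ^ 3 * l * E ^ 2 * J := by ring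
    omega
  have hpos : 0 < n ^ 3 * l * E ^ 2 * J := by positivity
  unfold totalTime
  rw [← hl, ← hJ]
  omega

/-- Used with `k = log (n + 1)`: the cube of the logarithm is at most linear in `n`. -/
theorem Nat.succ_pow_three_le (k : ℕ) : (k + 1) ^ 3 ≤ 8 * 2 ^ k := by
  rcases Nat.lt_or_ge k 3 with hk | hk
  · interval_cases k <;> norm_num
  induction k, hk using Nat.le_induction with
  | base => norm_num
  | succ k hk ih =>
    have : (k + 1 + 1) ^ 3 ≤ 2 * (k + 1) ^ 3 := by
      obtain ⟨j, rfl⟩ := Nat.exists_eq_add_of_le hk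
      ring_nf
      nlinarith [sq_nonneg j, Nat.zero_le (j ^ 3)]
    rw [pow_succ 2]
    omega

/-- The second iteration bound is of order `n ^ 2 * log² n`; with the logarithm from the number of
scales this makes `n ^ 2 * log³ n`, and the cube is absorbed by one factor `n`. -/
theorem Items.log_mul_iterations_le {n S : ℕ} (hn : 0 < n) :
    (Nat.log 2 n + 1) * (iterations n S + 1) ≤ 3136 * n ^ 3 := by
  set l := Nat.log 2 (n + 1) + 1 with hl
  have h1 : Nat.log 2 n + 1 ≤ l := by
    have : Nat.log 2 n ≤ Nat.log 2 (n + 1) := Nat.log_mono_right (by omega)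
    omega
  have h2 : iterations n S + 1 ≤ 49 * ((n + 1) ^ 2 * l ^ 2) := by
    have h3 : iterations n S ≤ 3 * (4 * (n + 1) * l) * (4 * (n + 1) * l) := min_le_right _ _
    have h4 : 3 * (4 * (n + 1) * l) * (4 * (n + 1) * l) = 48 * ((n + 1) ^ 2 * l ^ 2) := by ring
    have h5 : 0 < (n + 1) ^ 2 * l ^ 2 := by positivity
    omega
  have h3 : l ^ 3 ≤ 8 * (n + 1) := (Nat.succ_pow_three_le _).trans
    (Nat.mul_le_mul_left _ (Nat.pow_log_le_self 2 (by omega)))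
  calc (Nat.log 2 n + 1) * (iterations n S + 1) ≤ l * (49 * ((n + 1) ^ 2 * l ^ 2)) :=
        Nat.mul_le_mul h1 h2
    _ = 49 * (n + 1) ^ 2 * l ^ 3 := by ring
    _ ≤ 49 * (n + 1) ^ 2 * (8 * (n + 1)) := by gcongr
    _ = 392 * (n + 1) ^ 3 := by ring
    _ ≤ 392 * (2 * n) ^ 3 := by gcongr; omega
    _ = _ := by ring

namespace ParamKnapsack
variable (I : ParamKnapsack) {ε : ℚ}

/-- `S` is at most quadratic in `M`, so `log S` is of order `log M`. -/
theorem slopeBound_le : I.slopeBound ≤ I.bigM + 1 + 2 * I.bigM ^ 2 := by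
  set m := Finset.univ.sup fun i => max (I.a i).natAbs (I.b i).natAbs with hm
  have hW : I.W ≤ I.bigM := le_max_left _ _
  have hM : I.n * m ≤ I.bigM := le_max_right _ _
  have h1 : ∀ i, (I.a i).natAbs ^ 2 + (I.b i).natAbs ^ 2 ≤ 2 * m ^ 2 := fun i => by
    have h2 : max (I.a i).natAbs (I.b i).natAbs ≤ m :=
      Finset.le_sup (f := fun i => max (I.a i).natAbs (I.b i).natAbs) (Finset.mem_univ i)
    have h3 := Nat.pow_le_pow_left ((le_max_left _ _).trans h2) 2
    have h4 := Nat.pow_le_pow_left ((le_max_right _ _).trans h2) 2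
    omega
  have h2 : ∑ i, ((I.a i).natAbs ^ 2 + (I.b i).natAbs ^ 2) ≤ I.n * (2 * m ^ 2) := by
    simpa using Finset.sum_le_card_nsmul Finset.univ _ _ fun i _ => h1 i
  have h3 : I.n * (2 * m ^ 2) ≤ 2 * I.bigM ^ 2 := by
    calc I.n * (2 * m ^ 2) = 2 * (I.n * m ^ 2) := by ring
      _ ≤ 2 * (I.n ^ 2 * m ^ 2) := by gcongr; exact Nat.le_self_pow (by norm_num) _
      _ = 2 * (I.n * m) ^ 2 := by ring
      _ ≤ _ := by gcongr
  unfold slopeBound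
  omega

theorem iterations_le : (iterations I.n I.slopeBound + 1 : ℝ) ≤ 14 * max 1 (Real.log I.bigM) := by
  have h1 : iterations I.n I.slopeBound ≤ 2 * (Nat.log 2 I.slopeBound + 1) + 1 := min_le_left _ _
  have h2 : (Nat.log 2 I.slopeBound : ℝ) ≤ 2 + 3 * max 1 (Real.log I.bigM) := by
    have hS := I.slopeBound_le
    rcases Nat.eq_zero_or_pos I.bigM with h0 | h0
    · rw [h0] at hS
      -- For `M = 0` the logarithm of `M` has the default value 0; here `S ≤ 1`.
      have h3 : Nat.log 2 I.slopeBound = 0 := Nat.log_of_lt (by omega)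
      rw [h3]
      have := le_max_left (1 : ℝ) (Real.log I.bigM)
      push_cast; linarith
    · have h3 : I.slopeBound ≤ 4 * I.bigM ^ 2 := by nlinarith
      have h4 : 2 ^ Nat.log 2 I.slopeBound ≤ 4 * I.bigM ^ 2 := by
        refine (Nat.pow_log_le_self 2 ?_).trans h3
        unfold slopeBound; omega
      have h5 : (2 : ℝ) ^ Nat.log 2 I.slopeBound ≤ 2 ^ 2 * (I.bigM : ℝ) ^ 2 := by
        have : ((2 ^ Nat.log 2 I.slopeBound : ℕ) : ℝ) ≤ ((4 * I.bigM ^ 2 : ℕ) : ℝ) := by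
          exact_mod_cast h4
        push_cast at this
        linarith
      have h6 := Real.log_le_log (by positivity) h5
      have hM : (0 : ℝ) < I.bigM := by exact_mod_cast h0
      rw [Real.log_mul (by norm_num) (by positivity), Real.log_pow, Real.log_pow, Real.log_pow]
        at h6
      have h7 := Real.log_two_gt_d9
      have h8 := le_max_right (1 : ℝ) (Real.log I.bigM)
      have h9 := le_max_left (1 : ℝ) (Real.log I.bigM)
      push_cast at h6
      by_contra! h10
      have h11 := mul_lt_mul_of_pos_right h10 (by linarith : 0 < Real.log 2)
      nlinarith
  have h3 : (iterations I.n I.slopeBound : ℝ) ≤ 2 * (Nat.log 2 I.slopeBound + 1) + 1 := by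
    exact_mod_cast h1
  have h4 := le_max_left (1 : ℝ) (Real.log I.bigM)
  linarith

/-- With `L = log (n / e) ≥ log n` the denominator is `log n + log L ≤ 2 * L`. -/
theorem half_le_ratio {n e : ℝ} (hn : 2 ≤ n) (h0 : 0 < e) (h1 : e < 1) :
    n / 2 ≤ n * Real.log (n / e) / Real.log (n * Real.log (n / e)) := by
  have hne : n ≤ n / e := by
    rw [le_div_iff₀ h0]; nlinarith
  have hL : Real.log n ≤ Real.log (n / e) := Real.log_le_log (by linarith) hne
  have hn2 : Real.log 2 ≤ Real.log n := Real.log_le_log (by norm_num) hn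
  have h2 := Real.log_two_gt_d9
  set L := Real.log (n / e)
  have hL0 : 0 < L := by linarith
  have h3 : Real.log (n * L) ≤ 2 * L := by
    rw [Real.log_mul (by linarith) hL0.ne']
    have := Real.log_le_sub_one_of_pos hL0
    linarith
  have h4 : 0 < Real.log (n * L) := Real.log_pos (by nlinarith)
  rw [le_div_iff₀ h4]
  nlinarith

theorem totalTime_le_timeBound (h0 : 0 < ε) (h1 : ε < 1) :
    ((totalTime I.n (levels ε) (iterations I.n I.slopeBound) + 1 : ℕ) : ℝ) ≤
      2 ^ 30 * I.timeBound ε := by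
  have hn := I.n_pos
  have hE := levels_ge h0 h1
  have e0 : (0 : ℝ) < ε := by exact_mod_cast h0
  have e1 : (ε : ℝ) < 1 := by exact_mod_cast h1
  have hn1 : (1 : ℝ) ≤ I.n := by exact_mod_cast hn
  set l := Nat.log 2 I.n + 1 with hl
  have hln : (l : ℝ) ≤ I.n := by exact_mod_cast (Nat.log_lt_self 2 hn.ne' : l ≤ I.n)
  obtain ⟨J, hJ⟩ : ∃ J, J = iterations I.n I.slopeBound + 1 := ⟨_, rfl⟩
  -- `levels ε * ε ≤ 2 + ε < 3`.
  have hEe : (levels ε : ℝ) ^ 2 ≤ 9 / (ε : ℝ) ^ 2 := by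
    have h2 : ((levels ε : ℝ) - 1) * ε ≤ 2 := by exact_mod_cast (levels_mul h0).2
    rw [le_div_iff₀ (by positivity), ← mul_pow]
    have h3 : (levels ε : ℝ) * ε ≤ 3 := by linarith
    have h4 : 0 ≤ (levels ε : ℝ) * ε := by positivity
    nlinarith
  -- The factor `n ^ 5` leaves `n ^ 2` for the scales and the iterations. Against `log M` this is
  -- enough, as `log n + 1 ≤ n`. Against the second term, `3136 * n ^ 3 = 6272 * n ^ 2 * (n / 2)`.
  have hlJ : (l : ℝ) * J ≤ 6272 * ((I.n : ℝ) ^ 2 * max 1 (min (Real.log (I.bigM : ℝ))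
      ((I.n : ℝ) * Real.log ((I.n : ℝ) / (ε : ℝ)) /
        Real.log ((I.n : ℝ) * Real.log ((I.n : ℝ) / (ε : ℝ)))))) := by
    rw [max_min_distrib_left]
    have hsq : (I.n : ℝ) ≤ (I.n : ℝ) ^ 2 := by nlinarith
    rcases min_choice (max 1 (Real.log (I.bigM : ℝ))) (max 1 ((I.n : ℝ) *
      Real.log ((I.n : ℝ) / (ε : ℝ)) / Real.log ((I.n : ℝ) * Real.log ((I.n : ℝ) / (ε : ℝ)))))
      with h | h <;> rw [h]
    · have h2 : (J : ℝ) ≤ 14 * max 1 (Real.log I.bigM) := by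
        rw [hJ]; push_cast; exact I.iterations_le
      have h3 : (0 : ℝ) ≤ max 1 (Real.log I.bigM) := zero_le_one.trans (le_max_left _ _)
      calc (l : ℝ) * J ≤ (I.n : ℝ) ^ 2 * (14 * max 1 (Real.log I.bigM)) := by
            gcongr; exact hln.trans hsq
        _ ≤ _ := by nlinarith [mul_nonneg (sq_nonneg (I.n : ℝ)) h3]
    · have h2 : (l : ℝ) * J ≤ 3136 * (I.n : ℝ) ^ 3 := by
        have := log_mul_iterations_le (S := I.slopeBound) hn
        rw [← hl, ← hJ] at this
        exact_mod_cast this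
      have h3 : (I.n : ℝ) / 2 ≤ max 1 ((I.n : ℝ) * Real.log ((I.n : ℝ) / (ε : ℝ)) /
          Real.log ((I.n : ℝ) * Real.log ((I.n : ℝ) / (ε : ℝ)))) := by
        rcases lt_or_ge I.n 2 with h4 | h4
        · refine le_trans ?_ (le_max_left _ _)
          have : (I.n : ℝ) ≤ 1 := by exact_mod_cast Nat.le_of_lt_succ h4
          linarith
        · exact (half_le_ratio (by exact_mod_cast h4) e0 e1).trans (le_max_right _ _)
      have h4 := mul_le_mul_of_nonneg_left h3 (sq_nonneg (I.n : ℝ))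
      nlinarith
  have hpos : 0 ≤ (I.n : ℝ) ^ 5 / (ε : ℝ) ^ 2 * max 1 (min (Real.log (I.bigM : ℝ))
      ((I.n : ℝ) * Real.log ((I.n : ℝ) / (ε : ℝ)) /
        Real.log ((I.n : ℝ) * Real.log ((I.n : ℝ) / (ε : ℝ))))) :=
    mul_nonneg (by positivity) (zero_le_one.trans (le_max_left _ _))
  have h2 : ((totalTime I.n (levels ε) (iterations I.n I.slopeBound) + 1 : ℕ) : ℝ) ≤
      10000 * ((I.n : ℝ) ^ 3 * l * (levels ε : ℝ) ^ 2 * J) := by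
    have := totalTime_le (IT := iterations I.n I.slopeBound) hn (by omega : 0 < levels ε)
    rw [← hl, ← hJ] at this
    exact_mod_cast this
  refine h2.trans ?_
  unfold timeBound
  set B := max 1 (min (Real.log (I.bigM : ℝ)) ((I.n : ℝ) * Real.log ((I.n : ℝ) / (ε : ℝ)) /
    Real.log ((I.n : ℝ) * Real.log ((I.n : ℝ) / (ε : ℝ)))))
  calc 10000 * ((I.n : ℝ) ^ 3 * l * (levels ε : ℝ) ^ 2 * J)
      = 10000 * ((I.n : ℝ) ^ 3 * (levels ε : ℝ) ^ 2 * (l * J)) := by ring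
    _ ≤ 10000 * ((I.n : ℝ) ^ 3 * (9 / (ε : ℝ) ^ 2) * (6272 * ((I.n : ℝ) ^ 2 * B))) := by gcongr
    _ = 564480000 * ((I.n : ℝ) ^ 5 / (ε : ℝ) ^ 2 * B) := by ring
    _ ≤ _ := by nlinarith

theorem bigM_lt : I.bigM < 2 ^ I.encodingLength := by
  unfold bigM encodingLength
  set s := ∑ i, (Nat.size (I.p i) + Nat.size (I.a i).natAbs + Nat.size (I.b i).natAbs)
  have hsum : ∀ i, Nat.size (I.a i).natAbs ≤ s ∧ Nat.size (I.b i).natAbs ≤ s := fun i => by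
    have h : Nat.size (I.p i) + Nat.size (I.a i).natAbs + Nat.size (I.b i).natAbs ≤ s :=
      Finset.single_le_sum (f := fun i => Nat.size (I.p i) + Nat.size (I.a i).natAbs +
        Nat.size (I.b i).natAbs) (fun _ _ => Nat.zero_le _) (Finset.mem_univ i)
    omega
  refine max_lt ((Nat.lt_size_self _).trans_le (Nat.pow_le_pow_right (by norm_num) (by omega))) ?_
  have h1 : (Finset.univ.sup fun i => max (I.a i).natAbs (I.b i).natAbs) < 2 ^ s := by
    rw [Finset.sup_lt_iff (by simp)]
    intro i _
    exact max_lt ((Nat.lt_size_self _).trans_le (Nat.pow_le_pow_right (by norm_num) (hsum i).1))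
      ((Nat.lt_size_self _).trans_le (Nat.pow_le_pow_right (by norm_num) (hsum i).2))
  calc _ < 2 ^ I.n * 2 ^ s := Nat.mul_lt_mul'' Nat.lt_two_pow_self h1
    _ ≤ _ := by rw [← pow_add]; exact Nat.pow_le_pow_right (by norm_num) (by omega)

/-- The base is at least 2, so it absorbs the constant in 30 factors. Five more are for `n`, two for
`1 / ε`, and one for `log M`, which is at most the encoding length. -/
theorem timeBound_le (h0 : 0 < ε) (h1 : ε < 1) :
    2 ^ 30 * I.timeBound ε ≤ ((I.encodingLength : ℝ) + 1 / (ε : ℝ)) ^ 38 := by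
  have e0 : (0 : ℝ) < ε := by exact_mod_cast h0
  have e1 : (ε : ℝ) < 1 := by exact_mod_cast h1
  have hn : (1 : ℝ) ≤ I.n := by exact_mod_cast I.n_pos
  have hne : (I.n : ℝ) ≤ I.encodingLength := by
    exact_mod_cast (by unfold encodingLength; omega : I.n ≤ I.encodingLength)
  have he : 1 < 1 / (ε : ℝ) := by rwa [lt_div_iff₀ e0, one_mul]
  set X := (I.encodingLength : ℝ) + 1 / (ε : ℝ)
  have hX : 2 ≤ X := by linarith
  have hM : Real.log I.bigM ≤ X := by
    rcases Nat.eq_zero_or_pos I.bigM with h | h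
    · rw [h]; simp; linarith
    · have h2 : (I.bigM : ℝ) ≤ 2 ^ I.encodingLength := by exact_mod_cast I.bigM_lt.le
      have h3 := Real.log_le_log (by exact_mod_cast h) h2
      rw [Real.log_pow] at h3
      have h4 := Real.log_two_lt_d9
      nlinarith
  have hB : max 1 (min (Real.log (I.bigM : ℝ)) ((I.n : ℝ) * Real.log ((I.n : ℝ) / (ε : ℝ)) /
      Real.log ((I.n : ℝ) * Real.log ((I.n : ℝ) / (ε : ℝ))))) ≤ X :=
    max_le (by linarith) ((min_le_left _ _).trans hM)
  have hq : (I.n : ℝ) ^ 5 / (ε : ℝ) ^ 2 ≤ X ^ 5 * X ^ 2 := by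
    rw [div_eq_mul_one_div, ← one_div_pow]
    gcongr <;> linarith
  unfold timeBound
  calc _ ≤ X ^ 30 * ((X ^ 5 * X ^ 2) * X) := by gcongr
    _ = X ^ 38 := by ring

/-- The magnitude `m` is at least 4, so constants cost powers of `m` as well: `40 ≤ m ^ 3`. Both `S`
and the number of levels are at most `m ^ 2`. -/
theorem valueBound_le (h0 : 0 < ε) (h1 : ε < 1) : I.valueBound ε ≤ I.magnitude ε ^ 11 := by
  have hn := I.n_pos
  have hnum : 1 ≤ ε.num := Rat.num_pos.2 h0
  have hden : 2 ≤ ε.den := by have := num_lt_den h1; omega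
  have hsplit : I.magnitude ε =
      I.n + I.W + (∑ i, I.p i + ∑ i, ((I.a i).natAbs + (I.b i).natAbs)) + ε.den := by
    rw [magnitude, ← Finset.sum_add_distrib]
    simp only [add_assoc]
  have hp : 1 ≤ ∑ i, I.p i := by
    have := Finset.single_le_sum (f := I.p) (fun _ _ => Nat.zero_le _)
      (Finset.mem_univ ⟨0, hn⟩)
    have := I.p_pos ⟨0, hn⟩
    omega
  have hsq : ∑ i, ((I.a i).natAbs ^ 2 + (I.b i).natAbs ^ 2) ≤
      (∑ i, ((I.a i).natAbs + (I.b i).natAbs)) ^ 2 :=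
    (Finset.sum_le_sum fun i _ => by
    nlinarith [Nat.zero_le ((I.a i).natAbs * (I.b i).natAbs)]).trans
      (Finset.sum_sq_le_sq_sum_of_nonneg fun _ _ => Nat.zero_le _)
  have hE : levels ε ≤ 2 * ε.den + 1 := by
    have h2 : 2 * (ε.den : ℤ) / ε.num ≤ 2 * ε.den := Int.ediv_le_self _ (by positivity)
    have := levels_eq h0
    omega
  set m := I.magnitude ε
  set A := ∑ i, ((I.a i).natAbs + (I.b i).natAbs)
  have hm : 4 ≤ m := by omega
  have hS : I.slopeBound ≤ m ^ 2 := by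
    have h2 : I.W + A + 2 ≤ m := by omega
    have h3 := Nat.pow_le_pow_left h2 2
    unfold slopeBound
    nlinarith
  have hEm : levels ε ≤ m ^ 2 := by nlinarith
  have h40 : 40 ≤ m ^ 3 := le_trans (by norm_num) (Nat.pow_le_pow_left hm 3)
  have hm10 : m ≤ m ^ 10 := Nat.le_self_pow (by norm_num) m
  unfold valueBound
  calc 40 * I.slopeBound ^ 3 + 40 * I.n ^ 2 * levels ε ^ 2 * (∑ i, I.p i + 1) + ε.den
      ≤ m ^ 3 * (m ^ 2) ^ 3 + m ^ 3 * m ^ 2 * (m ^ 2) ^ 2 * m + m ^ 10 := by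
        gcongr <;> omega
    _ = m ^ 9 + 2 * m ^ 10 := by ring
    _ ≤ m ^ 10 + 2 * m ^ 10 := by gcongr <;> omega
    _ ≤ m * m ^ 10 := by
        have := Nat.mul_le_mul_right (m ^ 10) hm
        omega
    _ = m ^ 11 := by ring

end ParamKnapsack

theorem theorem1 :
    ∃ P : RAMProgram, ParamKnapsack.IsFPTAS P ∧
      ∃ C : ℝ, ∀ (I : ParamKnapsack) (ε : ℚ), 0 < ε → ε < 1 →
        ∃ t : ℕ, ParamKnapsack.HaltsWithin P I ε t ∧ (t : ℝ) ≤ C * I.timeBound ε := by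
  obtain ⟨d, hd⟩ := ParamKnapsack.program_spec
  have htime : ∀ (I : ParamKnapsack) (ε : ℚ), 0 < ε → ε < 1 → ∀ t : ℕ,
      t ≤ Items.totalTime I.n (ParamKnapsack.levels ε) (Items.iterations I.n I.slopeBound) + 1 →
      (t : ℝ) ≤ 2 ^ 30 * I.timeBound ε := fun I ε h0 h1 t ht =>
    le_trans (by exact_mod_cast ht) (I.totalTime_le_timeBound h0 h1)
  -- The exponent 38 serves the running time; `11 * d` arises because values are bounded by the
  -- `d`-th power of `valueBound`, which is at most the 11th power of the magnitude.
  refine ⟨ParamKnapsack.program, ⟨max 38 (11 * d), fun I ε h0 h1 => ?_⟩, 2 ^ 30,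
    fun I ε h0 h1 => ?_⟩
  · obtain ⟨t, ht, hhalt, hbd, hout⟩ := hd I ε h0 h1
    refine ⟨t, hhalt, ?_, fun s hs => ?_, hout⟩
    · refine ((htime I ε h0 h1 t ht).trans (I.timeBound_le h0 h1)).trans
        (pow_le_pow_right₀ ?_ (le_max_left _ _))
      have h2 : (1 : ℝ) ≤ I.encodingLength := by
        exact_mod_cast I.n_pos.trans_le (by unfold ParamKnapsack.encodingLength; omega)
      have h3 : (0 : ℝ) < ε := by exact_mod_cast h0
      have : 0 < 1 / (ε : ℝ) := by positivity
      linarith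
    · have hle : I.valueBound ε ^ d ≤ I.magnitude ε ^ max 38 (11 * d) := by
        refine (Nat.pow_le_pow_left (I.valueBound_le h0 h1) d).trans ?_
        rw [← pow_mul]
        exact Nat.pow_le_pow_right (by have := I.n_pos; unfold ParamKnapsack.magnitude; omega)
          (le_max_right _ _)
      exact ⟨fun r => ((hbd s hs).1 r).trans hle, fun z => ((hbd s hs).2 z).trans hle⟩
  · obtain ⟨t, ht, hhalt, -⟩ := hd I ε h0 h1
    exact ⟨t, hhalt, htime I ε h0 h1 t ht⟩
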